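/- **Notation.** Let $r>0$, let $M=r\mathbb S^2$ be the sphere of radius $r$ with polar angle $\theta\in(0,\pi)$ and azimuth $\phi$, with surface measure $r^2\sin\theta\,d\theta\,d\phi$ and Laplace–Beltrami operator $\Delta_h$. Let $H^s_\diamond(M)$ be the Sobolev space of mean-zero functions with norm $\|f\|_{H^s_\diamond}=\|(-\Delta_h)^{s/2}f\|_{L^2(M)}$, and let $C_{H^s_\diamond\to L^q}$ denote the embedding constants, $\|f\|_{L^q(M)}\le C_{H^s_\diamond\to L^q}\|f\|_{H^s_\diamond}$. For functions $\Omega=\Omega(\theta)$ write $\Omega\in H^s(M;0)$ if $\Omega\in H^s(M)=\mathrm{dom}((I-\Delta_h)^{s/2})$, with $\|\Omega\|_{H^s}=\|(I-\Delta_h)^{s/2}\Omega\|_{L^2(M)}$; so $\|\Omega\|_{H^1}^2=\|\Omega\|^2_{L^2(M)}+\|\Omega'/r\|^2_{L^2(M)}$. Let $0<\epsilon<\pi/2$, $I=(0,\pi)$, $I'=(\epsilon,\pi-\epsilon)$ and $m\in\mathbb Z$. Let $L^2(I')$ and $H^k(I')$ be the usual spaces of complex functions on $I'$, with $\langle f,g\rangle=\int_{I'}f\bar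 g\,r^2\sin\theta\,d\theta$, and for $k\ge2$ let $$H^k_0(I')=\{\Psi\in H^k(I'):\Psi=\Psi'=0\text{ on }\partial I'\}$$ (no condition on higher derivatives). Let $H^{-2}(I')$ be the space of bounded antilinear functionals on $H^2_0(I')$; a function $f\in L^2(I')$ defines the element $\langle f,\cdot\rangle$ of it. Put $$\Delta_m\Psi=\frac1{r^2\sin\theta}(\sin\theta\,\Psi')'-\frac{m^2}{r^2\sin^2\theta}\Psi .$$ Let $\gamma>0$, $\omega,\Omega_{\mathrm{ref}}\in\mathbb R$, let $\Omega\in H^1(M;0)$ be real-valued, and put $\beta_\Omega=\Omega-\Omega_{\mathrm{ref}}$, $\tilde\alpha_\Omega=\Omega'\sin\theta+2\Omega\cos\theta$, $\alpha_\Omega=\tilde\alpha_\Omega'/(r^2\sin\theta)$. The operator $\mathbf B_m=\gamma\Delta_m^2+i\omega\Delta_m-im\beta_\Omega\Delta_m+im\alpha_\Omega$ from $H^2(I')$ to $H^{-2}(I')$ is defined weakly by $\langle\mathbf B_m\Psi,\psi\rangle=\mathbf A_m[\Psi,\psi]$ for $\psi\in H^2_0(I')$, where $$\mathbf A_m[\Psi,\psi]=\gamma\langle\Delta_m\Psi,\Delta_m\psi\rangle-i\omega\int_{I'}\frac1{r^2}\Big(\Psi'\bar\psi'+\frac{m^2}{\sin^2\theta}\Psi\bar\psi\Big)r^2\sin\theta\,d\theta-im\int_{I'}\tilde\alpha_\Omega\,(\Psi\bar\psi)'\,d\theta-im\langle\beta_\Omega\Delta_m\Psi,\psi\rangle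 ,$$ and its adjoint $\mathbf B_m^\star:H^2_0(I')\to H^{-2}(I')$ by $\langle\mathbf B_m^\star\Psi,\psi\rangle=\overline{\mathbf A_m[\psi,\Psi]}$. **Proposition 3.9.** Assume that at least one of the following holds: $$|\omega|>\frac4{\gamma^3}\big(C_{H^1_\diamond\to L^6}C_{H^{1/2}_\diamond\to L^3}\big)^4\big(\|\Omega-\Omega_{\mathrm{ref}}\|_{H^1}^2+9\|\Omega\|_{H^1}^2\big)^2,$$ $$\|\Omega'\|_{L^2(M)}\frac{|m|}{r}\,C_{H^2_\diamond\to L^3}\,C_{H^1_\diamond\to L^6}<\gamma .$$ (i) $\mathbf B_m$ is bounded from $H^2(I')$ to $H^{-2}(I')$, and its restriction $\mathbf B_m:H^2_0(I')\to H^{-2}(I')$, as well as $\mathbf B_m^\star$, is boundedly invertible. For all $f\in H^{-2}(I')$ and $u_1,u_2\in\mathbb C^2$ there is exactly one $\Psi\in H^2(I')$ with $\mathbf B_m\Psi=f$, $\Psi|_{\partial I'}=u_1$ and $\Psi'|_{\partial I'}=u_2$. For every $u\in C^\infty(I)$ with $u|_{\partial I'}=u_1$ and $u'|_{\partial I'}=u_2$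 it is given by $\Psi=\mathbf B_m^{-1}(f-g)+u$ with $g=\mathbf B_mu$, where $\mathbf B_m^{-1}:H^{-2}(I')\to H^2_0(I')$. (ii) If in addition $\Omega\in H^2(M;0)$, then $\mathbf B_m$ and $\mathbf B_m^\star$ restrict to bounded operators $H^4_0(I')\to L^2(I')$ with bounded inverses $\mathbf B_m^{-1},(\mathbf B_m^\star)^{-1}:L^2(I')\to H^4_0(I')$. -/

import Mathlib

open MeasureTheory Set Filter Topology
open scoped ENNReal ComplexConjugate

noncomputable section

namespace InertialWave

/-! ### The sphere of radius `r`, spherical harmonics and embedding constants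

Functions on the sphere are written in the spherical coordinates
`(θ, φ) ∈ (0, π) × (0, 2π)`. -/

/-- The surface measure `r² sin θ dθ dφ` of the sphere of radius `r`. -/
def sphereMeasure (r : ℝ) : Measure (ℝ × ℝ) :=
  (volume.restrict (Ioo 0 Real.pi ×ˢ Ioo 0 (2 * Real.pi))).withDensity
    fun x => ENNReal.ofReal (r ^ 2 * Real.sin x.1)

/-- The unit vector with spherical coordinates `(θ, φ)`. -/
def unitVector (x : ℝ × ℝ) : Fin 3 → ℝ :=
  ![Real.sin x.1 * Real.cos x.2, Real.sin x.1 * Real.sin x.2, Real.cos x.1]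

/-- `p` is a complex homogeneous harmonic polynomial of degree `l` in three variables. -/
def IsSolidHarmonic (l : ℕ) (p : MvPolynomial (Fin 3) ℂ) : Prop :=
  p.IsHomogeneous l ∧ ∑ i, MvPolynomial.pderiv i (MvPolynomial.pderiv i p) = 0

/-- The restriction of a polynomial to the sphere, `x ↦ p (x / |x|)`. For solid harmonics of
degree `l` these functions span the eigenspace of the Laplace-Beltrami operator of the sphere of
radius `r` with eigenvalue `-l (l + 1) / r²`. -/
def onSphere (p : MvPolynomial (Fin 3) ℂ) (x : ℝ × ℝ) : ℂ :=
  MvPolynomial.eval (fun i => ((unitVector x i : ℝ) : ℂ)) p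

/-- `f ∈ L²` of the sphere has mean zero and spherical harmonic expansion `f = ∑ₗ pₗ`, with `pₗ`
of degree `l` (the term of degree `0` is the mean). -/
structure HasHarmonicExpansion (r : ℝ) (p : ℕ → MvPolynomial (Fin 3) ℂ) (f : ℝ × ℝ → ℂ) :
    Prop where
  harmonic : ∀ l, IsSolidHarmonic l (p l)
  mean_zero : p 0 = 0
  memLp : MemLp f 2 (sphereMeasure r)
  tendsto : Tendsto
    (fun n => eLpNorm (fun x => f x - ∑ l ∈ Finset.range n, onSphere (p l) x) 2 (sphereMeasure r))
    atTop (𝓝 0)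

/-- `‖(-Δ)^{s/2} f‖_{L²}` for `f = ∑ₗ pₗ`; it is finite exactly for `f` in the mean-zero Sobolev
space of order `s`. -/
def harmonicNorm (r s : ℝ) (p : ℕ → MvPolynomial (Fin 3) ℂ) : ℝ≥0∞ :=
  (∑' l : ℕ, ENNReal.ofReal ((((l : ℝ) * (l + 1)) / r ^ 2) ^ s)
    * eLpNorm (onSphere (p l)) 2 (sphereMeasure r) ^ 2) ^ (1 / 2 : ℝ)

/-- The (best) constant of the embedding of the mean-zero Sobolev space of order `s` of the sphere
of radius `r`, with norm `‖(-Δ)^{s/2} f‖_{L²}`, into `L^q`. -/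
def embeddingConstant (r s : ℝ) (q : ℝ≥0∞) : ℝ≥0∞ :=
  sInf {C : ℝ≥0∞ | ∀ (p : ℕ → MvPolynomial (Fin 3) ℂ) (f : ℝ × ℝ → ℂ),
    HasHarmonicExpansion r p f → harmonicNorm r s p ≠ ⊤ →
      eLpNorm f q (sphereMeasure r) ≤ C * harmonicNorm r s p}

/-! ### Weak derivatives and the rotation profile -/

/-- `g` is the weak derivative of `f` on the open interval `(a, b)`. -/
def HasWeakDerivOn {E : Type*} [NormedAddCommGroup E] [NormedSpace ℝ E] (a b : ℝ)
    (f g : ℝ → E) : Prop :=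
  ∀ φ : ℝ → ℝ, ContDiff ℝ (⊤ : ℕ∞) φ → HasCompactSupport φ → tsupport φ ⊆ Ioo a b →
    ∫ x in Ioo a b, deriv φ x • f x = - ∫ x in Ioo a b, φ x • g x

/-- `f = f(θ)` is square integrable on the sphere. -/
def ZonalL2 (f : ℝ → ℝ) : Prop :=
  AEStronglyMeasurable f (volume.restrict (Ioo 0 Real.pi)) ∧
    IntegrableOn (fun θ => f θ ^ 2 * Real.sin θ) (Ioo 0 Real.pi)

/-- The `L²` norm on the sphere of radius `r` of the function `f = f(θ)`. -/
def zonalL2Norm (r : ℝ) (f : ℝ → ℝ) : ℝ :=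
  √(2 * Real.pi * ∫ θ in Ioo 0 Real.pi, f θ ^ 2 * (r ^ 2 * Real.sin θ))

/-- `f = f(θ)` is in `H¹` of the sphere, with weak derivative `f₁ = df/dθ`. -/
structure ZonalH1 (f f₁ : ℝ → ℝ) : Prop where
  memL2 : ZonalL2 f
  deriv_memL2 : ZonalL2 f₁
  weakDeriv : HasWeakDerivOn 0 Real.pi f f₁

/-- The `H¹` norm `(‖f‖² + ‖grad f‖²)^{1/2} = ‖(I - Δ)^{1/2} f‖` on the sphere of radius `r` of
`f = f(θ)` with derivative `f₁`. -/
def zonalH1Norm (r : ℝ) (f f₁ : ℝ → ℝ) : ℝ :=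
  √(zonalL2Norm r f ^ 2 + zonalL2Norm r (fun θ => f₁ θ / r) ^ 2)

/-- `f = f(θ)` is in `H²` of the sphere, that is, in `H¹` and with Laplacian
`(f'' + cot θ f') / r²` in `L²`; `f₁` and `f₂` are the weak derivatives. -/
structure ZonalH2 (f f₁ f₂ : ℝ → ℝ) : Prop where
  memH1 : ZonalH1 f f₁
  weakDeriv₂ : HasWeakDerivOn 0 Real.pi f₁ f₂
  laplacian_memL2 : ZonalL2 (fun θ => f₂ θ + Real.cos θ / Real.sin θ * f₁ θ)

/-- The large-frequency condition. -/
def LargeFrequency (r γ ω Ωref : ℝ) (Ω Ω₁ : ℝ → ℝ) : Prop :=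
  ENNReal.ofReal (4 / γ ^ 3) * (embeddingConstant r 1 6 * embeddingConstant r (1 / 2) 3) ^ 4
      * ENNReal.ofReal ((zonalH1Norm r (fun θ => Ω θ - Ωref) Ω₁ ^ 2
          + 9 * zonalH1Norm r Ω Ω₁ ^ 2) ^ 2)
    < ENNReal.ofReal |ω|

/-- The smallness condition on the derivative of the rotation. -/
def SmallShear (r γ : ℝ) (m : ℤ) (Ω₁ : ℝ → ℝ) : Prop :=
  ENNReal.ofReal (zonalL2Norm r Ω₁ * (|(m : ℝ)| / r))
      * embeddingConstant r 2 3 * embeddingConstant r 1 6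
    < ENNReal.ofReal γ

/-! ### Function spaces on `I' = (ε, π - ε)` -/

/-- Lebesgue measure on `I'`. -/
abbrev latMeasure (ε : ℝ) : Measure ℝ := volume.restrict (Ioo ε (Real.pi - ε))

instance (ε : ℝ) : IsFiniteMeasure (latMeasure ε) :=
  ⟨by simp [latMeasure]⟩

/-- `L²(I')`. -/
abbrev LatL2 (ε : ℝ) : Type := Lp ℂ 2 (latMeasure ε)

/-- A bounded continuous function times an `L²` function is integrable on `I'`. -/
theorem integrable_smul_L2 {ε : ℝ} {φ : ℝ → ℝ} (hφ : Continuous φ) (hs : HasCompactSupport φ)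
    (u : LatL2 ε) : Integrable (fun x => φ x • u x) (latMeasure ε) := by
  obtain ⟨C, hC⟩ := hφ.bounded_above_of_compact_support hs
  exact ((Lp.memLp u).integrable (by norm_num)).bdd_smul (𝕜 := ℝ) C
    hφ.aestronglyMeasurable (Eventually.of_forall hC)

theorem HasWeakDerivOn.zero_L2 (ε : ℝ) :
    HasWeakDerivOn ε (Real.pi - ε) ((0 : LatL2 ε) : ℝ → ℂ) ((0 : LatL2 ε) : ℝ → ℂ) := by
  intro φ _ _ _
  have key : ∀ χ : ℝ → ℝ,
      ∫ x, χ x • ((0 : LatL2 ε) : ℝ → ℂ) x ∂(latMeasure ε) = 0 := by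
    intro χ
    refine integral_eq_zero_of_ae ?_
    filter_upwards [Lp.coeFn_zero ℂ 2 (latMeasure ε)] with x hx
    rw [hx, Pi.zero_apply, smul_zero]
  rw [key, key, neg_zero]

theorem HasWeakDerivOn.add_L2 {ε : ℝ} {u v u' v' : LatL2 ε}
    (hu : HasWeakDerivOn ε (Real.pi - ε) u u') (hv : HasWeakDerivOn ε (Real.pi - ε) v v') :
    HasWeakDerivOn ε (Real.pi - ε) ((u + v : LatL2 ε) : ℝ → ℂ) ((u' + v' : LatL2 ε) : ℝ → ℂ) := by
  intro φ h1 h2 h3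
  have hd : Continuous (deriv φ) := h1.continuous_deriv (by simp)
  have key : ∀ {χ : ℝ → ℝ}, Continuous χ → HasCompactSupport χ → ∀ a b : LatL2 ε,
      ∫ x, χ x • ((a + b : LatL2 ε) : ℝ → ℂ) x ∂(latMeasure ε)
        = ∫ x, χ x • a x ∂(latMeasure ε) + ∫ x, χ x • b x ∂(latMeasure ε) := by
    intro χ hc hs a b
    rw [← integral_add (integrable_smul_L2 hc hs a) (integrable_smul_L2 hc hs b)]
    refine integral_congr_ae ?_
    filter_upwards [Lp.coeFn_add a b] with x hx
    rw [hx, Pi.add_apply, smul_add]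
  rw [key hd h2.deriv, key h1.continuous h2, hu φ h1 h2 h3, hv φ h1 h2 h3, neg_add]

theorem HasWeakDerivOn.smul_L2 {ε : ℝ} (c : ℂ) {u u' : LatL2 ε}
    (hu : HasWeakDerivOn ε (Real.pi - ε) u u') :
    HasWeakDerivOn ε (Real.pi - ε) ((c • u : LatL2 ε) : ℝ → ℂ) ((c • u' : LatL2 ε) : ℝ → ℂ) := by
  intro φ h1 h2 h3
  have key : ∀ (χ : ℝ → ℝ) (a : LatL2 ε),
      ∫ x, χ x • ((c • a : LatL2 ε) : ℝ → ℂ) x ∂(latMeasure ε)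
        = c • ∫ x, χ x • a x ∂(latMeasure ε) := by
    intro χ a
    rw [← integral_smul]
    refine integral_congr_ae ?_
    filter_upwards [Lp.coeFn_smul c a] with x hx
    rw [hx, Pi.smul_apply, smul_comm]
  rw [key, key, hu φ h1 h2 h3, smul_neg]

/-- The Sobolev space `H^k(I')`: its elements are the tuples `(u, u', …, u^{(k)})` of an `L²`
function with its weak derivatives, with the norm `(∑ⱼ ‖u^{(j)}‖²)^{1/2}`. -/
def sobolev (ε : ℝ) (k : ℕ) : Submodule ℂ (PiLp 2 fun _ : Fin (k + 1) => LatL2 ε) where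
  carrier := {u | ∀ j : Fin k, HasWeakDerivOn ε (Real.pi - ε) (u j.castSucc) (u j.succ)}
  zero_mem' := fun _ => HasWeakDerivOn.zero_L2 ε
  add_mem' := fun hu hv j => (hu j).add_L2 (hv j)
  smul_mem' := fun c _ hu j => (hu j).smul_L2 c

/-- The continuous representative of `f` on `[ε, π - ε]` takes the values `v` at `ε` and `w` at
`π - ε`. -/
def HasBoundaryValues (ε : ℝ) (f : ℝ → ℂ) (v w : ℂ) : Prop :=
  ∃ g : ℝ → ℂ, ContinuousOn g (Icc ε (Real.pi - ε)) ∧ f =ᵐ[latMeasure ε] g ∧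
    g ε = v ∧ g (Real.pi - ε) = w

/-- The space `H^k_0(I')`, `k ≥ 2`, of the functions in `H^k(I')` with `u = u' = 0` on the boundary
of `I'` (for `k > 2` no boundary condition is imposed on the higher derivatives). -/
def sobolev₀ (ε : ℝ) (k : ℕ) : Submodule ℂ (sobolev ε k) where
  carrier := {u | ∀ j : Fin (k + 1), (j : ℕ) < 2 → HasBoundaryValues ε (u.1 j) 0 0}
  zero_mem' := fun _ _ => ⟨0, continuousOn_const, Lp.coeFn_zero ℂ 2 _, rfl, rfl⟩
  add_mem' := by
    intro u v hu hv j hj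
    obtain ⟨g, hg, hug, hg0, hg1⟩ := hu j hj
    obtain ⟨h, hh, hvh, hh0, hh1⟩ := hv j hj
    refine ⟨g + h, hg.add hh, ?_, by simp [hg0, hh0], by simp [hg1, hh1]⟩
    exact (Lp.coeFn_add (u.1 j) (v.1 j)).trans (hug.add hvh)
  smul_mem' := by
    intro c u hu j hj
    obtain ⟨g, hg, hug, hg0, hg1⟩ := hu j hj
    refine ⟨c • g, hg.const_smul c, ?_, by simp [hg0], by simp [hg1]⟩
    exact (Lp.coeFn_smul c (u.1 j)).trans (hug.const_smul c)

/-- `H^{-2}(I')`, the space of bounded antilinear functionals on `H²_0(I')`. -/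
abbrev SobolevDual (ε : ℝ) : Type := sobolev₀ ε 2 →L⋆[ℂ] ℂ

/-- The functions `(u, u', u'')` for `u` in `H^k(I')` with `k ≥ 2`. -/
def jet {ε : ℝ} {k : ℕ} (u : sobolev ε (k + 2)) (j : Fin 3) : ℝ → ℂ :=
  u.1 (Fin.castLE (by omega) j)

/-! ### The sesquilinear form and the wave operator -/

/-- The separated Laplacian `(sin θ)⁻¹ (sin θ u')' / r² - m² u / (r² sin² θ)`. -/
def lap (r : ℝ) (m : ℤ) (u : Fin 3 → ℝ → ℂ) (θ : ℝ) : ℂ :=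
  (u 2 θ + (Real.cos θ / Real.sin θ : ℝ) * u 1 θ - ((m : ℝ) ^ 2 / Real.sin θ ^ 2 : ℝ) * u 0 θ)
    / (r : ℂ) ^ 2

/-- The inner product `∫ f conj(g) r² sin θ dθ` of `L²(I'; m)`. -/
def pairing (r ε : ℝ) (f g : ℝ → ℂ) : ℂ :=
  ∫ θ in Ioo ε (Real.pi - ε), f θ * conj (g θ) * ((r ^ 2 * Real.sin θ : ℝ) : ℂ)

/-- The inner product of the surface gradients of `u(θ) e_m(φ)` and `v(θ) e_m(φ)`. -/
def gradPairing (r ε : ℝ) (m : ℤ) (u v : Fin 3 → ℝ → ℂ) : ℂ :=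
  pairing r ε (fun θ => u 1 θ / r) (fun θ => v 1 θ / r)
    + pairing r ε (fun θ => Complex.I * m * u 0 θ / (r * Real.sin θ : ℝ))
        (fun θ => Complex.I * m * v 0 θ / (r * Real.sin θ : ℝ))

/-- The form `i m ⟨α_Ω u, v⟩ = ⟨α̃ grad u, curl v⟩` with `α̃ = Ω' sin θ + 2 Ω cos θ` and
`α_Ω = α̃' / (r² sin θ)`, written for `Ω` in `H¹`, where `Ω₁ = Ω'`. -/
def alphaForm (ε : ℝ) (m : ℤ) (Ω Ω₁ : ℝ → ℝ) (u v : Fin 3 → ℝ → ℂ) : ℂ :=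
  -(Complex.I * m) * ∫ θ in Ioo ε (Real.pi - ε),
    ((Ω₁ θ * Real.sin θ + 2 * Ω θ * Real.cos θ : ℝ) : ℂ)
      * (u 1 θ * conj (v 0 θ) + u 0 θ * conj (v 1 θ))

/-- The separated sesquilinear form `A_m[u, v]` on `I'`; `u` and `v` are given together with
their first two derivatives. -/
def waveForm (r ε γ ω Ωref : ℝ) (m : ℤ) (Ω Ω₁ : ℝ → ℝ) (u v : Fin 3 → ℝ → ℂ) : ℂ :=
  γ * pairing r ε (lap r m u) (lap r m v)
    - Complex.I * ω * gradPairing r ε m u v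
    + alphaForm ε m Ω Ω₁ u v
    - Complex.I * m * pairing r ε (fun θ => ((Ω θ - Ωref : ℝ) : ℂ) * lap r m u θ) (v 0)

/-- `Ψ ∈ H²(I')` is a weak solution of `B_m Ψ = f` in `I'` with the Cauchy data `Ψ = a`, `Ψ' = b`
on the boundary; the indices `0` and `1` refer to the boundary points `ε` and `π - ε`. -/
structure IsWaveSolution (r ε γ ω Ωref : ℝ) (m : ℤ) (Ω Ω₁ : ℝ → ℝ) (f : SobolevDual ε)
    (a b : Fin 2 → ℂ) (Ψ : sobolev ε 2) : Prop where
  weak : ∀ ψ : sobolev₀ ε 2, waveForm r ε γ ω Ωref m Ω Ω₁ (jet Ψ) (jet ψ.1) = f ψ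
  boundary : HasBoundaryValues ε (Ψ.1 0) (a 0) (a 1)
  boundary' : HasBoundaryValues ε (Ψ.1 1) (b 0) (b 1)

end InertialWave

end

open InertialWave

namespace InertialWave

/-! ### Absolutely continuous functions with a given derivative -/

section AC

variable {E F : Type*} [NormedAddCommGroup E] [NormedSpace ℝ E]
  [NormedAddCommGroup F] [NormedSpace ℝ F]

/-! The core is the coercivity estimate `waveForm_coercive`: on H²_0(I') the modulus of A_m[u, u] is
at least a positive multiple of ‖u‖². The Lax-Milgram argument `exists_equiv_of_le_norm` then
inverts B_m. It also inverts the adjoint, because conjugation does not change the modulus of the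
diagonal. Cauchy data are removed by subtracting a smooth function with the same data, and two
solutions with equal data differ by an element of H²_0(I'), where B_m is injective.

For coercivity let μ = |m|, and let y be u with its continuous representatives. Let L be the
separated Laplacian of the unit sphere, X = ∫ |Ly|² sin and G = ∫ |∇y|² sin. By `waveForm_self` the
real part of A_m[u, u] is γX/r² + m Im Z and the imaginary part is -ωG - mT - m Re Z, with Z the
advection integral and T the vorticity gradient integral. Since y and y' vanish at both ends,
elementary one-dimensional identities (Green, a ground state substitution, Bochner) give explicit
bounds. Both μ|Z| and μ|T| are at most a constant times X^(3/4) G^(1/4), and only the L² norms of Ω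
- Ωref and Ω enter (`norm_integral_advection_le`, `abs_integral_vorticity_le`). For large |ω| the
lower bounds from the two parts are combined by Young's inequality (`exists_pos_mul_pow_four_le`).
For small shear the real part suffices: Im Z depends on Ω only through Ω' and is at most a constant
times ‖Ω'‖ X (`abs_integral_shear_le`).

No Sobolev embedding on the sphere is proved or used. The hypotheses contain the best embedding
constants, and testing these with the harmonic cos θ bounds them from below (`LargeFrequency.lt`,
`SmallShear.lt`). The conditions become explicit numerical inequalities, and these are strong enough
for the constants of the one-dimensional estimates: 0.287 against 27/80 for small shear, and
`largeFrequency_numerics` for large frequency.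

For the regularity statement the form is written as a matrix of coefficients (`coeffForm`), so that
the adjoint is the conjugate transpose and needs no separate argument. If the right hand side is in
L², a second order du Bois-Reymond lemma shows that the coefficient of ψ'' has a weak derivative.
Dividing by the leading coefficient and repeating once gives u'' in H²
(`RegularCoeff.isSobolev_of_weak`). The closed graph theorem makes the resulting bijection H⁴_0(I')
→ L²(I') an isomorphism. -/

theorem absolutelyContinuous_of_dist_le {X Y : Type*} [PseudoMetricSpace X] [PseudoMetricSpace Y]
    {f : ℝ → X} {g : ℝ → Y} {a b : ℝ}
    (hg : AbsolutelyContinuousOnInterval g a b)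
    (h : ∀ x ∈ uIcc a b, ∀ y ∈ uIcc a b, dist (f x) (f y) ≤ dist (g x) (g y)) :
    AbsolutelyContinuousOnInterval f a b := by
  rw [absolutelyContinuousOnInterval_iff] at hg ⊢
  intro e he
  obtain ⟨d, hd, H⟩ := hg e he
  refine ⟨d, hd, fun I hI hl => lt_of_le_of_lt (Finset.sum_le_sum fun i hi => ?_) (H I hI hl)⟩
  exact h _ (hI.1 i hi).1 _ (hI.1 i hi).2

/-- `f` is absolutely continuous on `[a, b]` with almost everywhere derivative `f'`. -/
structure ACDeriv (a b : ℝ) (f f' : ℝ → E) : Prop where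
  ac : AbsolutelyContinuousOnInterval f a b
  integrableOn : IntegrableOn f' (Ioo a b)
  ae_hasDerivAt : ∀ᵐ x ∂(volume.restrict (Ioo a b)), HasDerivAt f (f' x) x

namespace ACDeriv

variable {a b : ℝ} {f f' g g' : ℝ → E}

theorem congr_deriv (h : ACDeriv a b f f') (hg : f' =ᵐ[volume.restrict (Ioo a b)] g') :
    ACDeriv a b f g' := by
  refine ⟨h.ac, h.integrableOn.congr_fun_ae hg, ?_⟩
  filter_upwards [h.ae_hasDerivAt, hg] with x hx hx'
  rwa [← hx']

theorem continuousOn (h : ACDeriv a b f f') (hab : a ≤ b) : ContinuousOn f (Icc a b) := by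
  have := h.ac.continuousOn
  rwa [uIcc_of_le hab] at this

theorem add (hf : ACDeriv a b f f') (hg : ACDeriv a b g g') :
    ACDeriv a b (fun x => f x + g x) (fun x => f' x + g' x) := by
  refine ⟨hf.ac.add hg.ac, hf.integrableOn.add hg.integrableOn, ?_⟩
  filter_upwards [hf.ae_hasDerivAt, hg.ae_hasDerivAt] with x hx hx' using hx.add hx'

theorem neg (hf : ACDeriv a b f f') : ACDeriv a b (fun x => - f x) (fun x => - f' x) := by
  refine ⟨hf.ac.neg, hf.integrableOn.neg, ?_⟩
  filter_upwards [hf.ae_hasDerivAt] with x hx using hx.neg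

theorem sub (hf : ACDeriv a b f f') (hg : ACDeriv a b g g') :
    ACDeriv a b (fun x => f x - g x) (fun x => f' x - g' x) := by
  simpa [sub_eq_add_neg] using hf.add hg.neg

theorem clm (hf : ACDeriv a b f f') (L : E →L[ℝ] F) :
    ACDeriv a b (fun x => L (f x)) (fun x => L (f' x)) := by
  refine ⟨absolutelyContinuous_of_dist_le (hf.ac.const_smul ‖L‖) ?_,
    L.integrable_comp hf.integrableOn, ?_⟩
  · intro x _ y _
    simp only [dist_eq_norm, ← smul_sub, norm_smul, norm_norm, ← map_sub]
    exact L.le_opNorm _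
  · filter_upwards [hf.ae_hasDerivAt] with x hx using L.hasFDerivAt.comp_hasDerivAt x hx

theorem of_hasDerivAt (hab : a ≤ b) (h : ∀ x ∈ Icc a b, HasDerivAt f (f' x) x)
    (hc : ContinuousOn f' (Icc a b)) : ACDeriv a b f f' := by
  obtain ⟨C, hC⟩ := isCompact_Icc.exists_bound_of_continuousOn hc
  refine ⟨?_, (hc.integrableOn_Icc).mono_set Ioo_subset_Icc_self, ?_⟩
  · have : LipschitzOnWith C.toNNReal f (uIcc a b) := by
      rw [uIcc_of_le hab]
      refine Convex.lipschitzOnWith_of_nnnorm_hasDerivWithin_le (convex_Icc a b)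
        (fun x hx => (h x hx).hasDerivWithinAt) fun x hx => ?_
      rw [← NNReal.coe_le_coe, coe_nnnorm]
      exact (hC x hx).trans (Real.le_coe_toNNReal C)
    exact this.absolutelyContinuousOnInterval
  · exact (ae_restrict_iff' measurableSet_Ioo).2
      (Eventually.of_forall fun x hx => h x (Ioo_subset_Icc_self hx))

theorem const (hab : a ≤ b) (c : E) : ACDeriv a b (fun _ => c) (fun _ => 0) :=
  of_hasDerivAt hab (fun x _ => hasDerivAt_const x c) continuousOn_const

theorem mul {A : Type*} [NormedRing A] [NormOneClass A] [NormMulClass A] [NormedAlgebra ℝ A]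
    {f f' g g' : ℝ → A} (hab : a ≤ b) (hf : ACDeriv a b f f') (hg : ACDeriv a b g g') :
    ACDeriv a b (fun x => f x * g x) (fun x => f' x * g x + f x * g' x) := by
  have hb : ∀ {u : ℝ → A} {u' : ℝ → A}, ACDeriv a b u u' →
      ∃ C, ∀ᵐ x ∂(volume.restrict (Ioo a b)), ‖u x‖ ≤ C := fun hu => by
    obtain ⟨C, hC⟩ := isCompact_Icc.exists_bound_of_continuousOn (hu.continuousOn hab)
    exact ⟨C, (ae_restrict_iff' measurableSet_Ioo).2
      (Eventually.of_forall fun x hx => hC x (Ioo_subset_Icc_self hx))⟩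
  have hm : ∀ {u : ℝ → A} {u' : ℝ → A}, ACDeriv a b u u' →
      AEStronglyMeasurable u (volume.restrict (Ioo a b)) := fun hu =>
    ((hu.continuousOn hab).mono Ioo_subset_Icc_self).aestronglyMeasurable measurableSet_Ioo
  refine ⟨hf.ac.smul hg.ac, ?_, ?_⟩
  · obtain ⟨C, hC⟩ := hb hf
    obtain ⟨D, hD⟩ := hb hg
    exact (hf.integrableOn.mul_bdd (hm hg) hD).add (hg.integrableOn.bdd_mul (hm hf) hC)
  · filter_upwards [hf.ae_hasDerivAt, hg.ae_hasDerivAt] with x hx hx'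
    exact hx.mul hx'

theorem intervalIntegrable {G : Type*} [NormedAddCommGroup G] {f : ℝ → G} (hab : a ≤ b)
    (h : IntegrableOn f (Ioo a b)) :
    IntervalIntegrable f volume a b :=
  (intervalIntegrable_iff_integrableOn_Ioo_of_le hab).2 h

/-- Increments of the primitive are dominated by those of the primitive of the norm, which gives
absolute continuity; the derivative is Lebesgue differentiation. -/
theorem primitive [CompleteSpace E] (hab : a ≤ b) (h : IntegrableOn f (Ioo a b)) :
    ACDeriv a b (fun x => ∫ t in a..x, f t) f := by
  have hi : IntervalIntegrable f volume a b := intervalIntegrable hab h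
  have hsub : ∀ x ∈ uIcc a b, IntervalIntegrable f volume a x := fun x hx =>
    hi.mono_set (uIcc_subset_uIcc left_mem_uIcc hx)
  refine ⟨?_, h, ?_⟩
  · refine absolutelyContinuous_of_dist_le
      (hi.norm.absolutelyContinuousOnInterval_intervalIntegral left_mem_uIcc) ?_
    intro x hx y hy
    rw [dist_eq_norm, dist_eq_norm,
      intervalIntegral.integral_interval_sub_left (hsub x hx) (hsub y hy),
      intervalIntegral.integral_interval_sub_left (hsub x hx).norm (hsub y hy).norm]
    exact intervalIntegral.norm_integral_le_abs_integral_norm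
  · filter_upwards [ae_restrict_of_ae hi.ae_hasDerivAt_integral, ae_restrict_mem measurableSet_Ioo]
      with x hx hx'
    refine hx ?_ a left_mem_uIcc
    rw [uIcc_of_le hab]
    exact Ioo_subset_Icc_self hx'

/-- After subtraction of the primitive of `f'` an absolutely continuous function with almost
everywhere vanishing derivative remains, and such a function is constant. -/
theorem eq_add_integral [CompleteSpace E] (hab : a ≤ b) (h : ACDeriv a b f f') {x : ℝ}
    (hx : x ∈ Icc a b) : f x = f a + ∫ t in a..x, f' t := by
  have hd := h.sub (primitive hab h.integrableOn)
  obtain ⟨C, hC⟩ := hd.ac.const_of_ae_hasDerivAt_zero (by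
    have h0 := hd.ae_hasDerivAt
    rw [ae_restrict_iff' measurableSet_Ioo] at h0
    rw [uIcc_of_le hab]
    have ha : ∀ᵐ x : ℝ, x ≠ a := by simp [ae_iff]
    have hb : ∀ᵐ x : ℝ, x ≠ b := by simp [ae_iff]
    filter_upwards [h0, ha, hb] with x hx hxa hxb hxI
    simpa using hx ⟨lt_of_le_of_ne hxI.1 (Ne.symm hxa), lt_of_le_of_ne hxI.2 hxb⟩)
  rw [uIcc_of_le hab] at hC
  have h1 := hC a (left_mem_Icc.2 hab)
  have h2 := hC x hx
  simp only [intervalIntegral.integral_same, sub_zero] at h1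
  rw [h1, ← h2]
  abel

theorem integral_eq_sub [CompleteSpace E] (hab : a ≤ b) (h : ACDeriv a b f f') :
    ∫ x in Ioo a b, f' x = f b - f a := by
  have := h.eq_add_integral hab (right_mem_Icc.2 hab)
  rw [this, intervalIntegral.integral_of_le hab, integral_Ioc_eq_integral_Ioo]
  abel

theorem norm_sub_le [CompleteSpace E] (hab : a ≤ b) (h : ACDeriv a b f f') {x y : ℝ}
    (hx : x ∈ Icc a b) (hy : y ∈ Icc a b) : ‖f x - f y‖ ≤ ∫ t in Ioo a b, ‖f' t‖ := by
  have hi := intervalIntegrable hab h.integrableOn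
  have hsub : ∀ x ∈ Icc a b, IntervalIntegrable f' volume a x := fun x hx =>
    hi.mono_set (uIcc_subset_uIcc left_mem_uIcc (by rwa [uIcc_of_le hab]))
  rw [h.eq_add_integral hab hx, h.eq_add_integral hab hy, add_sub_add_left_eq_sub,
    intervalIntegral.integral_interval_sub_left (hsub x hx) (hsub y hy)]
  refine intervalIntegral.norm_integral_le_integral_norm_uIoc.trans ?_
  rw [← integral_Ioc_eq_integral_Ioo]
  refine setIntegral_mono_set (hi.norm.1) (Eventually.of_forall fun _ => norm_nonneg _) ?_
  exact (Ioc_subset_Ioc (le_min hy.1 hx.1) (max_le hy.2 hx.2)).eventuallyLE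

/-- The value at `x` is estimated from each end point by the integral over the part on that side,
and the two estimates are added. The factor 2 gained in this way enters the pointwise bounds
`Clamped.norm_sq_le` and `Clamped.norm_sin_mul_sq_le`. -/
theorem two_mul_norm_le [CompleteSpace E] (hab : a ≤ b) (h : ACDeriv a b f f') (ha : f a = 0)
    (hb : f b = 0) {x : ℝ} (hx : x ∈ Icc a b) : 2 * ‖f x‖ ≤ ∫ t in Ioo a b, ‖f' t‖ := by
  have hi := intervalIntegrable hab h.integrableOn
  have h1 : ‖f x‖ ≤ ∫ t in a..x, ‖f' t‖ := by
    rw [h.eq_add_integral hab hx, ha, zero_add]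
    exact intervalIntegral.norm_integral_le_integral_norm hx.1
  have ix : IntervalIntegrable f' volume a x :=
    hi.mono_set (uIcc_subset_uIcc left_mem_uIcc (by rwa [uIcc_of_le hab]))
  have xb : IntervalIntegrable f' volume x b :=
    hi.mono_set (uIcc_subset_uIcc (by rwa [uIcc_of_le hab]) right_mem_uIcc)
  have h2 : ‖f x‖ ≤ ∫ t in x..b, ‖f' t‖ := by
    have := h.eq_add_integral hab (right_mem_Icc.2 hab)
    rw [hb, ← intervalIntegral.integral_add_adjacent_intervals ix xb, ← add_assoc,
      ← h.eq_add_integral hab hx] at this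
    rw [eq_neg_of_add_eq_zero_left this.symm, norm_neg]
    exact intervalIntegral.norm_integral_le_integral_norm hx.2
  have h3 := intervalIntegral.integral_add_adjacent_intervals ix.norm xb.norm
  rw [intervalIntegral.integral_of_le hab, integral_Ioc_eq_integral_Ioo] at h3
  linarith

end ACDeriv

/-! ### Weak derivatives -/

theorem exists_Icc_subset_of_isCompact {a b : ℝ} {K : Set ℝ} (hK : IsCompact K)
    (hne : K.Nonempty) (h : K ⊆ Ioo a b) : ∃ c d, a < c ∧ d < b ∧ K ⊆ Icc c d :=
  ⟨sInf K, sSup K, (h (hK.sInf_mem hne)).1, (h (hK.sSup_mem hne)).2, fun _ hx =>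
    ⟨csInf_le hK.bddBelow hx, le_csSup hK.bddAbove hx⟩⟩

/-- A smooth function with compact support in `(a, b)` and vanishing integral is the derivative
of such a function. -/
theorem exists_testFunction_primitive {a b : ℝ} {η : ℝ → ℝ} (h1 : ContDiff ℝ (⊤ : ℕ∞) η)
    (h2 : HasCompactSupport η) (h3 : tsupport η ⊆ Ioo a b) (h0 : ∫ x, η x = 0) :
    ∃ φ : ℝ → ℝ, ContDiff ℝ (⊤ : ℕ∞) φ ∧ HasCompactSupport φ ∧ tsupport φ ⊆ Ioo a b ∧
      deriv φ = η := by
  rcases (tsupport η).eq_empty_or_nonempty with he | hne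
  · have hz : η = 0 := tsupport_eq_empty_iff.1 he
    subst hz
    refine ⟨0, contDiff_const, HasCompactSupport.zero, by simp [tsupport], ?_⟩
    ext x
    exact deriv_const x (0 : ℝ)
  obtain ⟨c, d, hac, hdb, hcd⟩ := exists_Icc_subset_of_isCompact h2 hne h3
  have hzero : ∀ x, x ∉ Icc c d → η x = 0 := fun x hx =>
    image_eq_zero_of_notMem_tsupport fun h => hx (hcd h)
  have hder : ∀ x, HasDerivAt (fun x => ∫ t in a..x, η t) (η x) x := fun x =>
    intervalIntegral.integral_hasDerivAt_right (h1.continuous.intervalIntegrable _ _)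
      h1.continuous.stronglyMeasurable.stronglyMeasurableAtFilter h1.continuous.continuousAt
  have hderiv : deriv (fun x => ∫ t in a..x, η t) = η := funext fun x => (hder x).deriv
  -- To the left of the support of `η` the integrand vanishes; to the right the primitive equals the
  -- full integral, which is zero by `h0`.
  have hsupp : ∀ x, x ∉ Icc c d → ∫ t in a..x, η t = 0 := by
    intro x hx
    rcases lt_or_ge x c with hxc | hxc
    · refine intervalIntegral.integral_zero_ae (Eventually.of_forall fun t ht => hzero t ?_)
      exact fun ht' => absurd ht.2 (not_le.2 ((max_lt hac hxc).trans_le ht'.1))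
    · have hxd : d < x := lt_of_not_ge fun h => hx ⟨hxc, h⟩
      rw [← h0, intervalIntegral.integral_of_le (hac.le.trans hxc)]
      exact setIntegral_eq_integral_of_forall_compl_eq_zero fun t ht =>
        hzero t fun htI => ht ⟨hac.trans_le htI.1, htI.2.trans hxd.le⟩
  have hts : tsupport (fun x => ∫ t in a..x, η t) ⊆ Icc c d :=
    closure_minimal (fun x hx => by_contra fun h => hx (hsupp x h)) isClosed_Icc
  refine ⟨fun x => ∫ t in a..x, η t, ?_, ?_, ?_, hderiv⟩
  · rw [contDiff_infty_iff_deriv]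
    exact ⟨fun x => (hder x).differentiableAt, by rw [hderiv]; exact h1⟩
  · exact isCompact_Icc.of_isClosed_subset (isClosed_tsupport _) hts
  · exact hts.trans (Icc_subset_Ioo hac hdb)

/-- **Lemma of du Bois-Reymond.** -/
theorem ae_eq_const_of_integral_deriv_smul_eq_zero [CompleteSpace E] {a b : ℝ} (hab : a < b)
    {f : ℝ → E} (hf : IntegrableOn f (Ioo a b))
    (h : ∀ φ : ℝ → ℝ, ContDiff ℝ (⊤ : ℕ∞) φ → HasCompactSupport φ → tsupport φ ⊆ Ioo a b →
      ∫ x in Ioo a b, deriv φ x • f x = 0) :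
    ∃ c : E, f =ᵐ[volume.restrict (Ioo a b)] fun _ => c := by
  let ρ₀ : ContDiffBump ((a + b) / 2) := ⟨(b - a) / 8, (b - a) / 4, by linarith, by linarith⟩
  let ρ : ℝ → ℝ := ρ₀.normed volume
  have hρ1 : ContDiff ℝ (⊤ : ℕ∞) ρ := ρ₀.contDiff_normed
  have hρ2 : HasCompactSupport ρ := ρ₀.hasCompactSupport_normed
  have hρ3 : tsupport ρ ⊆ Ioo a b := by
    rw [ρ₀.tsupport_normed_eq, Real.closedBall_eq_Icc]
    have : ρ₀.rOut = (b - a) / 4 := rfl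
    rw [this]
    exact Icc_subset_Ioo (by linarith) (by linarith)
  have hρ0 : ∫ x, ρ x = 1 := ρ₀.integral_normed
  have hint : ∀ {χ : ℝ → ℝ}, Continuous χ → HasCompactSupport χ →
      IntegrableOn (fun x => χ x • f x) (Ioo a b) := fun {χ} hc hs => by
    obtain ⟨C, hC⟩ := hc.bounded_above_of_compact_support hs
    exact Integrable.bdd_smul (𝕜 := ℝ) hf C hc.aestronglyMeasurable (Eventually.of_forall hC)
  set c : E := ∫ x in Ioo a b, ρ x • f x with hc
  refine ⟨c, ?_⟩
  have key : ∀ᵐ x, x ∈ Ioo a b → f x - c = 0 := by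
    have hloc : IntegrableOn (fun x => f x - c) (Ioo a b) :=
      hf.sub (integrableOn_const (by simp))
    refine isOpen_Ioo.ae_eq_zero_of_integral_contDiff_smul_eq_zero hloc.locallyIntegrableOn ?_
    intro η h1 h2 h3
    have hη : Integrable η := h1.continuous.integrable_of_hasCompactSupport h2
    have hρi : Integrable ρ := hρ1.continuous.integrable_of_hasCompactSupport hρ2
    -- Subtracting the multiple of the normalized bump `ρ` with the same integral makes an arbitrary
    -- `η` a derivative of a test function. The bump contributes exactly the constant `c`.
    obtain ⟨φ, p1, p2, p3, p4⟩ := exists_testFunction_primitive (a := a) (b := b)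
      (η := fun x => η x - (∫ t, η t) * ρ x) (h1.sub (contDiff_const.mul hρ1))
      (h2.sub hρ2.mul_left)
      ((tsupport_sub _ _).trans (union_subset h3
        ((tsupport_mul_subset_right).trans hρ3)))
      (by rw [integral_sub hη (hρi.const_mul _), integral_const_mul, hρ0, mul_one, sub_self])
    have h4 := h φ p1 p2 p3
    rw [p4] at h4
    have e1 : ∫ x, η x • (f x - c) = ∫ x in Ioo a b, η x • (f x - c) := by
      refine (setIntegral_eq_integral_of_forall_compl_eq_zero fun x hx => ?_).symm
      rw [image_eq_zero_of_notMem_tsupport fun h => hx (h3 h), zero_smul]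
    have e2 : ∫ x, η x = ∫ x in Ioo a b, η x := by
      refine (setIntegral_eq_integral_of_forall_compl_eq_zero fun x hx => ?_).symm
      rw [image_eq_zero_of_notMem_tsupport fun h => hx (h3 h)]
    have e3 : ∫ x in Ioo a b, (η x - (∫ t, η t) * ρ x) • f x
        = (∫ x in Ioo a b, η x • f x) - (∫ t, η t) • c := by
      simp only [sub_smul, mul_smul]
      have hsm : IntegrableOn (fun x => (∫ t, η t) • ρ x • f x) (Ioo a b) :=
        (hint hρ1.continuous hρ2).smul (∫ t, η t)
      rw [integral_sub (hint h1.continuous h2) hsm, integral_smul]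
    rw [e1]
    simp only [smul_sub]
    rw [integral_sub (hint h1.continuous h2) (hη.integrableOn.smul_const c),
      integral_smul_const, ← e2, ← e3, h4]
  rw [EventuallyEq, ae_restrict_iff' measurableSet_Ioo]
  filter_upwards [key] with x hx hxI using sub_eq_zero.1 (hx hxI)

theorem HasWeakDerivOn.congr {a b : ℝ} {f f' g g' : ℝ → E} (h : HasWeakDerivOn a b f g)
    (hf : f =ᵐ[volume.restrict (Ioo a b)] f') (hg : g =ᵐ[volume.restrict (Ioo a b)] g') :
    HasWeakDerivOn a b f' g' := by
  intro φ h1 h2 h3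
  have e1 : ∫ x in Ioo a b, deriv φ x • f' x = ∫ x in Ioo a b, deriv φ x • f x :=
    integral_congr_ae (by filter_upwards [hf] with x hx; rw [hx])
  have e2 : ∫ x in Ioo a b, φ x • g' x = ∫ x in Ioo a b, φ x • g x :=
    integral_congr_ae (by filter_upwards [hg] with x hx; rw [hx])
  rw [e1, e2, h φ h1 h2 h3]

/-- Integration by parts against a continuously differentiable function. -/
theorem ACDeriv.smul_contDiff [CompleteSpace E] {a b : ℝ} (hab : a ≤ b) {f f' : ℝ → E} {φ : ℝ → ℝ}
    (h : ACDeriv a b f f') (hφ : ContDiff ℝ 1 φ) :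
    ACDeriv a b (fun x => φ x • f x) (fun x => deriv φ x • f x + φ x • f' x) := by
  have hd : Continuous (deriv φ) := hφ.continuous_deriv le_rfl
  have hA : ACDeriv a b φ (deriv φ) := ACDeriv.of_hasDerivAt hab
    (fun x _ => (hφ.differentiable one_ne_zero x).hasDerivAt) hd.continuousOn
  obtain ⟨C, hC⟩ := isCompact_Icc.exists_bound_of_continuousOn (s := Icc a b) hφ.continuous.continuousOn
  refine ⟨hA.ac.smul h.ac, ?_, ?_⟩
  · refine Integrable.add ?_ ?_
    · have : ContinuousOn (fun x => deriv φ x • f x) (Icc a b) :=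
        hd.continuousOn.smul (h.continuousOn hab)
      exact this.integrableOn_Icc.mono_set Ioo_subset_Icc_self
    · exact Integrable.bdd_smul (𝕜 := ℝ) h.integrableOn C hφ.continuous.aestronglyMeasurable
        ((ae_restrict_iff' measurableSet_Ioo).2 (Eventually.of_forall fun x hx =>
          hC x (Ioo_subset_Icc_self hx)))
  · filter_upwards [h.ae_hasDerivAt] with x hx
    have := ((hφ.differentiable one_ne_zero x).hasDerivAt).smul hx
    rwa [add_comm] at this

theorem ACDeriv.integral_deriv_smul [CompleteSpace E] {a b : ℝ} (hab : a ≤ b) {f f' : ℝ → E}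
    {φ : ℝ → ℝ} (h : ACDeriv a b f f') (hφ : ContDiff ℝ 1 φ) :
    (∫ x in Ioo a b, deriv φ x • f x) + ∫ x in Ioo a b, φ x • f' x = φ b • f b - φ a • f a := by
  have hd : Continuous (deriv φ) := hφ.continuous_deriv le_rfl
  obtain ⟨C, hC⟩ := isCompact_Icc.exists_bound_of_continuousOn (s := Icc a b) hφ.continuous.continuousOn
  rw [← (h.smul_contDiff hab hφ).integral_eq_sub hab, integral_add]
  · have : ContinuousOn (fun x => deriv φ x • f x) (Icc a b) :=
      hd.continuousOn.smul (h.continuousOn hab)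
    exact this.integrableOn_Icc.mono_set Ioo_subset_Icc_self
  · exact Integrable.bdd_smul (𝕜 := ℝ) h.integrableOn C hφ.continuous.aestronglyMeasurable
      ((ae_restrict_iff' measurableSet_Ioo).2 (Eventually.of_forall fun x hx =>
        hC x (Ioo_subset_Icc_self hx)))

theorem ACDeriv.hasWeakDerivOn [CompleteSpace E] {a b : ℝ} (hab : a ≤ b) {f f' : ℝ → E}
    (h : ACDeriv a b f f') : HasWeakDerivOn a b f f' := by
  intro φ h1 h2 h3
  have h0 : ∀ x, x ∉ Ioo a b → φ x = 0 := fun x hx =>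
    image_eq_zero_of_notMem_tsupport fun h => hx (h3 h)
  have := h.integral_deriv_smul hab (h1.of_le (by simp))
  rw [h0 a (by simp), h0 b (by simp), zero_smul, zero_smul, sub_zero] at this
  exact eq_neg_of_add_eq_zero_left this

/-- A function with an integrable weak derivative is absolutely continuous. -/
theorem HasWeakDerivOn.exists_acDeriv [CompleteSpace E] {a b : ℝ} (hab : a < b) {f g : ℝ → E}
    (hf : IntegrableOn f (Ioo a b)) (hg : IntegrableOn g (Ioo a b)) (h : HasWeakDerivOn a b f g) :
    ∃ F : ℝ → E, ACDeriv a b F g ∧ f =ᵐ[volume.restrict (Ioo a b)] F := by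
  have hP := ACDeriv.primitive hab.le hg
  have hPi : IntegrableOn (fun x => ∫ t in a..x, g t) (Ioo a b) :=
    (hP.continuousOn hab.le).integrableOn_Icc.mono_set Ioo_subset_Icc_self
  obtain ⟨c, hc⟩ := ae_eq_const_of_integral_deriv_smul_eq_zero hab (hf.sub hPi) (by
    intro φ h1 h2 h3
    have hd : Continuous (deriv φ) := h1.continuous_deriv (by simp)
    obtain ⟨C, hC⟩ := hd.bounded_above_of_compact_support h2.deriv
    have hi : ∀ {u : ℝ → E}, IntegrableOn u (Ioo a b) →
        IntegrableOn (fun x => deriv φ x • u x) (Ioo a b) := fun hu =>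
      Integrable.bdd_smul (𝕜 := ℝ) hu C hd.aestronglyMeasurable (Eventually.of_forall hC)
    simp only [Pi.sub_apply, smul_sub]
    rw [integral_sub (hi hf) (hi hPi), h φ h1 h2 h3, hP.hasWeakDerivOn hab.le φ h1 h2 h3, sub_self])
  refine ⟨fun x => (∫ t in a..x, g t) + c, ?_, ?_⟩
  · simpa using hP.add (ACDeriv.const hab.le c)
  · filter_upwards [hc] with x hx
    rw [← hx]
    simp

/-- A test function on the smaller interval is one on the larger. This passes from the rotation
profile on (0, π) to I'. -/
theorem HasWeakDerivOn.mono {a b c d : ℝ} (hac : a ≤ c) (hdb : d ≤ b) {f g : ℝ → E}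
    (h : HasWeakDerivOn a b f g) : HasWeakDerivOn c d f g := by
  intro φ h1 h2 h3
  have hs : Ioo c d ⊆ Ioo a b := Ioo_subset_Ioo hac hdb
  have key : ∀ (χ : ℝ → ℝ) (u : ℝ → E), tsupport χ ⊆ Ioo c d →
      ∫ x in Ioo c d, χ x • u x = ∫ x in Ioo a b, χ x • u x := fun χ u hχ =>
    (setIntegral_eq_of_subset_of_forall_sdiff_eq_zero measurableSet_Ioo hs fun x hx => by
      rw [image_eq_zero_of_notMem_tsupport fun h => hx.2 (hχ h), zero_smul]).symm
  rw [key _ f ((tsupport_deriv_subset).trans h3), key _ g h3]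
  exact h φ h1 h2 (h3.trans hs)

end AC

/-! ### Lower bounds for the embedding constants

They are obtained from the spherical harmonic `cos θ` of degree one. -/

section Embedding

theorem lintegral_sphereMeasure (r : ℝ) {g : ℝ → ℝ} (hg : Continuous g) (h0 : ∀ x, 0 ≤ g x) :
    ∫⁻ x, ENNReal.ofReal (g x.1) ∂(sphereMeasure r)
      = ENNReal.ofReal (2 * Real.pi * r ^ 2 * ∫ θ in (0 : ℝ)..Real.pi, g θ * Real.sin θ) := by
  have hm : Measurable fun x : ℝ × ℝ => ENNReal.ofReal (r ^ 2 * Real.sin x.1) := by fun_prop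
  have hgm : Measurable fun x : ℝ × ℝ => ENNReal.ofReal (g x.1) :=
    (ENNReal.measurable_ofReal.comp hg.measurable).comp measurable_fst
  rw [sphereMeasure, lintegral_withDensity_eq_lintegral_mul _ hm hgm, Measure.volume_eq_prod,
    ← Measure.prod_restrict, lintegral_prod _ (hm.mul hgm).aemeasurable]
  simp only [Pi.mul_apply, lintegral_const, MeasurableSet.univ, Measure.restrict_apply, univ_inter,
    Real.volume_Ioo, sub_zero]
  rw [lintegral_mul_const' _ _ ENNReal.ofReal_ne_top]
  have e1 : ∫⁻ x in Ioo 0 Real.pi, ENNReal.ofReal (r ^ 2 * Real.sin x) * ENNReal.ofReal (g x)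
      = ∫⁻ x in Ioo 0 Real.pi, ENNReal.ofReal (r ^ 2 * (g x * Real.sin x)) := by
    refine setLIntegral_congr_fun measurableSet_Ioo fun x hx => ?_
    have : 0 ≤ Real.sin x := (Real.sin_pos_of_mem_Ioo hx).le
    rw [← ENNReal.ofReal_mul (by positivity)]
    congr 1
    ring
  have hc : Continuous fun x => r ^ 2 * (g x * Real.sin x) := by fun_prop
  rw [e1, ← ofReal_integral_eq_lintegral_ofReal
    (hc.continuousOn.integrableOn_Icc.mono_set Ioo_subset_Icc_self), ← ENNReal.ofReal_mul']
  · rw [integral_const_mul, intervalIntegral.integral_of_le Real.pi_pos.le,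
      integral_Ioc_eq_integral_Ioo]
    congr 1
    ring
  · positivity
  · refine (ae_restrict_iff' measurableSet_Ioo).2 (Eventually.of_forall fun x hx => ?_)
    have : 0 ≤ Real.sin x := (Real.sin_pos_of_mem_Ioo hx).le
    have := h0 x
    simp only [Pi.zero_apply]
    positivity

theorem integral_cos_pow_mul_sin (n : ℕ) (a b : ℝ) :
    ∫ θ in a..b, Real.cos θ ^ n * Real.sin θ
      = (Real.cos a ^ (n + 1) - Real.cos b ^ (n + 1)) / (n + 1) := by
  have h : ∀ x ∈ uIcc a b, HasDerivAt (fun x => -(Real.cos x ^ (n + 1) / (n + 1)))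
      (Real.cos x ^ n * Real.sin x) x := by
    intro x _
    have h1 := (((Real.hasDerivAt_cos x).pow (n + 1)).div_const ((n : ℝ) + 1)).neg
    convert! h1 using 1
    have : (n : ℝ) + 1 ≠ 0 := by positivity
    push_cast
    field_simp
  rw [intervalIntegral.integral_eq_sub_of_hasDerivAt h
    (Continuous.intervalIntegrable (by fun_prop) _ _)]
  ring

theorem integral_abs_cos_pow_mul_sin (n : ℕ) :
    ∫ θ in (0 : ℝ)..Real.pi, |Real.cos θ| ^ n * Real.sin θ = 2 / (n + 1) := by
  have hc : Continuous fun θ => |Real.cos θ| ^ n * Real.sin θ := by fun_prop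
  have hp := Real.pi_pos
  rw [← intervalIntegral.integral_add_adjacent_intervals (b := Real.pi / 2)
    (hc.intervalIntegrable _ _) (hc.intervalIntegrable _ _)]
  have e1 : ∫ θ in (0 : ℝ)..(Real.pi / 2), |Real.cos θ| ^ n * Real.sin θ
      = ∫ θ in (0 : ℝ)..(Real.pi / 2), Real.cos θ ^ n * Real.sin θ := by
    refine intervalIntegral.integral_congr fun x hx => ?_
    rw [uIcc_of_le (by linarith)] at hx
    rw [abs_of_nonneg (Real.cos_nonneg_of_mem_Icc ⟨by linarith [hx.1], hx.2⟩)]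
  have e2 : ∫ θ in (Real.pi / 2)..Real.pi, |Real.cos θ| ^ n * Real.sin θ
      = ∫ θ in (Real.pi / 2)..Real.pi, (-1) ^ n * (Real.cos θ ^ n * Real.sin θ) := by
    refine intervalIntegral.integral_congr fun x hx => ?_
    rw [uIcc_of_le (by linarith)] at hx
    rw [abs_of_nonpos (Real.cos_nonpos_of_pi_div_two_le_of_le hx.1 (by linarith [hx.2])), neg_pow,
      mul_assoc]
  rw [e1, e2, intervalIntegral.integral_const_mul, integral_cos_pow_mul_sin,
    integral_cos_pow_mul_sin]
  have h3 : (-1 : ℝ) ^ n * (-1) ^ n = 1 := by rw [← mul_pow]; simp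
  have : (n : ℝ) + 1 ≠ 0 := by positivity
  simp only [Real.cos_zero, one_pow, Real.cos_pi_div_two, Real.cos_pi, pow_succ, mul_zero, mul_one]
  field_simp
  linear_combination h3

theorem lintegral_abs_cos_pow (r : ℝ) (n : ℕ) :
    ∫⁻ x, ENNReal.ofReal (|Real.cos x.1| ^ n) ∂(sphereMeasure r)
      = ENNReal.ofReal (4 * Real.pi * r ^ 2 / (n + 1)) := by
  rw [lintegral_sphereMeasure r (g := fun x => |Real.cos x| ^ n) (by fun_prop)
    (fun x => by positivity), integral_abs_cos_pow_mul_sin]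
  congr 1
  ring

instance (r : ℝ) : IsFiniteMeasure (sphereMeasure r) := by
  refine ⟨?_⟩
  have := lintegral_abs_cos_pow r 0
  simp only [pow_zero, ENNReal.ofReal_one, lintegral_const, one_mul] at this
  rw [this]
  exact ENNReal.ofReal_lt_top

theorem onSphere_X_two (x : ℝ × ℝ) : onSphere (MvPolynomial.X 2) x = (Real.cos x.1 : ℂ) := by
  simp [onSphere, unitVector]

theorem eLpNorm_cos (r : ℝ) (n : ℕ) (hn : n ≠ 0) :
    eLpNorm (onSphere (MvPolynomial.X 2)) n (sphereMeasure r)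
      = ENNReal.ofReal (4 * Real.pi * r ^ 2 / (n + 1)) ^ (1 / (n : ℝ)) := by
  rw [eLpNorm_eq_lintegral_rpow_enorm_toReal (by exact_mod_cast hn) (by simp),
    ENNReal.toReal_natCast, ← lintegral_abs_cos_pow]
  congr 1
  refine lintegral_congr fun x => ?_
  rw [onSphere_X_two, ENNReal.rpow_natCast, ← ofReal_norm, Complex.norm_real, Real.norm_eq_abs,
    ENNReal.ofReal_pow (abs_nonneg _)]

/-- The coefficients of the spherical harmonic `cos θ`. -/
noncomputable def axialHarmonic (l : ℕ) : MvPolynomial (Fin 3) ℂ := if l = 1 then MvPolynomial.X 2 else 0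

theorem onSphere_zero : onSphere 0 = 0 := by
  ext x
  simp [onSphere]

theorem hasHarmonicExpansion_axialHarmonic (r : ℝ) :
    HasHarmonicExpansion r axialHarmonic (onSphere (MvPolynomial.X 2)) := by
  have hf : onSphere (MvPolynomial.X 2) = fun x => (Real.cos x.1 : ℂ) := funext onSphere_X_two
  refine ⟨fun l => ?_, by simp [axialHarmonic], ?_, ?_⟩
  · rw [axialHarmonic]
    split_ifs with h
    · subst h
      refine ⟨MvPolynomial.isHomogeneous_X ℂ 2, Finset.sum_eq_zero fun i _ => ?_⟩
      rw [MvPolynomial.pderiv_X]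
      by_cases h : (2 : Fin 3) = i
      · subst h; simp
      · rw [Pi.single_eq_of_ne (Ne.intro h)]
        simp
    · exact ⟨MvPolynomial.isHomogeneous_zero _ _ _, by simp⟩
  · rw [hf]
    refine MemLp.of_bound (Continuous.aestronglyMeasurable (by fun_prop)) 1
      (Eventually.of_forall fun x => ?_)
    rw [Complex.norm_real]
    exact Real.abs_cos_le_one _
  · refine tendsto_const_nhds.congr' ?_
    filter_upwards [eventually_ge_atTop 2] with n hn
    have : ∀ x, ∑ l ∈ Finset.range n, onSphere (axialHarmonic l) x
        = onSphere (MvPolynomial.X 2) x := fun x => by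
      rw [Finset.sum_eq_single 1]
      · simp [axialHarmonic]
      · intro l _ hl
        simp [axialHarmonic, hl, onSphere_zero]
      · intro h
        exact absurd (Finset.mem_range.2 (by omega)) h
    simp [this]

theorem harmonicNorm_axialHarmonic (r s : ℝ) :
    harmonicNorm r s axialHarmonic
      = ENNReal.ofReal ((2 / r ^ 2) ^ s * (4 * Real.pi * r ^ 2 / 3)) ^ (1 / 2 : ℝ) := by
  rw [harmonicNorm, tsum_eq_single 1]
  · have h2 := eLpNorm_cos r 2 two_ne_zero
    push_cast at h2
    simp only [axialHarmonic, if_true]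
    rw [h2, ← ENNReal.rpow_natCast, ← ENNReal.rpow_mul, ENNReal.ofReal_mul (by positivity)]
    norm_num
  · intro l hl
    simp [axialHarmonic, hl, onSphere_zero]

/-- Every admissible `C` satisfies the embedding inequality for cos θ. The sixth power removes both
the n-th root of the L^n norm, leaving the exponent `k`, and the square root of the Sobolev norm,
leaving a cube. The hypothesis `hx` compares what remains. -/
theorem ofReal_le_embeddingConstant {r s x : ℝ} {n k : ℕ} (hnk : n * k = 6)
    (hx : x ^ 6 * ((2 / r ^ 2) ^ s * (4 * Real.pi * r ^ 2 / 3)) ^ 3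
      ≤ (4 * Real.pi * r ^ 2 / (n + 1)) ^ k)
    (hr : 0 < r) :
    ENNReal.ofReal x ≤ embeddingConstant r s n := by
  have hp := Real.pi_pos
  have hn : n ≠ 0 := by rintro rfl; simp at hnk
  have hN : 0 < (2 / r ^ 2) ^ s * (4 * Real.pi * r ^ 2 / 3) := by positivity
  refine le_sInf fun C hC => ?_
  have h := hC axialHarmonic _ (hasHarmonicExpansion_axialHarmonic r) (by
    rw [harmonicNorm_axialHarmonic]
    exact ENNReal.rpow_ne_top_of_nonneg (by norm_num) ENNReal.ofReal_ne_top)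
  rw [harmonicNorm_axialHarmonic, eLpNorm_cos r n hn] at h
  rcases eq_or_ne C ⊤ with rfl | hCt
  · exact le_top
  rw [← ENNReal.ofReal_toReal hCt]
  have h6 := pow_le_pow_left' h 6
  have e6 : (6 : ℝ) = n * k := by exact_mod_cast hnk.symm
  have hn0 : (n : ℝ) ≠ 0 := by exact_mod_cast hn
  have l1 : (ENNReal.ofReal (4 * Real.pi * r ^ 2 / (n + 1)) ^ (1 / (n : ℝ))) ^ 6
      = ENNReal.ofReal ((4 * Real.pi * r ^ 2 / (n + 1)) ^ k) := by
    rw [← ENNReal.rpow_natCast, ← ENNReal.rpow_mul, ENNReal.ofReal_pow (by positivity),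
      ← ENNReal.rpow_natCast]
    congr 1
    push_cast
    rw [e6]
    field_simp
  have l2 : (ENNReal.ofReal ((2 / r ^ 2) ^ s * (4 * Real.pi * r ^ 2 / 3)) ^ (1 / 2 : ℝ)) ^ 6
      = ENNReal.ofReal (((2 / r ^ 2) ^ s * (4 * Real.pi * r ^ 2 / 3)) ^ 3) := by
    rw [← ENNReal.rpow_natCast, ← ENNReal.rpow_mul, ENNReal.ofReal_pow hN.le,
      ← ENNReal.rpow_natCast]
    norm_num
  rw [mul_pow, l1, l2, ← ENNReal.ofReal_toReal hCt, ← ENNReal.ofReal_pow ENNReal.toReal_nonneg,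
    ← ENNReal.ofReal_mul (by positivity), ENNReal.ofReal_le_ofReal_iff (by positivity)] at h6
  refine ENNReal.ofReal_le_ofReal ?_
  have h7 : x ^ 6 ≤ C.toReal ^ 6 := le_of_mul_le_mul_right (hx.trans h6) (by positivity)
  exact le_of_abs_le ((pow_le_pow_iff_left₀ (abs_nonneg x) ENNReal.toReal_nonneg
    (by norm_num : (6 : ℕ) ≠ 0)).1 (by rwa [Even.pow_abs (by decide)]))

theorem exists_pow_six_eq {y : ℝ} (hy : 0 ≤ y) : ∃ x : ℝ, 0 ≤ x ∧ x ^ 6 = y :=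
  ⟨y ^ (1 / 6 : ℝ), by positivity, by
    rw [← Real.rpow_natCast, ← Real.rpow_mul hy]; norm_num⟩

/-- The number `x` is the exact quotient of norms for cos θ: the integral of cos⁶ is 4πr²/7, and the
squared H¹ norm is (2/r²)(4πr²/3) = 8π/3. -/
theorem exists_le_embeddingConstant_one_six {r : ℝ} (hr : 0 < r) :
    ∃ x : ℝ, 0 ≤ x ∧ x ^ 6 * (8 * Real.pi / 3) ^ 3 = 4 * Real.pi * r ^ 2 / 7 ∧
      ENNReal.ofReal x ≤ embeddingConstant r 1 6 := by
  have hp := Real.pi_pos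
  obtain ⟨x, hx, h⟩ := exists_pow_six_eq
    (y := (4 * Real.pi * r ^ 2 / 7) / (8 * Real.pi / 3) ^ 3) (by positivity)
  have h' : x ^ 6 * (8 * Real.pi / 3) ^ 3 = 4 * Real.pi * r ^ 2 / 7 := by
    rw [h]; field_simp
  refine ⟨x, hx, h', ?_⟩
  have := ofReal_le_embeddingConstant (r := r) (s := 1) (x := x) (n := 6) (k := 1) rfl ?_ hr
  · exact_mod_cast this
  · have e : 2 / r ^ 2 * (4 * Real.pi * r ^ 2 / 3) = 8 * Real.pi / 3 := by field_simp; ring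
    rw [Real.rpow_one, e, h']
    apply le_of_eq
    push_cast
    ring

/-- Here the integral of |cos|³ is πr² and the squared H² norm of cos θ is 16π/(3r²). -/
theorem exists_le_embeddingConstant_two_three {r : ℝ} (hr : 0 < r) :
    ∃ x : ℝ, 0 ≤ x ∧ x ^ 6 * (16 * Real.pi / 3) ^ 3 = Real.pi ^ 2 * r ^ 10 ∧
      ENNReal.ofReal x ≤ embeddingConstant r 2 3 := by
  have hp := Real.pi_pos
  obtain ⟨x, hx, h⟩ := exists_pow_six_eq
    (y := (Real.pi ^ 2 * r ^ 10) / (16 * Real.pi / 3) ^ 3) (by positivity)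
  have h' : x ^ 6 * (16 * Real.pi / 3) ^ 3 = Real.pi ^ 2 * r ^ 10 := by
    rw [h]; field_simp
  refine ⟨x, hx, h', ?_⟩
  have := ofReal_le_embeddingConstant (r := r) (s := 2) (x := x) (n := 3) (k := 2) rfl ?_ hr
  · exact_mod_cast this
  · have e : (2 / r ^ 2) ^ 2 * (4 * Real.pi * r ^ 2 / 3) = (16 * Real.pi / 3) / r ^ 2 := by
      field_simp; ring
    rw [Real.rpow_two, e, div_pow, mul_div_assoc', h']
    apply le_of_eq
    push_cast
    field_simp
    ring

/-- Again the integral of |cos|³ is πr²; the squared norm of order 1/2 of cos θ is √2 (4π/3) r. -/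
theorem exists_le_embeddingConstant_half_three {r : ℝ} (hr : 0 < r) :
    ∃ x : ℝ, 0 ≤ x ∧ x ^ 6 * (√2 * (4 * Real.pi / 3)) ^ 3 = Real.pi ^ 2 * r ∧
      ENNReal.ofReal x ≤ embeddingConstant r (1 / 2) 3 := by
  have hp := Real.pi_pos
  obtain ⟨x, hx, h⟩ := exists_pow_six_eq
    (y := (Real.pi ^ 2 * r) / (√2 * (4 * Real.pi / 3)) ^ 3) (by positivity)
  have h' : x ^ 6 * (√2 * (4 * Real.pi / 3)) ^ 3 = Real.pi ^ 2 * r := by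
    rw [h]; field_simp
  refine ⟨x, hx, h', ?_⟩
  have := ofReal_le_embeddingConstant (r := r) (s := 1 / 2) (x := x) (n := 3) (k := 2) rfl ?_ hr
  · exact_mod_cast this
  · have e : (2 / r ^ 2) ^ (1 / 2 : ℝ) * (4 * Real.pi * r ^ 2 / 3)
        = (√2 * (4 * Real.pi / 3)) * r := by
      rw [← Real.sqrt_eq_rpow, Real.sqrt_div (by norm_num), Real.sqrt_sq hr.le]
      field_simp
    rw [e, mul_pow, ← mul_assoc, h']
    apply le_of_eq
    push_cast
    ring

theorem zonalL2Norm_eq (r : ℝ) (f : ℝ → ℝ) :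
    zonalL2Norm r f = √(2 * Real.pi * r ^ 2 * ∫ θ in Ioo 0 Real.pi, f θ ^ 2 * Real.sin θ) := by
  have : ∫ θ in Ioo 0 Real.pi, f θ ^ 2 * (r ^ 2 * Real.sin θ)
      = r ^ 2 * ∫ θ in Ioo 0 Real.pi, f θ ^ 2 * Real.sin θ := by
    rw [← integral_const_mul]
    congr 1
    ext x
    ring
  rw [zonalL2Norm, this, mul_assoc (2 * Real.pi)]

theorem integral_sq_mul_sin_nonneg (f : ℝ → ℝ) :
    0 ≤ ∫ θ in Ioo 0 Real.pi, f θ ^ 2 * Real.sin θ :=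
  setIntegral_nonneg measurableSet_Ioo fun _ hx =>
    mul_nonneg (sq_nonneg _) (Real.sin_pos_of_mem_Ioo hx).le

theorem SmallShear.lt {r γ : ℝ} {m : ℤ} {Ω₁ : ℝ → ℝ} (hr : 0 < r) (hγ : 0 < γ)
    (h : SmallShear r γ m Ω₁) :
    27 / 80 * (|(m : ℝ)| * √(∫ θ in Ioo 0 Real.pi, Ω₁ θ ^ 2 * Real.sin θ)) * r ^ 2 < γ := by
  have hp := Real.pi_pos
  obtain ⟨x, hx, hx6, hxC⟩ := exists_le_embeddingConstant_one_six hr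
  obtain ⟨y, hy, hy6, hyC⟩ := exists_le_embeddingConstant_two_three hr
  rw [SmallShear] at h
  set J := ∫ θ in Ioo 0 Real.pi, Ω₁ θ ^ 2 * Real.sin θ with hJ
  have hJ0 : 0 ≤ J := integral_sq_mul_sin_nonneg Ω₁
  have h1 := lt_of_le_of_lt (mul_le_mul' (mul_le_mul_right hyC
    (ENNReal.ofReal (zonalL2Norm r Ω₁ * (|(m : ℝ)| / r)))) hxC) h
  have hz : 0 ≤ zonalL2Norm r Ω₁ := Real.sqrt_nonneg _
  rw [← ENNReal.ofReal_mul (by positivity), ← ENNReal.ofReal_mul (by positivity),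
    ENNReal.ofReal_lt_ofReal_iff hγ, zonalL2Norm_eq, ← hJ, Real.sqrt_mul (by positivity),
    Real.sqrt_mul (by positivity), Real.sqrt_sq hr.le] at h1
  -- For cos θ the quotient of the right side by r² is the sixth root of 23328/14680064, about
  -- 0.3416, which 27/80 rounds down.
  have h2 : 27 / 80 * r ^ 2 ≤ √(2 * Real.pi) * (x * y) := by
    refine (pow_le_pow_iff_left₀ (by positivity) (by positivity) (by norm_num : (6 : ℕ) ≠ 0)).1 ?_
    have e : √(2 * Real.pi) ^ 6 = (2 * Real.pi) ^ 3 := by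
      rw [show (6 : ℕ) = 2 * 3 by norm_num, pow_mul, Real.sq_sqrt (by positivity)]
    rw [mul_pow _ (x * y), e, mul_pow x]
    have hxe : x ^ 6 = (4 * Real.pi * r ^ 2 / 7) / (8 * Real.pi / 3) ^ 3 := by
      rw [← hx6]; field_simp
    have hye : y ^ 6 = Real.pi ^ 2 * r ^ 10 / (16 * Real.pi / 3) ^ 3 := by
      rw [← hy6]; field_simp
    rw [hxe, hye]
    have : (2 * Real.pi) ^ 3 * (4 * Real.pi * r ^ 2 / 7 / (8 * Real.pi / 3) ^ 3
        * (Real.pi ^ 2 * r ^ 10 / (16 * Real.pi / 3) ^ 3))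
        = (8 * 4 * 729 / (7 * 8 ^ 3 * 16 ^ 3)) * r ^ 12 := by
      field_simp
      ring
    rw [this, mul_pow, ← pow_mul]
    gcongr
    norm_num
  calc 27 / 80 * (|(m : ℝ)| * √J) * r ^ 2 = (27 / 80 * r ^ 2) * (|(m : ℝ)| * √J) := by ring
    _ ≤ (√(2 * Real.pi) * (x * y)) * (|(m : ℝ)| * √J) := by gcongr
    _ = √(2 * Real.pi) * r * √J * (|(m : ℝ)| / r) * y * x := by field_simp
    _ < γ := h1

theorem LargeFrequency.lt {r γ ω Ωref : ℝ} {Ω Ω₁ : ℝ → ℝ} (hr : 0 < r) (hγ : 0 < γ)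
    (h : LargeFrequency r γ ω Ωref Ω Ω₁) :
    87 / 200 * ((∫ θ in Ioo 0 Real.pi, (Ω θ - Ωref) ^ 2 * Real.sin θ)
      + 9 * ∫ θ in Ioo 0 Real.pi, Ω θ ^ 2 * Real.sin θ) ^ 2 * r ^ 6 < |ω| * γ ^ 3 := by
  have hp := Real.pi_pos
  obtain ⟨x, hx, hx6, hxC⟩ := exists_le_embeddingConstant_one_six hr
  obtain ⟨y, hy, hy6, hyC⟩ := exists_le_embeddingConstant_half_three hr
  rw [LargeFrequency] at h
  set J := ∫ θ in Ioo 0 Real.pi, (Ω θ - Ωref) ^ 2 * Real.sin θ with hJ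
  have hJ0 : 0 ≤ J := integral_sq_mul_sin_nonneg fun θ => Ω θ - Ωref
  set K := ∫ θ in Ioo 0 Real.pi, Ω θ ^ 2 * Real.sin θ with hK
  have hK0 : 0 ≤ K := integral_sq_mul_sin_nonneg Ω
  -- The gradient parts of both H¹ norms are discarded: the coercivity estimate for large
  -- frequencies needs only the L² norms of Ω - Ωref and Ω.
  have hN : 2 * Real.pi * r ^ 2 * (J + 9 * K) ≤ zonalH1Norm r (fun θ => Ω θ - Ωref) Ω₁ ^ 2
          + 9 * zonalH1Norm r Ω Ω₁ ^ 2 := by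
    rw [zonalH1Norm, zonalH1Norm, Real.sq_sqrt (by positivity), Real.sq_sqrt (by positivity),
      zonalL2Norm_eq r Ω, zonalL2Norm_eq r fun θ => Ω θ - Ωref, Real.sq_sqrt (by positivity),
      Real.sq_sqrt (by positivity)]
    nlinarith [sq_nonneg (zonalL2Norm r fun θ => Ω₁ θ / r)]
  have h1 : ENNReal.ofReal (4 / γ ^ 3) * (ENNReal.ofReal x * ENNReal.ofReal y) ^ 4
      * ENNReal.ofReal ((2 * Real.pi * r ^ 2 * (J + 9 * K)) ^ 2) < ENNReal.ofReal |ω| := by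
    refine lt_of_le_of_lt ?_ h
    gcongr
  -- Comparing real numbers through `ENNReal.ofReal` requires a positive right side; the strict
  -- inequality itself provides it.
  have hω : 0 < |ω| := by
    by_contra hc
    rw [ENNReal.ofReal_of_nonpos (not_lt.1 hc)] at h1
    exact absurd h1 not_lt_zero
  rw [← ENNReal.ofReal_mul (by positivity), ← ENNReal.ofReal_pow (by positivity),
    ← ENNReal.ofReal_mul (by positivity), ← ENNReal.ofReal_mul (by positivity),
    ENNReal.ofReal_lt_ofReal_iff hω] at h1
  -- The value for cos θ has the factor 0.4357… in place of 87/200. The denominator 16π² cancels the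
  -- constants 4 and (2π)² of the condition.
  have h2 : 87 / 200 * r ^ 2 / (16 * Real.pi ^ 2) ≤ (x * y) ^ 4 := by
    refine (pow_le_pow_iff_left₀ (by positivity) (by positivity) (by norm_num : (3 : ℕ) ≠ 0)).1 ?_
    have hxe : x ^ 6 = (4 * Real.pi * r ^ 2 / 7) / (8 * Real.pi / 3) ^ 3 := by
      rw [← hx6]; field_simp
    have hye : y ^ 6 = Real.pi ^ 2 * r / (√2 * (4 * Real.pi / 3)) ^ 3 := by
      rw [← hy6]; field_simp
    have e : ((x * y) ^ 4) ^ 3 = (x ^ 6) ^ 2 * (y ^ 6) ^ 2 := by ring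
    have e2 : √2 ^ 6 = 8 := by
      rw [pow_mul √2 2 3, Real.sq_sqrt (by positivity)]; norm_num
    have : ((x * y) ^ 4) ^ 3
        = (16 * 729 * 729 / (49 * 8 ^ 6 * 8 * 4 ^ 6)) * r ^ 6 / Real.pi ^ 6 := by
      rw [e, hxe, hye, div_pow _ ((√2 * (4 * Real.pi / 3)) ^ 3), ← pow_mul, mul_pow √2, e2]
      field_simp
      ring
    rw [this]
    have : (87 / 200 * r ^ 2 / (16 * Real.pi ^ 2)) ^ 3
        = (87 / 200 / 16) ^ 3 * r ^ 6 / Real.pi ^ 6 := by field_simp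
    rw [this]
    gcongr
    norm_num
  have h3 : 4 / γ ^ 3 * (87 / 200 * r ^ 2 / (16 * Real.pi ^ 2))
      * (2 * Real.pi * r ^ 2 * (J + 9 * K)) ^ 2 < |ω| := lt_of_le_of_lt (by gcongr) h1
  have e : 4 / γ ^ 3 * (87 / 200 * r ^ 2 / (16 * Real.pi ^ 2))
      * (2 * Real.pi * r ^ 2 * (J + 9 * K)) ^ 2
      = (87 / 200 * (J + 9 * K) ^ 2 * r ^ 6) / γ ^ 3 := by field_simp; ring
  rw [e, div_lt_iff₀ (by positivity)] at h3
  exact h3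

end Embedding

/-! ### Inequalities for functions with vanishing Cauchy data on an interval -/

/-- **Cauchy-Schwarz inequality** for integrals. -/
theorem sq_integral_mul_le {α : Type*} [MeasurableSpace α] {μ : Measure α} {f g : α → ℝ}
    (hf : Integrable (fun x => f x ^ 2) μ) (hg : Integrable (fun x => g x ^ 2) μ)
    (hfg : Integrable (fun x => f x * g x) μ) :
    (∫ x, f x * g x ∂μ) ^ 2 ≤ (∫ x, f x ^ 2 ∂μ) * ∫ x, g x ^ 2 ∂μ := by
  have h : ∀ t : ℝ, 0 ≤ (∫ x, g x ^ 2 ∂μ) * (t * t) + (2 * ∫ x, f x * g x ∂μ) * t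
      + ∫ x, f x ^ 2 ∂μ := by
    intro t
    have e : ∫ x, (f x + t * g x) ^ 2 ∂μ
        = (∫ x, g x ^ 2 ∂μ) * (t * t) + (2 * ∫ x, f x * g x ∂μ) * t + ∫ x, f x ^ 2 ∂μ := by
      have e1 : (fun x => (f x + t * g x) ^ 2)
          = fun x => (t * t) * g x ^ 2 + (2 * t) * (f x * g x) + f x ^ 2 := by
        ext x; ring
      rw [e1, integral_add ((hg.const_mul _).fun_add (hfg.const_mul _)) hf,
        integral_add (hg.const_mul _) (hfg.const_mul _), integral_const_mul, integral_const_mul]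
      ring
    rw [← e]
    exact integral_nonneg fun x => sq_nonneg _
  have := discrim_le_zero h
  rw [discrim] at this
  nlinarith

theorem abs_integral_mul_le {α : Type*} [MeasurableSpace α] {μ : Measure α} {f g : α → ℝ}
    (hf : Integrable (fun x => f x ^ 2) μ) (hg : Integrable (fun x => g x ^ 2) μ)
    (hfg : Integrable (fun x => f x * g x) μ) :
    |∫ x, f x * g x ∂μ| ≤ √((∫ x, f x ^ 2 ∂μ) * ∫ x, g x ^ 2 ∂μ) :=
  Real.abs_le_sqrt (sq_integral_mul_le hf hg hfg)

/-- `y₀` is a function on `[a, b] ⊆ (0, π)` with absolutely continuous derivative `y₁`, square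
integrable second derivative `y₂`, and `y₀ = y₁ = 0` at the end points. -/
structure Clamped (a b : ℝ) (y₀ y₁ y₂ : ℝ → ℂ) : Prop where
  pos : 0 < a
  lt : a < b
  lt_pi : b < Real.pi
  ac₀ : ACDeriv a b y₀ y₁
  ac₁ : ACDeriv a b y₁ y₂
  memLp : MemLp y₂ 2 (volume.restrict (Ioo a b))
  left₀ : y₀ a = 0
  right₀ : y₀ b = 0
  left₁ : y₁ a = 0
  right₁ : y₁ b = 0

/-- The separated Laplacian on the unit sphere. -/
noncomputable def unitLap (μ : ℝ) (y₀ y₁ y₂ : ℝ → ℂ) (x : ℝ) : ℂ :=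
  y₂ x + ((Real.cos x / Real.sin x : ℝ) : ℂ) * y₁ x - ((μ ^ 2 / Real.sin x ^ 2 : ℝ) : ℂ) * y₀ x

theorem unitLap_re (μ : ℝ) (y₀ y₁ y₂ : ℝ → ℂ) (x : ℝ) :
    (unitLap μ y₀ y₁ y₂ x).re = (y₂ x).re + Real.cos x / Real.sin x * (y₁ x).re
      - μ ^ 2 / Real.sin x ^ 2 * (y₀ x).re := by
  rw [unitLap, Complex.sub_re, Complex.add_re, Complex.re_ofReal_mul, Complex.re_ofReal_mul]

theorem unitLap_im (μ : ℝ) (y₀ y₁ y₂ : ℝ → ℂ) (x : ℝ) :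
    (unitLap μ y₀ y₁ y₂ x).im = (y₂ x).im + Real.cos x / Real.sin x * (y₁ x).im
      - μ ^ 2 / Real.sin x ^ 2 * (y₀ x).im := by
  rw [unitLap, Complex.sub_im, Complex.add_im, Complex.im_ofReal_mul, Complex.im_ofReal_mul]

theorem norm_sq_eq_re_im (z : ℂ) : ‖z‖ ^ 2 = z.re ^ 2 + z.im ^ 2 := by
  rw [Complex.sq_norm, Complex.normSq_apply]; ring

/-- `∫ |Δ y|² sin`. -/
noncomputable def lapEnergy (a b μ : ℝ) (y₀ y₁ y₂ : ℝ → ℂ) : ℝ :=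
  ∫ x in Ioo a b, Real.sin x * ‖unitLap μ y₀ y₁ y₂ x‖ ^ 2

/-- `∫ |y|² sin`. -/
noncomputable def massEnergy (a b : ℝ) (y : ℝ → ℂ) : ℝ :=
  ∫ x in Ioo a b, Real.sin x * ‖y x‖ ^ 2

/-- `∫ |y|² / sin`. -/
noncomputable def angularEnergy (a b : ℝ) (y : ℝ → ℂ) : ℝ :=
  ∫ x in Ioo a b, ‖y x‖ ^ 2 / Real.sin x

/-- `∫ |∇ y|² sin`. -/
noncomputable def gradEnergy (a b μ : ℝ) (y₀ y₁ : ℝ → ℂ) : ℝ :=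
  massEnergy a b y₁ + μ ^ 2 * angularEnergy a b y₀

namespace Clamped

variable {a b μ : ℝ} {y₀ y₁ y₂ : ℝ → ℂ}

theorem sin_pos (h : Clamped a b y₀ y₁ y₂) {x : ℝ} (hx : x ∈ Icc a b) : 0 < Real.sin x :=
  Real.sin_pos_of_mem_Ioo ⟨h.pos.trans_le hx.1, hx.2.trans_lt h.lt_pi⟩

theorem re₀ (h : Clamped a b y₀ y₁ y₂) :
    ACDeriv a b (fun x => (y₀ x).re) fun x => (y₁ x).re := h.ac₀.clm Complex.reCLM

theorem im₀ (h : Clamped a b y₀ y₁ y₂) :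
    ACDeriv a b (fun x => (y₀ x).im) fun x => (y₁ x).im := h.ac₀.clm Complex.imCLM

theorem re₁ (h : Clamped a b y₀ y₁ y₂) :
    ACDeriv a b (fun x => (y₁ x).re) fun x => (y₂ x).re := h.ac₁.clm Complex.reCLM

theorem im₁ (h : Clamped a b y₀ y₁ y₂) :
    ACDeriv a b (fun x => (y₁ x).im) fun x => (y₂ x).im := h.ac₁.clm Complex.imCLM

theorem continuousOn₀ (h : Clamped a b y₀ y₁ y₂) : ContinuousOn y₀ (Icc a b) :=
  h.ac₀.continuousOn h.lt.le

theorem continuousOn₁ (h : Clamped a b y₀ y₁ y₂) : ContinuousOn y₁ (Icc a b) :=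
  h.ac₁.continuousOn h.lt.le

theorem ae_of_forall {p : ℝ → Prop} (h : ∀ x ∈ Icc a b, p x) :
    ∀ᵐ x ∂(volume.restrict (Ioo a b)), p x :=
  (ae_restrict_iff' measurableSet_Ioo).2
    (Eventually.of_forall fun x hx => h x (Ioo_subset_Icc_self hx))

theorem integrableOn_of_continuousOn {E : Type*} [NormedAddCommGroup E] {f : ℝ → E}
    (hf : ContinuousOn f (Icc a b)) : IntegrableOn f (Ioo a b) :=
  hf.integrableOn_Icc.mono_set Ioo_subset_Icc_self

theorem memLp_of_continuousOn {E : Type*} [NormedAddCommGroup E] {p : ℝ≥0∞} {f : ℝ → E}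
    (hf : ContinuousOn f (Icc a b)) : MemLp f p (volume.restrict (Ioo a b)) := by
  obtain ⟨C, hC⟩ := isCompact_Icc.exists_bound_of_continuousOn hf
  have : IsFiniteMeasure (volume.restrict (Ioo a b)) := ⟨by simp⟩
  refine MemLp.of_bound ((hf.mono Ioo_subset_Icc_self).aestronglyMeasurable measurableSet_Ioo) C ?_
  exact ae_of_forall hC

theorem memLp_continuousOn_mul {f g : ℝ → ℂ} (hf : ContinuousOn f (Icc a b))
    (hg : MemLp g 2 (volume.restrict (Ioo a b))) :
    MemLp (fun x => f x * g x) 2 (volume.restrict (Ioo a b)) :=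
  hg.mul (memLp_of_continuousOn (p := ⊤) hf)

theorem continuousOn_ofReal_cot (h : Clamped a b y₀ y₁ y₂) :
    ContinuousOn (fun x => ((Real.cos x / Real.sin x : ℝ) : ℂ)) (Icc a b) := by
  refine Complex.continuous_ofReal.comp_continuousOn (ContinuousOn.div (by fun_prop) (by fun_prop) ?_)
  exact fun x hx => (h.sin_pos hx).ne'

theorem continuousOn_ofReal_div_sin_sq (h : Clamped a b y₀ y₁ y₂) :
    ContinuousOn (fun x => ((μ ^ 2 / Real.sin x ^ 2 : ℝ) : ℂ)) (Icc a b) := by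
  refine Complex.continuous_ofReal.comp_continuousOn (ContinuousOn.div (by fun_prop) (by fun_prop) ?_)
  exact fun x hx => pow_ne_zero _ (h.sin_pos hx).ne'

theorem memLp_unitLap (h : Clamped a b y₀ y₁ y₂) :
    MemLp (unitLap μ y₀ y₁ y₂) 2 (volume.restrict (Ioo a b)) := by
  refine (h.memLp.add (memLp_of_continuousOn ?_)).sub (memLp_of_continuousOn ?_)
  · exact h.continuousOn_ofReal_cot.mul h.continuousOn₁
  · exact h.continuousOn_ofReal_div_sin_sq.mul h.continuousOn₀

theorem integrable_continuousOn_mul {f g : ℝ → ℝ} (hf : ContinuousOn f (Icc a b))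
    (hg : IntegrableOn g (Ioo a b)) : IntegrableOn (fun x => f x * g x) (Ioo a b) := by
  obtain ⟨C, hC⟩ := isCompact_Icc.exists_bound_of_continuousOn hf
  exact hg.bdd_mul ((hf.mono Ioo_subset_Icc_self).aestronglyMeasurable measurableSet_Ioo)
    (ae_of_forall hC)

theorem integrable_sin_mul_norm_sq {f : ℝ → ℂ} (hf : MemLp f 2 (volume.restrict (Ioo a b))) :
    IntegrableOn (fun x => Real.sin x * ‖f x‖ ^ 2) (Ioo a b) :=
  integrable_continuousOn_mul (by fun_prop) ((memLp_two_iff_integrable_sq_norm hf.1).1 hf)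

theorem integrable_massEnergy₀ (h : Clamped a b y₀ y₁ y₂) :
    IntegrableOn (fun x => Real.sin x * ‖y₀ x‖ ^ 2) (Ioo a b) :=
  integrable_sin_mul_norm_sq (memLp_of_continuousOn h.continuousOn₀)

theorem integrable_massEnergy₁ (h : Clamped a b y₀ y₁ y₂) :
    IntegrableOn (fun x => Real.sin x * ‖y₁ x‖ ^ 2) (Ioo a b) :=
  integrable_sin_mul_norm_sq (memLp_of_continuousOn h.continuousOn₁)

theorem integrable_angularEnergy (h : Clamped a b y₀ y₁ y₂) :
    IntegrableOn (fun x => ‖y₀ x‖ ^ 2 / Real.sin x) (Ioo a b) :=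
  integrableOn_of_continuousOn ((h.continuousOn₀.norm.pow 2).div (by fun_prop)
    fun x hx => (h.sin_pos hx).ne')

theorem lapEnergy_nonneg (h : Clamped a b y₀ y₁ y₂) : 0 ≤ lapEnergy a b μ y₀ y₁ y₂ :=
  setIntegral_nonneg measurableSet_Ioo fun _ hx =>
    mul_nonneg (h.sin_pos (Ioo_subset_Icc_self hx)).le (sq_nonneg _)

theorem massEnergy_nonneg (h : Clamped a b y₀ y₁ y₂) (y : ℝ → ℂ) : 0 ≤ massEnergy a b y :=
  setIntegral_nonneg measurableSet_Ioo fun _ hx =>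
    mul_nonneg (h.sin_pos (Ioo_subset_Icc_self hx)).le (sq_nonneg _)

theorem angularEnergy_nonneg (h : Clamped a b y₀ y₁ y₂) (y : ℝ → ℂ) : 0 ≤ angularEnergy a b y :=
  setIntegral_nonneg measurableSet_Ioo fun _ hx =>
    div_nonneg (sq_nonneg _) (h.sin_pos (Ioo_subset_Icc_self hx)).le

theorem gradEnergy_nonneg (h : Clamped a b y₀ y₁ y₂) : 0 ≤ gradEnergy a b μ y₀ y₁ :=
  add_nonneg (h.massEnergy_nonneg _) (mul_nonneg (sq_nonneg _) (h.angularEnergy_nonneg _))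

/-- If `A = B + f'` where `f` vanishes at the end points, then `∫ A = ∫ B`. -/
theorem integral_eq_of_deriv {A B f f' : ℝ → ℝ} (hab : a ≤ b) (hf : ACDeriv a b f f')
    (ha : f a = 0) (hb : f b = 0) (hB : IntegrableOn B (Ioo a b))
    (h : ∀ x ∈ Icc a b, A x = B x + f' x) : ∫ x in Ioo a b, A x = ∫ x in Ioo a b, B x := by
  rw [setIntegral_congr_fun measurableSet_Ioo fun x hx => h x (Ioo_subset_Icc_self hx),
    integral_add hB hf.integrableOn, hf.integral_eq_sub hab, ha, hb]
  simp

theorem acDeriv_sin (a b : ℝ) (hab : a ≤ b) : ACDeriv a b Real.sin Real.cos :=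
  ACDeriv.of_hasDerivAt hab (fun x _ => Real.hasDerivAt_sin x) (by fun_prop)

theorem acDeriv_cos (a b : ℝ) (hab : a ≤ b) : ACDeriv a b Real.cos fun x => -Real.sin x :=
  ACDeriv.of_hasDerivAt hab (fun x _ => Real.hasDerivAt_cos x) (by fun_prop)

/-- The derivative of `Re (y₁ conj y₀)`. -/
theorem acDeriv_re (h : Clamped a b y₀ y₁ y₂) :
    ACDeriv a b (fun x => (y₁ x).re * (y₀ x).re + (y₁ x).im * (y₀ x).im)
      (fun x => ((y₂ x).re * (y₀ x).re + (y₁ x).re * (y₁ x).re)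
        + ((y₂ x).im * (y₀ x).im + (y₁ x).im * (y₁ x).im)) :=
  (h.re₁.mul h.lt.le h.re₀).add (h.im₁.mul h.lt.le h.im₀)

/-- The derivative of `|y₀|²`. -/
theorem acDeriv_norm_sq₀ (h : Clamped a b y₀ y₁ y₂) :
    ACDeriv a b (fun x => ‖y₀ x‖ ^ 2)
      (fun x => 2 * ((y₁ x).re * (y₀ x).re + (y₁ x).im * (y₀ x).im)) := by
  have := (h.re₀.mul h.lt.le h.re₀).add (h.im₀.mul h.lt.le h.im₀)
  simp only [norm_sq_eq_re_im]
  simp only [sq]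
  refine this.congr_deriv (Eventually.of_forall fun x => ?_)
  ring

/-- The derivative of `|y₁|²`. -/
theorem acDeriv_norm_sq₁ (h : Clamped a b y₀ y₁ y₂) :
    ACDeriv a b (fun x => ‖y₁ x‖ ^ 2)
      (fun x => 2 * ((y₂ x).re * (y₁ x).re + (y₂ x).im * (y₁ x).im)) := by
  have := (h.re₁.mul h.lt.le h.re₁).add (h.im₁.mul h.lt.le h.im₁)
  simp only [norm_sq_eq_re_im]
  simp only [sq]
  refine this.congr_deriv (Eventually.of_forall fun x => ?_)
  ring

/-- Green's formula. -/
theorem integral_unitLap_mul (h : Clamped a b y₀ y₁ y₂) :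
    ∫ x in Ioo a b, Real.sin x * ((unitLap μ y₀ y₁ y₂ x).re * (y₀ x).re
      + (unitLap μ y₀ y₁ y₂ x).im * (y₀ x).im) = - gradEnergy a b μ y₀ y₁ := by
  have hd := (acDeriv_sin a b h.lt.le).mul h.lt.le h.acDeriv_re
  rw [integral_eq_of_deriv (B := fun x => -(Real.sin x * ‖y₁ x‖ ^ 2
    + μ ^ 2 * (‖y₀ x‖ ^ 2 / Real.sin x))) h.lt.le hd]
  · rw [integral_neg, integral_add h.integrable_massEnergy₁
      (h.integrable_angularEnergy.const_mul _), integral_const_mul]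
    rfl
  · simp [h.left₀]
  · simp [h.right₀]
  · exact (h.integrable_massEnergy₁.add (h.integrable_angularEnergy.const_mul _)).neg
  · intro x hx
    have hs := (h.sin_pos hx).ne'
    simp only [unitLap_re, unitLap_im, norm_sq_eq_re_im]
    field_simp
    ring

theorem abs_re_im_le (z w : ℂ) : |z.re * w.re + z.im * w.im| ≤ ‖z‖ * ‖w‖ := by
  have : z.re * w.re + z.im * w.im = (z * conj w).re := by simp
  rw [this]
  refine (Complex.abs_re_le_norm _).trans ?_
  simp

theorem abs_im_re_le (z w : ℂ) : |z.im * w.re - z.re * w.im| ≤ ‖z‖ * ‖w‖ := by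
  have : z.im * w.re - z.re * w.im = (z * conj w).im := by simp; ring
  rw [this]
  refine (Complex.abs_im_le_norm _).trans ?_
  simp

/-- The Cauchy-Schwarz inequality with weight `sin`. -/
theorem integral_sin_norm_mul_norm_le (h : Clamped a b y₀ y₁ y₂) {f g : ℝ → ℂ}
    (hf : MemLp f 2 (volume.restrict (Ioo a b))) (hg : MemLp g 2 (volume.restrict (Ioo a b))) :
    IntegrableOn (fun x => Real.sin x * (‖f x‖ * ‖g x‖)) (Ioo a b) ∧
    ∫ x in Ioo a b, Real.sin x * (‖f x‖ * ‖g x‖) ≤ √(massEnergy a b f * massEnergy a b g) := by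
  have hfg : IntegrableOn (fun x => Real.sin x * (‖f x‖ * ‖g x‖)) (Ioo a b) :=
    integrable_continuousOn_mul (by fun_prop) (hf.norm.integrable_mul hg.norm)
  refine ⟨hfg, ?_⟩
  have e : ∀ (k l : ℝ → ℂ), ∀ x ∈ Ioo a b,
      (√(Real.sin x) * ‖k x‖) * (√(Real.sin x) * ‖l x‖) = Real.sin x * (‖k x‖ * ‖l x‖) := by
    intro k l x hx
    have := Real.mul_self_sqrt (h.sin_pos (Ioo_subset_Icc_self hx)).le
    linear_combination (‖k x‖ * ‖l x‖) * this
  have e2 : ∀ (k : ℝ → ℂ), ∀ x ∈ Ioo a b,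
      (√(Real.sin x) * ‖k x‖) ^ 2 = Real.sin x * ‖k x‖ ^ 2 := by
    intro k x hx
    rw [sq, e k k x hx, sq]
  have := abs_integral_mul_le (μ := volume.restrict (Ioo a b))
    (f := fun x => √(Real.sin x) * ‖f x‖) (g := fun x => √(Real.sin x) * ‖g x‖)
    ((integrableOn_congr_fun (e2 f) measurableSet_Ioo).2 (integrable_sin_mul_norm_sq hf))
    ((integrableOn_congr_fun (e2 g) measurableSet_Ioo).2 (integrable_sin_mul_norm_sq hg))
    ((integrableOn_congr_fun (e f g) measurableSet_Ioo).2 hfg)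
  rw [setIntegral_congr_fun measurableSet_Ioo (e2 f), setIntegral_congr_fun measurableSet_Ioo (e2 g),
    setIntegral_congr_fun measurableSet_Ioo (e f g)] at this
  exact (le_abs_self _).trans this

/-- Green's formula expresses the gradient energy as minus the pairing of Ly with y, and
Cauchy-Schwarz with weight sin applies. -/
theorem gradEnergy_sq_le (h : Clamped a b y₀ y₁ y₂) :
    gradEnergy a b μ y₀ y₁ ^ 2 ≤ lapEnergy a b μ y₀ y₁ y₂ * massEnergy a b y₀ := by
  obtain ⟨h1, h2⟩ := h.integral_sin_norm_mul_norm_le (h.memLp_unitLap (μ := μ))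
    (memLp_of_continuousOn h.continuousOn₀)
  have h3 : gradEnergy a b μ y₀ y₁ ≤ √(lapEnergy a b μ y₀ y₁ y₂ * massEnergy a b y₀) := by
    refine le_trans ?_ h2
    rw [← neg_neg (gradEnergy a b μ y₀ y₁), ← h.integral_unitLap_mul]
    refine (neg_le_abs _).trans ((abs_integral_le_integral_abs).trans ?_)
    refine integral_mono_of_nonneg (Eventually.of_forall fun x => abs_nonneg _) h1
      (ae_of_forall fun x hx => ?_)
    have hs := h.sin_pos hx
    simp only [abs_mul, abs_of_pos hs]
    gcongr
    exact abs_re_im_le _ _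
  have h4 := pow_le_pow_left₀ h.gradEnergy_nonneg h3 2
  rwa [Real.sq_sqrt (mul_nonneg h.lapEnergy_nonneg (h.massEnergy_nonneg _))] at h4

/-- Ground state substitution: expand ∫ sin |y' - μ cot y|² ≥ 0. The bracket vanishes for y = sin^μ,
whose eigenvalue for -L is μ(μ + 1). -/
theorem massEnergy_le_gradEnergy (h : Clamped a b y₀ y₁ y₂) :
    (μ ^ 2 + μ) * massEnergy a b y₀ ≤ gradEnergy a b μ y₀ y₁ := by
  -- The total derivative is that of -μ cos |y|²; it absorbs the cross term of the expanded square.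
  have hd := (((acDeriv_cos a b h.lt.le).mul h.lt.le h.acDeriv_norm_sq₀).mul h.lt.le
    (ACDeriv.const h.lt.le (-μ)))
  have hi : IntegrableOn (fun x => Real.sin x * ‖y₁ x‖ ^ 2 + μ ^ 2 * (‖y₀ x‖ ^ 2 / Real.sin x)
      - (μ ^ 2 + μ) * (Real.sin x * ‖y₀ x‖ ^ 2)) (Ioo a b) :=
    (h.integrable_massEnergy₁.add (h.integrable_angularEnergy.const_mul _)).sub
      (h.integrable_massEnergy₀.const_mul _)
  have e := integral_eq_of_deriv (A := fun x => Real.sin x *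
    (((y₁ x).re - μ * (Real.cos x / Real.sin x) * (y₀ x).re) ^ 2
      + ((y₁ x).im - μ * (Real.cos x / Real.sin x) * (y₀ x).im) ^ 2))
    (B := fun x => Real.sin x * ‖y₁ x‖ ^ 2 + μ ^ 2 * (‖y₀ x‖ ^ 2 / Real.sin x)
      - (μ ^ 2 + μ) * (Real.sin x * ‖y₀ x‖ ^ 2)) h.lt.le hd (by simp [h.left₀])
      (by simp [h.right₀]) hi (fun x hx => by
        have hs := (h.sin_pos hx).ne'
        have hc := Real.cos_sq' x
        simp only [norm_sq_eq_re_im]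
        field_simp
        ring_nf
        simp only [hc]
        ring)
  have h0 : 0 ≤ ∫ x in Ioo a b, Real.sin x *
    (((y₁ x).re - μ * (Real.cos x / Real.sin x) * (y₀ x).re) ^ 2
      + ((y₁ x).im - μ * (Real.cos x / Real.sin x) * (y₀ x).im) ^ 2) :=
    setIntegral_nonneg measurableSet_Ioo fun x hx => by
      have := h.sin_pos (Ioo_subset_Icc_self hx)
      positivity
  rw [e, integral_sub (h.integrable_massEnergy₁.fun_add (h.integrable_angularEnergy.const_mul _))
    (h.integrable_massEnergy₀.const_mul _), integral_add h.integrable_massEnergy₁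
    (h.integrable_angularEnergy.const_mul _), integral_const_mul, integral_const_mul] at h0
  simpa [gradEnergy, massEnergy, angularEnergy] using h0

/-- The spectral gap (μ² + μ)‖y‖² ≤ G combined with G² ≤ X‖y‖², after division by G. -/
theorem mul_gradEnergy_le_lapEnergy (h : Clamped a b y₀ y₁ y₂) (hμ : 0 ≤ μ) :
    (μ ^ 2 + μ) * gradEnergy a b μ y₀ y₁ ≤ lapEnergy a b μ y₀ y₁ y₂ := by
  have h1 := h.gradEnergy_sq_le (μ := μ)
  have h2 := h.massEnergy_le_gradEnergy (μ := μ)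
  have h3 := h.gradEnergy_nonneg (μ := μ)
  have h4 := h.lapEnergy_nonneg (μ := μ)
  rcases h3.eq_or_lt with h0 | h0
  · rw [← h0]; simpa using h4
  · refine le_of_mul_le_mul_right ?_ h0
    calc (μ ^ 2 + μ) * gradEnergy a b μ y₀ y₁ * gradEnergy a b μ y₀ y₁
        = (μ ^ 2 + μ) * gradEnergy a b μ y₀ y₁ ^ 2 := by ring
      _ ≤ (μ ^ 2 + μ) * (lapEnergy a b μ y₀ y₁ y₂ * massEnergy a b y₀) := by gcongr
      _ = lapEnergy a b μ y₀ y₁ y₂ * ((μ ^ 2 + μ) * massEnergy a b y₀) := by ring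
      _ ≤ lapEnergy a b μ y₀ y₁ y₂ * gradEnergy a b μ y₀ y₁ := by gcongr

/-- Since |y|² vanishes at both ends, 2|y|² is at most the integral of its absolute derivative,
hence at most 2∫ |y'||y|. Cauchy-Schwarz distributes the weights √sin and 1/√sin over the two
factors. -/
theorem norm_sq_le (h : Clamped a b y₀ y₁ y₂) {x : ℝ} (hx : x ∈ Icc a b) :
    ‖y₀ x‖ ^ 2 ≤ √(massEnergy a b y₁ * angularEnergy a b y₀) := by
  have h1 := h.acDeriv_norm_sq₀.two_mul_norm_le h.lt.le (by simp [h.left₀]) (by simp [h.right₀]) hx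
  have hi : IntegrableOn (fun x => ‖y₁ x‖ * ‖y₀ x‖) (Ioo a b) :=
    integrableOn_of_continuousOn (h.continuousOn₁.norm.mul h.continuousOn₀.norm)
  have e1 : ∀ x ∈ Ioo a b, (√(Real.sin x) * ‖y₁ x‖) ^ 2 = Real.sin x * ‖y₁ x‖ ^ 2 := by
    intro x hx
    rw [mul_pow, Real.sq_sqrt (h.sin_pos (Ioo_subset_Icc_self hx)).le]
  have e2 : ∀ x ∈ Ioo a b, (‖y₀ x‖ / √(Real.sin x)) ^ 2 = ‖y₀ x‖ ^ 2 / Real.sin x := by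
    intro x hx
    rw [div_pow, Real.sq_sqrt (h.sin_pos (Ioo_subset_Icc_self hx)).le]
  have e3 : ∀ x ∈ Ioo a b, (√(Real.sin x) * ‖y₁ x‖) * (‖y₀ x‖ / √(Real.sin x))
      = ‖y₁ x‖ * ‖y₀ x‖ := by
    intro x hx
    have := (Real.sqrt_pos.2 (h.sin_pos (Ioo_subset_Icc_self hx))).ne'
    field_simp
  have h2 := abs_integral_mul_le (μ := volume.restrict (Ioo a b))
    (f := fun x => √(Real.sin x) * ‖y₁ x‖) (g := fun x => ‖y₀ x‖ / √(Real.sin x))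
    ((integrableOn_congr_fun e1 measurableSet_Ioo).2 h.integrable_massEnergy₁)
    ((integrableOn_congr_fun e2 measurableSet_Ioo).2 h.integrable_angularEnergy)
    ((integrableOn_congr_fun e3 measurableSet_Ioo).2 hi)
  rw [setIntegral_congr_fun measurableSet_Ioo e1, setIntegral_congr_fun measurableSet_Ioo e2,
    setIntegral_congr_fun measurableSet_Ioo e3] at h2
  have h3 : ∫ t in Ioo a b, ‖2 * ((y₁ t).re * (y₀ t).re + (y₁ t).im * (y₀ t).im)‖
      ≤ ∫ t in Ioo a b, 2 * (‖y₁ t‖ * ‖y₀ t‖) :=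
    integral_mono_of_nonneg (Eventually.of_forall fun x => norm_nonneg _) (hi.const_mul 2)
      (Eventually.of_forall fun x => by
        simp only [norm_mul, Real.norm_eq_abs, abs_two]
        gcongr
        exact abs_re_im_le _ _)
  rw [integral_const_mul] at h3
  rw [Real.norm_of_nonneg (sq_nonneg _)] at h1
  have h4 := (le_abs_self _).trans h2
  simp only [massEnergy, angularEnergy]
  linarith

/-- The derivative of sin²|y'|² - μ²|y|² is exactly 2 sin² Re(Ly conj y'), because the first and
zeroth order terms of L cancel against the weights. Boundedness of sin removes one of the two sine
factors. -/
theorem norm_sin_mul_sq_le (h : Clamped a b y₀ y₁ y₂) {x : ℝ} (hx : x ∈ Icc a b) :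
    Real.sin x ^ 2 * ‖y₁ x‖ ^ 2 ≤ μ ^ 2 * ‖y₀ x‖ ^ 2
      + √(lapEnergy a b μ y₀ y₁ y₂ * massEnergy a b y₁) := by
  have hs := acDeriv_sin a b h.lt.le
  have hd := ((hs.mul h.lt.le hs).mul h.lt.le h.acDeriv_norm_sq₁).sub
    ((ACDeriv.const h.lt.le (μ ^ 2)).mul h.lt.le h.acDeriv_norm_sq₀)
  have h1 := hd.two_mul_norm_le h.lt.le (by simp [h.left₀, h.left₁])
    (by simp [h.right₀, h.right₁]) hx
  obtain ⟨h2, h3⟩ := h.integral_sin_norm_mul_norm_le (h.memLp_unitLap (μ := μ))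
    (memLp_of_continuousOn h.continuousOn₁)
  have h4 := integral_mono_of_nonneg (Eventually.of_forall fun x => norm_nonneg _)
    (h2.const_mul 2) (f := fun t => ‖(Real.cos t * Real.sin t + Real.sin t * Real.cos t) * ‖y₁ t‖ ^ 2
      + Real.sin t * Real.sin t * (2 * ((y₂ t).re * (y₁ t).re + (y₂ t).im * (y₁ t).im))
      - (0 * ‖y₀ t‖ ^ 2 + μ ^ 2 * (2 * ((y₁ t).re * (y₀ t).re + (y₁ t).im * (y₀ t).im)))‖)
      (ae_of_forall (a := a) (b := b) fun t ht => by
        have hs := h.sin_pos ht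
        have e : (Real.cos t * Real.sin t + Real.sin t * Real.cos t) * ‖y₁ t‖ ^ 2
          + Real.sin t * Real.sin t * (2 * ((y₂ t).re * (y₁ t).re + (y₂ t).im * (y₁ t).im))
          - (0 * ‖y₀ t‖ ^ 2 + μ ^ 2 * (2 * ((y₁ t).re * (y₀ t).re + (y₁ t).im * (y₀ t).im)))
          = 2 * (Real.sin t * Real.sin t * ((unitLap μ y₀ y₁ y₂ t).re * (y₁ t).re
            + (unitLap μ y₀ y₁ y₂ t).im * (y₁ t).im)) := by
          simp only [unitLap_re, unitLap_im, norm_sq_eq_re_im]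
          field_simp
          ring
        simp only [e, norm_mul, Real.norm_eq_abs, abs_two, abs_of_pos hs]
        have h5 := abs_re_im_le (unitLap μ y₀ y₁ y₂ t) (y₁ t)
        have h6 := Real.sin_le_one t
        calc 2 * (Real.sin t * Real.sin t * |(unitLap μ y₀ y₁ y₂ t).re * (y₁ t).re
            + (unitLap μ y₀ y₁ y₂ t).im * (y₁ t).im|)
            ≤ 2 * (Real.sin t * 1 * (‖unitLap μ y₀ y₁ y₂ t‖ * ‖y₁ t‖)) := by gcongr
          _ = _ := by ring)
  rw [integral_const_mul] at h4
  have h7 := Real.le_norm_self (Real.sin x * Real.sin x * ‖y₁ x‖ ^ 2 - μ ^ 2 * ‖y₀ x‖ ^ 2)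
  change _ ≤ √(lapEnergy a b μ y₀ y₁ y₂ * massEnergy a b y₁) at h3
  linarith [sq (Real.sin x)]

/-- Bochner's formula. -/
theorem lapEnergy_eq (h : Clamped a b y₀ y₁ y₂) :
    lapEnergy a b μ y₀ y₁ y₂ = massEnergy a b y₂ +
      (∫ x in Ioo a b, (2 * μ ^ 2 * (‖y₁ x - ((Real.cos x / Real.sin x : ℝ) : ℂ) * y₀ x‖ ^ 2
          / Real.sin x)
        + Real.sin x * ‖((Real.cos x / Real.sin x : ℝ) : ℂ) * y₁ x
          - ((μ ^ 2 / Real.sin x ^ 2 : ℝ) : ℂ) * y₀ x‖ ^ 2)) + gradEnergy a b μ y₀ y₁ := by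
  have hs0 : ∀ x ∈ Icc a b, Real.sin x ≠ 0 := fun x hx => (h.sin_pos hx).ne'
  -- The boundary function is cos |y'|² + α Re(y' conj y) + β|y|², with multipliers chosen so that
  -- the remaining density is the squared Hessian plus the squared gradient. The Hessian entries are
  -- y'', the mixed entry μ(y' - cot y)/sin counted twice, and cot y' - μ²y/sin². The gradient term
  -- comes from the Ricci curvature of the unit sphere.
  have hα : ACDeriv a b (fun x => -2 * μ ^ 2 / Real.sin x)
      (fun x => 2 * μ ^ 2 * Real.cos x / Real.sin x ^ 2) := by
    refine ACDeriv.of_hasDerivAt h.lt.le (fun x hx => ?_) ?_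
    · convert! (hasDerivAt_const x (-2 * μ ^ 2)).div (Real.hasDerivAt_sin x) (hs0 x hx) using 1
      ring
    · exact ContinuousOn.div (by fun_prop) (by fun_prop) fun x hx => pow_ne_zero _ (hs0 x hx)
  have hβ : ACDeriv a b (fun x => μ ^ 2 * Real.cos x / Real.sin x ^ 2)
      (fun x => - μ ^ 2 * (1 / Real.sin x + 2 * Real.cos x ^ 2 / Real.sin x ^ 3)) := by
    refine ACDeriv.of_hasDerivAt h.lt.le (fun x hx => ?_) ?_
    · have hs := hs0 x hx
      convert! ((Real.hasDerivAt_cos x).const_mul (μ ^ 2)).div ((Real.hasDerivAt_sin x).pow 2)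
        (pow_ne_zero 2 hs) using 1
      simp only [Pi.pow_apply]
      push_cast
      field_simp
      ring
    · exact continuousOn_const.mul ((ContinuousOn.div (by fun_prop) (by fun_prop) hs0).add
        (ContinuousOn.div (by fun_prop) (by fun_prop) fun x hx => pow_ne_zero _ (hs0 x hx)))
  have hd := (((acDeriv_cos a b h.lt.le).mul h.lt.le h.acDeriv_norm_sq₁).add
    (hα.mul h.lt.le h.acDeriv_re)).add (hβ.mul h.lt.le h.acDeriv_norm_sq₀)
  have i2 : IntegrableOn (fun x => Real.sin x * ‖y₂ x‖ ^ 2) (Ioo a b) :=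
    integrable_sin_mul_norm_sq h.memLp
  have hcont : ContinuousOn (fun x => 2 * μ ^ 2
      * (‖y₁ x - ((Real.cos x / Real.sin x : ℝ) : ℂ) * y₀ x‖ ^ 2 / Real.sin x)
        + Real.sin x * ‖((Real.cos x / Real.sin x : ℝ) : ℂ) * y₁ x
          - ((μ ^ 2 / Real.sin x ^ 2 : ℝ) : ℂ) * y₀ x‖ ^ 2) (Icc a b) := by
    refine (continuousOn_const.mul (ContinuousOn.div ?_ (by fun_prop) hs0)).add
      (ContinuousOn.mul (by fun_prop) ?_)
    · exact (h.continuousOn₁.sub (h.continuousOn_ofReal_cot.mul h.continuousOn₀)).norm.pow 2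
    · exact ((h.continuousOn_ofReal_cot.mul h.continuousOn₁).sub
        (h.continuousOn_ofReal_div_sin_sq.mul h.continuousOn₀)).norm.pow 2
  have i3 := integrableOn_of_continuousOn hcont
  have ig : IntegrableOn (fun x => Real.sin x * ‖y₁ x‖ ^ 2 + μ ^ 2 * (‖y₀ x‖ ^ 2 / Real.sin x))
    (Ioo a b) := h.integrable_massEnergy₁.add (h.integrable_angularEnergy.const_mul _)
  rw [lapEnergy, integral_eq_of_deriv (B := fun x => Real.sin x * ‖y₂ x‖ ^ 2
    + (2 * μ ^ 2 * (‖y₁ x - ((Real.cos x / Real.sin x : ℝ) : ℂ) * y₀ x‖ ^ 2 / Real.sin x)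
        + Real.sin x * ‖((Real.cos x / Real.sin x : ℝ) : ℂ) * y₁ x
          - ((μ ^ 2 / Real.sin x ^ 2 : ℝ) : ℂ) * y₀ x‖ ^ 2)
    + (Real.sin x * ‖y₁ x‖ ^ 2 + μ ^ 2 * (‖y₀ x‖ ^ 2 / Real.sin x))) h.lt.le hd]
  · rw [integral_add (i2.fun_add i3) ig, integral_add i2 i3, integral_add h.integrable_massEnergy₁
      (h.integrable_angularEnergy.const_mul _), integral_const_mul]
    rfl
  · simp [h.left₀, h.left₁]
  · simp [h.right₀, h.right₁]
  · exact (i2.add i3).add ig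
  · intro x hx
    have hs := hs0 x hx
    simp only [norm_sq_eq_re_im, unitLap_re, unitLap_im, Complex.sub_re, Complex.sub_im,
      Complex.re_ofReal_mul, Complex.im_ofReal_mul]
    field_simp
    ring

end Clamped

/-! ### Pointwise bounds and the advection, vorticity and shear integrals -/

/-- The density `|y' - cot y|² + (μ² - cos²) / sin² |y|²`. -/
noncomputable def twist (μ : ℝ) (y₀ y₁ : ℝ → ℂ) (x : ℝ) : ℝ :=
  ‖y₁ x - ((Real.cos x / Real.sin x : ℝ) : ℂ) * y₀ x‖ ^ 2
    + (μ ^ 2 - Real.cos x ^ 2) / Real.sin x ^ 2 * ‖y₀ x‖ ^ 2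

namespace Clamped

variable {a b μ p q : ℝ} {y₀ y₁ y₂ : ℝ → ℂ}

/-- This is `norm_sq_le` followed by 2μ√(DV) ≤ D + μ²V, where D = ∫ |y'|² sin, V = ∫ |y|²/sin and
the right side is the gradient energy. -/
theorem mul_norm_sq_le_gradEnergy (h : Clamped a b y₀ y₁ y₂) (hμ : 0 ≤ μ) {x : ℝ}
    (hx : x ∈ Icc a b) : μ * ‖y₀ x‖ ^ 2 ≤ gradEnergy a b μ y₀ y₁ / 2 := by
  have h1 := h.norm_sq_le hx
  have hD := h.massEnergy_nonneg y₁
  have hV := h.angularEnergy_nonneg y₀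
  have h2 : μ * √(massEnergy a b y₁ * angularEnergy a b y₀) ≤ gradEnergy a b μ y₀ y₁ / 2 := by
    have : μ * √(massEnergy a b y₁ * angularEnergy a b y₀)
        = √(massEnergy a b y₁) * (μ * √(angularEnergy a b y₀)) := by
      rw [Real.sqrt_mul hD]; ring
    rw [this, gradEnergy]
    nlinarith [sq_nonneg (√(massEnergy a b y₁) - μ * √(angularEnergy a b y₀)), Real.sq_sqrt hD,
      Real.sq_sqrt hV]
  exact (mul_le_mul_of_nonneg_left h1 hμ).trans h2

/-- The fourth roots `p` and `q` of the Laplacian and gradient energies make all later interpolation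
estimates polynomial. Here the previous bound is squared and μ²G ≤ X is inserted. -/
theorem sq_mul_norm_sq_le (h : Clamped a b y₀ y₁ y₂) (hμ : 0 ≤ μ)
    (hp : p ^ 4 = lapEnergy a b μ y₀ y₁ y₂) (hq : q ^ 4 = gradEnergy a b μ y₀ y₁)
    {x : ℝ} (hx : x ∈ Icc a b) : μ ^ 2 * ‖y₀ x‖ ^ 2 ≤ p ^ 2 * q ^ 2 / 2 := by
  have h1 := h.mul_norm_sq_le_gradEnergy hμ hx
  have h2 := h.mul_gradEnergy_le_lapEnergy hμ
  have h3 := h.gradEnergy_nonneg (μ := μ)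
  refine le_of_sq_le_sq ?_ (by positivity)
  calc (μ ^ 2 * ‖y₀ x‖ ^ 2) ^ 2 = μ ^ 2 * (μ * ‖y₀ x‖ ^ 2) ^ 2 := by ring
    _ ≤ μ ^ 2 * (gradEnergy a b μ y₀ y₁ / 2) ^ 2 := by gcongr
    _ = (μ ^ 2 * gradEnergy a b μ y₀ y₁) * gradEnergy a b μ y₀ y₁ / 4 := by ring
    _ ≤ lapEnergy a b μ y₀ y₁ y₂ * gradEnergy a b μ y₀ y₁ / 4 := by
        gcongr
        nlinarith
    _ = (p ^ 2 * q ^ 2 / 2) ^ 2 := by rw [← hp, ← hq]; ring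

/-- The decimal constant is 1/√2 rounded up. -/
theorem mul_norm_le (h : Clamped a b y₀ y₁ y₂) (hμ : 0 ≤ μ)
    (hp : p ^ 4 = lapEnergy a b μ y₀ y₁ y₂) (hq : q ^ 4 = gradEnergy a b μ y₀ y₁)
    (hp0 : 0 ≤ p) (hq0 : 0 ≤ q) {x : ℝ} (hx : x ∈ Icc a b) :
    μ * ‖y₀ x‖ ≤ 7072 / 10000 * (p * q) := by
  have h1 := h.sq_mul_norm_sq_le hμ hp hq hx
  refine le_of_sq_le_sq ?_ (by positivity)
  nlinarith [mul_nonneg (sq_nonneg p) (sq_nonneg q)]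

theorem sin_sq_mul_twist_le (h : Clamped a b y₀ y₁ y₂) (hμ : 1 ≤ μ)
    (hp : p ^ 4 = lapEnergy a b μ y₀ y₁ y₂) (hq : q ^ 4 = gradEnergy a b μ y₀ y₁)
    {x : ℝ} (hx : x ∈ Icc a b) : Real.sin x ^ 2 * twist μ y₀ y₁ x ≤ 4 * (p ^ 2 * q ^ 2) := by
  have h1 := h.sq_mul_norm_sq_le (by linarith) hp hq hx
  have h2 := h.norm_sin_mul_sq_le (μ := μ) hx
  have h3 : √(lapEnergy a b μ y₀ y₁ y₂ * massEnergy a b y₁) ≤ p ^ 2 * q ^ 2 := by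
    refine Real.sqrt_le_iff.2 ⟨by positivity, ?_⟩
    have h4 : massEnergy a b y₁ ≤ gradEnergy a b μ y₀ y₁ := by
      rw [gradEnergy]
      nlinarith [mul_nonneg (sq_nonneg μ) (h.angularEnergy_nonneg y₀)]
    calc lapEnergy a b μ y₀ y₁ y₂ * massEnergy a b y₁
        ≤ lapEnergy a b μ y₀ y₁ y₂ * gradEnergy a b μ y₀ y₁ :=
          mul_le_mul_of_nonneg_left h4 h.lapEnergy_nonneg
      _ = (p ^ 2 * q ^ 2) ^ 2 := by rw [← hp, ← hq]; ring
  have hs := (h.sin_pos hx).ne'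
  -- Parallelogram identity for sin y' - cos y and sin y' + cos y; discarding the square of the
  -- latter gives an upper bound for the twist without a mixed term.
  have e : Real.sin x ^ 2 * twist μ y₀ y₁ x + ((Real.sin x * (y₁ x).re + Real.cos x * (y₀ x).re) ^ 2
      + (Real.sin x * (y₁ x).im + Real.cos x * (y₀ x).im) ^ 2)
      = 2 * (Real.sin x ^ 2 * ‖y₁ x‖ ^ 2) + (μ ^ 2 + Real.cos x ^ 2) * ‖y₀ x‖ ^ 2 := by
    simp only [twist, norm_sq_eq_re_im, Complex.sub_re, Complex.sub_im, Complex.re_ofReal_mul,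
      Complex.im_ofReal_mul]
    field_simp
    ring
  have h5 : Real.cos x ^ 2 * ‖y₀ x‖ ^ 2 ≤ μ ^ 2 * ‖y₀ x‖ ^ 2 := by
    refine mul_le_mul_of_nonneg_right ?_ (sq_nonneg _)
    nlinarith [Real.cos_sq_le_one x]
  nlinarith [sq_nonneg (Real.sin x * (y₁ x).re + Real.cos x * (y₀ x).re),
    sq_nonneg (Real.sin x * (y₁ x).im + Real.cos x * (y₀ x).im)]

theorem twist_nonneg (hμ : 1 ≤ μ) (x : ℝ) : 0 ≤ twist μ y₀ y₁ x := by
  have : 0 ≤ μ ^ 2 - Real.cos x ^ 2 := by nlinarith [Real.cos_sq_le_one x]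
  rw [twist]
  positivity

theorem continuousOn_twist (h : Clamped a b y₀ y₁ y₂) :
    ContinuousOn (twist μ y₀ y₁) (Icc a b) := by
  refine ((h.continuousOn₁.sub (h.continuousOn_ofReal_cot.mul h.continuousOn₀)).norm.pow 2).add
    (ContinuousOn.mul (ContinuousOn.div (by fun_prop) (by fun_prop) fun x hx =>
      pow_ne_zero _ (h.sin_pos hx).ne') (h.continuousOn₀.norm.pow 2))

theorem continuousOn_bochner (h : Clamped a b y₀ y₁ y₂) :
    ContinuousOn (fun x => 2 * μ ^ 2
      * (‖y₁ x - ((Real.cos x / Real.sin x : ℝ) : ℂ) * y₀ x‖ ^ 2 / Real.sin x)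
        + Real.sin x * ‖((Real.cos x / Real.sin x : ℝ) : ℂ) * y₁ x
          - ((μ ^ 2 / Real.sin x ^ 2 : ℝ) : ℂ) * y₀ x‖ ^ 2) (Icc a b) := by
  refine (continuousOn_const.mul (ContinuousOn.div ?_ (by fun_prop)
    fun x hx => (h.sin_pos hx).ne')).add (ContinuousOn.mul (by fun_prop) ?_)
  · exact (h.continuousOn₁.sub (h.continuousOn_ofReal_cot.mul h.continuousOn₀)).norm.pow 2
  · exact ((h.continuousOn_ofReal_cot.mul h.continuousOn₁).sub
      (h.continuousOn_ofReal_div_sin_sq.mul h.continuousOn₀)).norm.pow 2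

/-- Both parts of the twist are controlled by the Hessian terms of Bochner's formula. The dichotomy
for μ is essential to the argument: the factor μ² - cos² may be small compared with μ² when μ is
near 1, but for μ = 1 it is exactly sin². -/
theorem integral_twist_le (h : Clamped a b y₀ y₁ y₂) (hμ : μ = 1 ∨ 2 ≤ μ) :
    μ ^ 2 * ∫ x in Ioo a b, twist μ y₀ y₁ x / Real.sin x
      ≤ 8 / 5 * lapEnergy a b μ y₀ y₁ y₂ := by
  have h1 := h.lapEnergy_eq (μ := μ)
  have h2 := h.massEnergy_nonneg y₂
  have h3 := h.gradEnergy_nonneg (μ := μ)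
  have hi := integrableOn_of_continuousOn (h.continuousOn_bochner (μ := μ))
  have hs0 : ∀ x ∈ Icc a b, Real.sin x ≠ 0 := fun x hx => (h.sin_pos hx).ne'
  have hti : IntegrableOn (fun x => twist μ y₀ y₁ x / Real.sin x) (Ioo a b) :=
    integrableOn_of_continuousOn (h.continuousOn_twist.div (by fun_prop) hs0)
  rcases hμ with rfl | hμ
  -- For μ = 1, twice the integral is at most X - G + 2G = X + G, and G ≤ X/2 gives 3X/2 for it; the
  -- constant 8/5 is needed only in the other case.
  · have h4 := h.mul_gradEnergy_le_lapEnergy zero_le_one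
    have h5 : 2 * ∫ x in Ioo a b, twist 1 y₀ y₁ x / Real.sin x
        ≤ (∫ x in Ioo a b, (2 * 1 ^ 2
      * (‖y₁ x - ((Real.cos x / Real.sin x : ℝ) : ℂ) * y₀ x‖ ^ 2 / Real.sin x)
        + Real.sin x * ‖((Real.cos x / Real.sin x : ℝ) : ℂ) * y₁ x
          - ((1 ^ 2 / Real.sin x ^ 2 : ℝ) : ℂ) * y₀ x‖ ^ 2)) + 2 * angularEnergy a b y₀ := by
      rw [angularEnergy, ← integral_const_mul, ← integral_const_mul,
        ← integral_add hi (h.integrable_angularEnergy.const_mul 2)]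
      refine setIntegral_mono_on (hti.const_mul 2)
        (hi.add (h.integrable_angularEnergy.const_mul 2)) measurableSet_Ioo fun x hx => ?_
      have hs := h.sin_pos (Ioo_subset_Icc_self hx)
      have e : twist 1 y₀ y₁ x / Real.sin x = ‖y₁ x
          - ((Real.cos x / Real.sin x : ℝ) : ℂ) * y₀ x‖ ^ 2 / Real.sin x
            + ‖y₀ x‖ ^ 2 / Real.sin x := by
        rw [twist, one_pow, ← Real.sin_sq]
        field_simp
      have h6 := mul_nonneg hs.le (sq_nonneg ‖((Real.cos x / Real.sin x : ℝ) : ℂ) * y₁ x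
          - ((1 ^ 2 / Real.sin x ^ 2 : ℝ) : ℂ) * y₀ x‖)
      rw [e]
      linarith
    have h7 : angularEnergy a b y₀ ≤ gradEnergy a b 1 y₀ y₁ := by
      rw [gradEnergy]
      linarith [h.massEnergy_nonneg y₁]
    linarith
  · rw [← integral_const_mul]
    have h5 : ∫ x in Ioo a b, μ ^ 2 * (twist μ y₀ y₁ x / Real.sin x)
        ≤ ∫ x in Ioo a b, 8 / 5 * (2 * μ ^ 2
      * (‖y₁ x - ((Real.cos x / Real.sin x : ℝ) : ℂ) * y₀ x‖ ^ 2 / Real.sin x)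
        + Real.sin x * ‖((Real.cos x / Real.sin x : ℝ) : ℂ) * y₁ x
          - ((μ ^ 2 / Real.sin x ^ 2 : ℝ) : ℂ) * y₀ x‖ ^ 2) := by
      refine setIntegral_mono_on (hti.const_mul _) (hi.const_mul _) measurableSet_Ioo fun x hx => ?_
      have hs := h.sin_pos (Ioo_subset_Icc_self hx)
      set v := y₁ x - ((Real.cos x / Real.sin x : ℝ) : ℂ) * y₀ x with hv
      set w := ((Real.cos x / Real.sin x : ℝ) : ℂ) * y₁ x
          - ((μ ^ 2 / Real.sin x ^ 2 : ℝ) : ℂ) * y₀ x with hw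
      have hμ2 : 4 ≤ μ ^ 2 := by nlinarith
      have hc1 := Real.cos_sq_le_one x
      have hn : 0 ≤ μ ^ 2 - Real.cos x ^ 2 := by linarith
      have hc := Real.sin_sq_add_cos_sq x
      have h8 : (μ ^ 2 - Real.cos x ^ 2) / Real.sin x ^ 2 * ‖y₀ x‖
          ≤ ‖w‖ + ‖v‖ / Real.sin x := by
        -- The undifferentiated function is recovered algebraically from two Hessian entries: the
        -- terms cot y' cancel in cot v - w.
        have e : (((μ ^ 2 - Real.cos x ^ 2) / Real.sin x ^ 2 : ℝ) : ℂ) * y₀ x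
            = ((Real.cos x / Real.sin x : ℝ) : ℂ) * v - w := by
          rw [hv, hw]
          push_cast
          ring
        have e2 := congrArg norm e
        rw [norm_mul, Complex.norm_real, Real.norm_of_nonneg (by positivity)] at e2
        rw [e2]
        refine (norm_sub_le _ _).trans ?_
        rw [norm_mul, Complex.norm_real, norm_div, Real.norm_eq_abs, Real.norm_of_nonneg hs.le,
          add_comm, div_mul_eq_mul_div]
        gcongr
        exact mul_le_of_le_one_left (norm_nonneg _) (Real.abs_cos_le_one x)
      have h9 : ((μ ^ 2 - Real.cos x ^ 2) / Real.sin x ^ 2 * ‖y₀ x‖) ^ 2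
          ≤ 6 / 5 * ‖w‖ ^ 2 + 6 * (‖v‖ ^ 2 / Real.sin x ^ 2) := by
        refine (pow_le_pow_left₀ (by positivity) h8 2).trans ?_
        have e : ‖v‖ ^ 2 / Real.sin x ^ 2 = (‖v‖ / Real.sin x) ^ 2 := by rw [div_pow]
        rw [e]
        -- Young's inequality with weights 6/5 and 6: after the factor 4/3 the first becomes 8/5,
        -- the coefficient allowed for w.
        nlinarith [sq_nonneg (‖w‖ - 5 * (‖v‖ / Real.sin x))]
      -- From μ² ≥ 4 and cos² ≤ 1 follows μ² ≤ (4/3)(μ² - cos²).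
      have h10 : μ ^ 2 * ((μ ^ 2 - Real.cos x ^ 2) / Real.sin x ^ 2 * ‖y₀ x‖ ^ 2 / Real.sin x)
          ≤ 4 / 3 * Real.sin x * ((μ ^ 2 - Real.cos x ^ 2) / Real.sin x ^ 2 * ‖y₀ x‖) ^ 2 := by
        have e1 : μ ^ 2 * ((μ ^ 2 - Real.cos x ^ 2) / Real.sin x ^ 2 * ‖y₀ x‖ ^ 2 / Real.sin x)
            = μ ^ 2 * ((μ ^ 2 - Real.cos x ^ 2) * ‖y₀ x‖ ^ 2 / Real.sin x ^ 3) := by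
          field_simp
        have e2 : 4 / 3 * Real.sin x * ((μ ^ 2 - Real.cos x ^ 2) / Real.sin x ^ 2 * ‖y₀ x‖) ^ 2
            = 4 / 3 * (μ ^ 2 - Real.cos x ^ 2)
              * ((μ ^ 2 - Real.cos x ^ 2) * ‖y₀ x‖ ^ 2 / Real.sin x ^ 3) := by
          field_simp
        rw [e1, e2]
        gcongr
        linarith
      have h11 : 4 / 3 * Real.sin x * ((μ ^ 2 - Real.cos x ^ 2) / Real.sin x ^ 2 * ‖y₀ x‖) ^ 2
          ≤ 8 / 5 * (Real.sin x * ‖w‖ ^ 2) + 8 * (‖v‖ ^ 2 / Real.sin x) := by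
        refine (mul_le_mul_of_nonneg_left h9 (by positivity)).trans (le_of_eq ?_)
        field_simp
        ring
      have h12 : 0 ≤ ‖v‖ ^ 2 / Real.sin x := by positivity
      have e : μ ^ 2 * (twist μ y₀ y₁ x / Real.sin x) = μ ^ 2 * (‖v‖ ^ 2 / Real.sin x)
          + μ ^ 2 * ((μ ^ 2 - Real.cos x ^ 2) / Real.sin x ^ 2 * ‖y₀ x‖ ^ 2 / Real.sin x) := by
        rw [twist, ← hv]
        ring
      rw [e]
      -- For v the coefficient μ² + 8 must be at most (16/5)μ², which holds because (11/5)μ² ≥ 44/5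
      -- > 8.
      nlinarith
    rw [integral_const_mul (8 / 5 : ℝ)] at h5
    linarith

/-- The integrand is (sin² twist)(twist / sin); the first factor is bounded pointwise and the second
in the integral. -/
theorem integral_sin_mul_twist_sq_le (h : Clamped a b y₀ y₁ y₂) (hμ : μ = 1 ∨ 2 ≤ μ)
    (hp : p ^ 4 = lapEnergy a b μ y₀ y₁ y₂) (hq : q ^ 4 = gradEnergy a b μ y₀ y₁) :
    μ ^ 2 * ∫ x in Ioo a b, Real.sin x * twist μ y₀ y₁ x ^ 2 ≤ 32 / 5 * (p ^ 6 * q ^ 2) := by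
  have hμ1 : 1 ≤ μ := by rcases hμ with h | h <;> linarith
  have hs0 : ∀ x ∈ Icc a b, Real.sin x ≠ 0 := fun x hx => (h.sin_pos hx).ne'
  have hti : IntegrableOn (fun x => twist μ y₀ y₁ x / Real.sin x) (Ioo a b) :=
    integrableOn_of_continuousOn (h.continuousOn_twist.div (by fun_prop) hs0)
  have h1 : ∫ x in Ioo a b, Real.sin x * twist μ y₀ y₁ x ^ 2
      ≤ ∫ x in Ioo a b, (4 * (p ^ 2 * q ^ 2)) * (twist μ y₀ y₁ x / Real.sin x) := by
    refine setIntegral_mono_on (integrableOn_of_continuousOn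
      (ContinuousOn.mul (by fun_prop) (h.continuousOn_twist.pow 2))) (hti.const_mul _)
      measurableSet_Ioo fun x hx => ?_
    have hx' := Ioo_subset_Icc_self hx
    have hs := h.sin_pos hx'
    have h2 := h.sin_sq_mul_twist_le hμ1 hp hq hx'
    have h3 : 0 ≤ twist μ y₀ y₁ x / Real.sin x := div_nonneg (twist_nonneg hμ1 x) hs.le
    calc Real.sin x * twist μ y₀ y₁ x ^ 2
        = (Real.sin x ^ 2 * twist μ y₀ y₁ x) * (twist μ y₀ y₁ x / Real.sin x) := by field_simp
      _ ≤ _ := by gcongr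
  rw [integral_const_mul] at h1
  have h4 := h.integral_twist_le hμ
  calc μ ^ 2 * ∫ x in Ioo a b, Real.sin x * twist μ y₀ y₁ x ^ 2
      ≤ μ ^ 2 * (4 * (p ^ 2 * q ^ 2) * ∫ x in Ioo a b, twist μ y₀ y₁ x / Real.sin x) := by gcongr
    _ = 4 * (p ^ 2 * q ^ 2) * (μ ^ 2 * ∫ x in Ioo a b, twist μ y₀ y₁ x / Real.sin x) := by ring
    _ ≤ 4 * (p ^ 2 * q ^ 2) * (8 / 5 * p ^ 4) := by rw [hp]; gcongr
    _ = _ := by ring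

theorem continuousOn_ofReal {β : ℝ → ℝ} (hβ : ContinuousOn β (Icc a b)) :
    ContinuousOn (fun x => (β x : ℂ)) (Icc a b) :=
  Complex.continuous_ofReal.comp_continuousOn hβ

/-- The advection term. -/
theorem norm_integral_advection_le (h : Clamped a b y₀ y₁ y₂) (hμ : 0 ≤ μ)
    (hp : p ^ 4 = lapEnergy a b μ y₀ y₁ y₂) (hq : q ^ 4 = gradEnergy a b μ y₀ y₁)
    (hp0 : 0 ≤ p) (hq0 : 0 ≤ q) {β : ℝ → ℝ} (hβ : ContinuousOn β (Icc a b)) :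
    μ * ∫ x in Ioo a b, Real.sin x * (‖(β x : ℂ)‖ * (‖unitLap μ y₀ y₁ y₂ x‖ * ‖y₀ x‖))
      ≤ 7072 / 10000 * √(∫ x in Ioo a b, Real.sin x * β x ^ 2) * (p ^ 3 * q) := by
  obtain ⟨h1, h2⟩ := h.integral_sin_norm_mul_norm_le (memLp_of_continuousOn (continuousOn_ofReal hβ))
    (h.memLp_unitLap (μ := μ))
  have e : massEnergy a b (fun x => (β x : ℂ)) = ∫ x in Ioo a b, Real.sin x * β x ^ 2 := by
    simp [massEnergy]
  have hX : √(massEnergy a b (unitLap μ y₀ y₁ y₂)) = p ^ 2 := by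
    change √(lapEnergy a b μ y₀ y₁ y₂) = _
    rw [← hp, show p ^ 4 = (p ^ 2) ^ 2 by ring, Real.sqrt_sq (by positivity)]
  rw [Real.sqrt_mul (h.massEnergy_nonneg _), e, hX] at h2
  -- Hölder with exponents 2, 2, ∞: the supremum of μ|y| contributes pq/√2, and the weighted L² norm
  -- of Ly is p².
  have h3 : ∫ x in Ioo a b, μ * (Real.sin x * (‖(β x : ℂ)‖ * (‖unitLap μ y₀ y₁ y₂ x‖ * ‖y₀ x‖)))
      ≤ ∫ x in Ioo a b, 7072 / 10000 * (p * q)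
        * (Real.sin x * (‖(β x : ℂ)‖ * ‖unitLap μ y₀ y₁ y₂ x‖)) := by
    refine integral_mono_of_nonneg (ae_of_forall fun x hx => ?_) (h1.const_mul _)
      (ae_of_forall fun x hx => ?_)
    · have := h.sin_pos hx
      simp only [Pi.zero_apply]
      positivity
    · have hs := h.sin_pos hx
      calc μ * (Real.sin x * (‖(β x : ℂ)‖ * (‖unitLap μ y₀ y₁ y₂ x‖ * ‖y₀ x‖)))
          = (μ * ‖y₀ x‖) * (Real.sin x * (‖(β x : ℂ)‖ * ‖unitLap μ y₀ y₁ y₂ x‖)) := by ring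
        _ ≤ _ := mul_le_mul_of_nonneg_right (h.mul_norm_le hμ hp hq hp0 hq0 hx) (by positivity)
  rw [integral_const_mul, integral_const_mul] at h3
  refine h3.trans ((mul_le_mul_of_nonneg_left h2 (by positivity)).trans (le_of_eq ?_))
  ring

/-- The vorticity gradient term, integrated by parts. -/
theorem integral_vorticity_eq (h : Clamped a b y₀ y₁ y₂) {Ω Ω₁ : ℝ → ℝ}
    (hΩ : ACDeriv a b Ω Ω₁) :
    ∫ x in Ioo a b, (Ω₁ x * Real.sin x + 2 * Ω x * Real.cos x)
        * (2 * ((y₁ x).re * (y₀ x).re + (y₁ x).im * (y₀ x).im))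
      = ∫ x in Ioo a b, -(2 * (Real.sin x * Ω x * ((unitLap μ y₀ y₁ y₂ x).re * (y₀ x).re
        + (unitLap μ y₀ y₁ y₂ x).im * (y₀ x).im)
          + Real.sin x * (Ω x * twist μ y₀ y₁ x))) := by
  have hc := hΩ.continuousOn h.lt.le
  -- The boundary function is 2Ω sin Re(y' conj y). Integration by parts removes Ω', and after Ly is
  -- split off the remaining quadratic form in y and y' is the twist.
  have hd := hΩ.mul h.lt.le ((acDeriv_sin a b h.lt.le).mul h.lt.le
    (h.acDeriv_re.mul h.lt.le (ACDeriv.const h.lt.le (2 : ℝ))))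
  refine integral_eq_of_deriv h.lt.le hd (by simp [h.left₀]) (by simp [h.right₀]) ?_ ?_
  · refine ((IntegrableOn.add (f := fun x => Real.sin x * Ω x *
      ((unitLap μ y₀ y₁ y₂ x).re * (y₀ x).re + (unitLap μ y₀ y₁ y₂ x).im * (y₀ x).im))
      (g := fun x => Real.sin x * (Ω x * twist μ y₀ y₁ x)) ?_ ?_).const_mul 2).neg
    · refine integrable_continuousOn_mul (ContinuousOn.mul (by fun_prop) hc) ?_
      have hL := h.memLp_unitLap (μ := μ)
      have hy : MemLp y₀ 2 (volume.restrict (Ioo a b)) := memLp_of_continuousOn h.continuousOn₀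
      exact (hL.re.integrable_mul hy.re).add (hL.im.integrable_mul hy.im)
    · exact integrableOn_of_continuousOn
        (ContinuousOn.mul (by fun_prop) (hc.mul h.continuousOn_twist))
  · intro x hx
    have hs := (h.sin_pos hx).ne'
    simp only [twist, unitLap_re, unitLap_im, norm_sq_eq_re_im, Complex.sub_re, Complex.sub_im,
      Complex.re_ofReal_mul, Complex.im_ofReal_mul]
    field_simp
    ring

theorem abs_integral_vorticity_le (h : Clamped a b y₀ y₁ y₂) (hμ : μ = 1 ∨ 2 ≤ μ)
    (hp : p ^ 4 = lapEnergy a b μ y₀ y₁ y₂) (hq : q ^ 4 = gradEnergy a b μ y₀ y₁)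
    (hp0 : 0 ≤ p) (hq0 : 0 ≤ q) {Ω Ω₁ : ℝ → ℝ} (hΩ : ACDeriv a b Ω Ω₁) :
    μ * |∫ x in Ioo a b, (Ω₁ x * Real.sin x + 2 * Ω x * Real.cos x)
        * (2 * ((y₁ x).re * (y₀ x).re + (y₁ x).im * (y₀ x).im))|
      ≤ 648 / 100 * √(∫ x in Ioo a b, Real.sin x * Ω x ^ 2) * (p ^ 3 * q) := by
  have hμ1 : 1 ≤ μ := by rcases hμ with h | h <;> linarith
  have hc := hΩ.continuousOn h.lt.le
  have h1 := h.norm_integral_advection_le (by linarith) hp hq hp0 hq0 hc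
  have hW : ContinuousOn (fun x => ((twist μ y₀ y₁ x : ℝ) : ℂ)) (Icc a b) :=
    continuousOn_ofReal h.continuousOn_twist
  obtain ⟨h2, h3⟩ := h.integral_sin_norm_mul_norm_le (memLp_of_continuousOn (continuousOn_ofReal hc))
    (memLp_of_continuousOn hW)
  have e1 : massEnergy a b (fun x => (Ω x : ℂ)) = ∫ x in Ioo a b, Real.sin x * Ω x ^ 2 := by
    simp [massEnergy]
  have e2 : massEnergy a b (fun x => ((twist μ y₀ y₁ x : ℝ) : ℂ))
      = ∫ x in Ioo a b, Real.sin x * twist μ y₀ y₁ x ^ 2 := by simp [massEnergy]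
  rw [Real.sqrt_mul (h.massEnergy_nonneg _), e1, e2] at h3
  -- The constant 2.53 is √(32/5) rounded up.
  have h4 : μ * √(∫ x in Ioo a b, Real.sin x * twist μ y₀ y₁ x ^ 2)
      ≤ 253 / 100 * (p ^ 3 * q) := by
    have h5 := h.integral_sin_mul_twist_sq_le hμ hp hq
    refine le_of_sq_le_sq ?_ (by positivity)
    have h6 : 0 ≤ ∫ x in Ioo a b, Real.sin x * twist μ y₀ y₁ x ^ 2 := by
      rw [← e2]; exact h.massEnergy_nonneg _
    rw [mul_pow, Real.sq_sqrt h6]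
    refine h5.trans ?_
    have : 0 ≤ p ^ 6 * q ^ 2 := by positivity
    nlinarith
  have hiA : IntegrableOn (fun x => Real.sin x * (‖(Ω x : ℂ)‖
      * (‖unitLap μ y₀ y₁ y₂ x‖ * ‖y₀ x‖))) (Ioo a b) := by
    have hL := h.memLp_unitLap (μ := μ)
    have hy : MemLp y₀ 2 (volume.restrict (Ioo a b)) := memLp_of_continuousOn h.continuousOn₀
    exact integrable_continuousOn_mul (by fun_prop) (integrable_continuousOn_mul
      (continuousOn_ofReal hc).norm (hL.norm.integrable_mul hy.norm))
  have h7 : |∫ x in Ioo a b, (Ω₁ x * Real.sin x + 2 * Ω x * Real.cos x)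
        * (2 * ((y₁ x).re * (y₀ x).re + (y₁ x).im * (y₀ x).im))|
      ≤ 2 * ((∫ x in Ioo a b, Real.sin x * (‖(Ω x : ℂ)‖ * (‖unitLap μ y₀ y₁ y₂ x‖ * ‖y₀ x‖)))
        + ∫ x in Ioo a b, Real.sin x * (‖(Ω x : ℂ)‖ * ‖((twist μ y₀ y₁ x : ℝ) : ℂ)‖)) := by
    rw [h.integral_vorticity_eq (μ := μ) hΩ, ← integral_add hiA h2, ← integral_const_mul]
    refine abs_integral_le_integral_abs.trans ?_
    refine integral_mono_of_nonneg (Eventually.of_forall fun x => abs_nonneg _)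
      ((hiA.add h2).const_mul 2) (ae_of_forall fun x hx => ?_)
    have hs := h.sin_pos hx
    simp only [abs_neg, abs_mul, abs_two, Complex.norm_real, Real.norm_eq_abs]
    gcongr
    refine (abs_add_le _ _).trans ?_
    simp only [abs_mul, abs_of_pos hs, mul_assoc]
    gcongr
    exact abs_re_im_le _ _
  have hw0 : 0 ≤ √(∫ x in Ioo a b, Real.sin x * Ω x ^ 2) := Real.sqrt_nonneg _
  calc μ * |∫ x in Ioo a b, (Ω₁ x * Real.sin x + 2 * Ω x * Real.cos x)
        * (2 * ((y₁ x).re * (y₀ x).re + (y₁ x).im * (y₀ x).im))|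
      ≤ μ * (2 * ((∫ x in Ioo a b, Real.sin x * (‖(Ω x : ℂ)‖
          * (‖unitLap μ y₀ y₁ y₂ x‖ * ‖y₀ x‖)))
        + √(∫ x in Ioo a b, Real.sin x * Ω x ^ 2)
          * √(∫ x in Ioo a b, Real.sin x * twist μ y₀ y₁ x ^ 2))) := by gcongr; exact h7.trans (by gcongr)
    _ = 2 * (μ * ∫ x in Ioo a b, Real.sin x * (‖(Ω x : ℂ)‖ * (‖unitLap μ y₀ y₁ y₂ x‖ * ‖y₀ x‖)))
        + 2 * √(∫ x in Ioo a b, Real.sin x * Ω x ^ 2)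
          * (μ * √(∫ x in Ioo a b, Real.sin x * twist μ y₀ y₁ x ^ 2)) := by ring
    _ ≤ 2 * (7072 / 10000 * √(∫ x in Ioo a b, Real.sin x * Ω x ^ 2) * (p ^ 3 * q))
        + 2 * √(∫ x in Ioo a b, Real.sin x * Ω x ^ 2) * (253 / 100 * (p ^ 3 * q)) := by gcongr
    -- Here 2 · 0.7072 + 2 · 2.53 = 6.4744, rounded up to 6.48.
    _ ≤ _ := by
      have : 0 ≤ √(∫ x in Ioo a b, Real.sin x * Ω x ^ 2) * (p ^ 3 * q) := by positivity
      nlinarith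

/-- The real part of the advection term only involves the shear. -/
theorem integral_shear_eq (h : Clamped a b y₀ y₁ y₂) {Ω Ω₁ : ℝ → ℝ} (hΩ : ACDeriv a b Ω Ω₁)
    (Ωref : ℝ) :
    ∫ x in Ioo a b, Real.sin x * ((Ω x - Ωref) * ((unitLap μ y₀ y₁ y₂ x).im * (y₀ x).re
        - (unitLap μ y₀ y₁ y₂ x).re * (y₀ x).im))
      = ∫ x in Ioo a b, -(Ω₁ x * (Real.sin x * ((y₁ x).im * (y₀ x).re
        - (y₁ x).re * (y₀ x).im))) := by
  -- The potential in L is real, so sin Im(Ly conj y) is the derivative of sin Im(y' conj y). After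
  -- integration by parts the constant Ωref drops out.
  have hdim := (h.im₁.mul h.lt.le h.re₀).sub (h.re₁.mul h.lt.le h.im₀)
  have hd := (hΩ.sub (ACDeriv.const h.lt.le Ωref)).mul h.lt.le
    ((acDeriv_sin a b h.lt.le).mul h.lt.le hdim)
  refine integral_eq_of_deriv h.lt.le hd (by simp [h.left₀]) (by simp [h.right₀]) ?_ ?_
  · have hcont : ContinuousOn (fun x => Real.sin x * ((y₁ x).im * (y₀ x).re
        - (y₁ x).re * (y₀ x).im)) (Icc a b) :=
      ContinuousOn.mul (by fun_prop) (((h.im₁.continuousOn h.lt.le).mul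
        (h.re₀.continuousOn h.lt.le)).sub ((h.re₁.continuousOn h.lt.le).mul
        (h.im₀.continuousOn h.lt.le)))
    have := (integrable_continuousOn_mul hcont hΩ.integrableOn).neg
    refine this.congr (Eventually.of_forall fun x => ?_)
    simp only [Pi.neg_apply]
    ring
  · intro x hx
    have hs := (h.sin_pos hx).ne'
    simp only [unitLap_re, unitLap_im]
    field_simp
    ring

/-- The weighted arithmetic-geometric mean inequality, with equality at D = 3V; the explicit
factorization shows the sign. -/
theorem pow_four_amgm {D V : ℝ} (hD : 0 ≤ D) (hV : 0 ≤ V) :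
    256 * (D ^ 3 * V) ≤ 27 * (D + V) ^ 4 := by
  have : 27 * (D + V) ^ 4 - 256 * (D ^ 3 * V)
      = (D - 3 * V) ^ 2 * (27 * D ^ 2 + 14 * (D * V) + 3 * V ^ 2) := by ring
  have h2 : 0 ≤ (D - 3 * V) ^ 2 * (27 * D ^ 2 + 14 * (D * V) + 3 * V ^ 2) := by positivity
  linarith

/-- Cauchy-Schwarz leaves the weighted L² norm of y'y, and the supremum of |y|² is bounded by
`norm_sq_le`. Its fourth power is therefore at most D³V (D and V the energies ∫ |y'|² sin and ∫
|y|²/sin), which is compared with (D + V)⁴ and with X through 2G ≤ X. -/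
theorem abs_integral_shear_le (h : Clamped a b y₀ y₁ y₂) (hμ : 1 ≤ μ) {Ω Ω₁ : ℝ → ℝ}
    (hΩ : ACDeriv a b Ω Ω₁) (Ωref : ℝ) (hL2 : MemLp Ω₁ 2 (volume.restrict (Ioo a b))) :
    |∫ x in Ioo a b, Real.sin x * ((Ω x - Ωref) * ((unitLap μ y₀ y₁ y₂ x).im * (y₀ x).re
        - (unitLap μ y₀ y₁ y₂ x).re * (y₀ x).im))|
      ≤ 287 / 1000 * √(∫ x in Ioo a b, Real.sin x * Ω₁ x ^ 2) * lapEnergy a b μ y₀ y₁ y₂ := by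
  have hD := h.massEnergy_nonneg y₁
  have hV := h.angularEnergy_nonneg y₀
  have hX := h.lapEnergy_nonneg (μ := μ)
  have hG := h.gradEnergy_nonneg (μ := μ)
  have hy : MemLp (fun x => y₁ x * y₀ x) 2 (volume.restrict (Ioo a b)) :=
    memLp_of_continuousOn (h.continuousOn₁.mul h.continuousOn₀)
  obtain ⟨h1, h2⟩ := h.integral_sin_norm_mul_norm_le (hL2.ofReal (K := ℂ)) hy
  have e1 : massEnergy a b (fun x => ((Ω₁ x : ℝ) : ℂ)) = ∫ x in Ioo a b, Real.sin x * Ω₁ x ^ 2 := by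
    simp [massEnergy]
  have h3 : massEnergy a b (fun x => y₁ x * y₀ x)
      ≤ massEnergy a b y₁ * √(massEnergy a b y₁ * angularEnergy a b y₀) := by
    rw [mul_comm]
    simp only [massEnergy]
    rw [← integral_const_mul]
    refine setIntegral_mono_on (integrable_sin_mul_norm_sq hy)
      (h.integrable_massEnergy₁.const_mul _) measurableSet_Ioo fun x hx => ?_
    have hx' := Ioo_subset_Icc_self hx
    have hs := h.sin_pos hx'
    have := h.norm_sq_le hx'
    rw [norm_mul, mul_pow]
    calc Real.sin x * (‖y₁ x‖ ^ 2 * ‖y₀ x‖ ^ 2) = ‖y₀ x‖ ^ 2 * (Real.sin x * ‖y₁ x‖ ^ 2) := by ring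
      _ ≤ _ := by gcongr; exact this
  have h4 : massEnergy a b (fun x => y₁ x * y₀ x)
      -- The exact constant is the fourth root of (27/256)/16, about 0.2849.
      ≤ (287 / 1000 * lapEnergy a b μ y₀ y₁ y₂) ^ 2 := by
    refine h3.trans (le_of_sq_le_sq ?_ (by positivity))
    rw [mul_pow, Real.sq_sqrt (by positivity)]
    have h5 := pow_four_amgm hD hV
    have h6 : massEnergy a b y₁ + angularEnergy a b y₀ ≤ gradEnergy a b μ y₀ y₁ := by
      rw [gradEnergy]
      have : 1 ≤ μ ^ 2 := one_le_pow₀ hμ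
      nlinarith
    have h7 : 2 * gradEnergy a b μ y₀ y₁ ≤ lapEnergy a b μ y₀ y₁ y₂ :=
      le_trans (mul_le_mul_of_nonneg_right (by nlinarith) hG) (h.mul_gradEnergy_le_lapEnergy (by linarith))
    have h8 : (massEnergy a b y₁ + angularEnergy a b y₀) ^ 4
        ≤ (lapEnergy a b μ y₀ y₁ y₂ / 2) ^ 4 := by
      gcongr
      linarith
    have h9 : 0 ≤ lapEnergy a b μ y₀ y₁ y₂ ^ 4 := by positivity
    nlinarith
  have h5 : √(massEnergy a b (fun x => ((Ω₁ x : ℝ) : ℂ)) * massEnergy a b (fun x => y₁ x * y₀ x))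
      ≤ 287 / 1000 * √(∫ x in Ioo a b, Real.sin x * Ω₁ x ^ 2) * lapEnergy a b μ y₀ y₁ y₂ := by
    rw [Real.sqrt_mul (h.massEnergy_nonneg _), e1]
    have := Real.sqrt_le_iff.2 ⟨by positivity, h4⟩
    calc _ ≤ √(∫ x in Ioo a b, Real.sin x * Ω₁ x ^ 2) * (287 / 1000 * lapEnergy a b μ y₀ y₁ y₂) := by
          gcongr
      _ = _ := by ring
  refine le_trans ?_ (h2.trans h5)
  rw [h.integral_shear_eq (μ := μ) hΩ Ωref]
  refine abs_integral_le_integral_abs.trans ?_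
  refine integral_mono_of_nonneg (Eventually.of_forall fun x => abs_nonneg _) h1
    (ae_of_forall fun x hx => ?_)
  have hs := h.sin_pos hx
  simp only [abs_neg, abs_mul, abs_of_pos hs, norm_mul, RCLike.norm_ofReal]
  have := abs_im_re_le (y₁ x) (y₀ x)
  calc |Ω₁ x| * (Real.sin x * |(y₁ x).im * (y₀ x).re - (y₁ x).re * (y₀ x).im|)
      ≤ |Ω₁ x| * (Real.sin x * (‖y₁ x‖ * ‖y₀ x‖)) := by gcongr
    _ = _ := by ring

end Clamped

/-! ### Absorption by Young's inequality and the numerical comparison -/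

/-- Absorption of the lower order terms for large frequencies. -/
theorem exists_pos_mul_pow_four_le {g w κ₀ κ : ℝ} (hg : 0 < g) (hw : 0 ≤ w) (h0 : 0 ≤ κ₀)
    (hκ : κ₀ ≤ κ) (h : κ₀ ^ 3 * κ < w * g ^ 3) :
    ∃ c, 0 < c ∧ ∀ p q N : ℝ, 0 ≤ p → 0 ≤ q → g * p ^ 4 - κ₀ * (p ^ 3 * q) ≤ N →
      w * q ^ 4 - κ * (p ^ 3 * q) ≤ N → c * p ^ 4 ≤ N := by
  -- If `κ₀` vanishes the first lower bound suffices; this case is separate because `w` and `κ` may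
  -- vanish as well.
  rcases h0.eq_or_lt with rfl | h0
  · exact ⟨g, hg, fun p q N _ _ h1 _ => by simpa using h1⟩
  have hκ0 : 0 < κ := h0.trans_le hκ
  have hw0 : 0 < w := by
    rcases hw.eq_or_lt with rfl | hw
    · have : 0 < κ₀ ^ 3 * κ := by positivity
      linarith
    · exact hw
  -- Young's inequality will be used as 4p³q ≤ 3p⁴/t + t³q⁴. With this `t` its q⁴ term is cancelled
  -- by the second lower bound, and the hypothesis becomes `κ₀ < t * g`.
  obtain ⟨t, ht, ht3⟩ : ∃ t : ℝ, 0 < t ∧ t ^ 3 = w / κ :=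
    ⟨(w / κ) ^ (1 / 3 : ℝ), by positivity, by
      rw [← Real.rpow_natCast, ← Real.rpow_mul (by positivity)]; norm_num⟩
  have hwt : w = t ^ 3 * κ := by rw [ht3]; field_simp
  have hlt : κ₀ < t * g := by
    refine lt_of_pow_lt_pow_left₀ 3 (by positivity) ?_
    rw [hwt] at h
    refine lt_of_mul_lt_mul_right (a := κ) ?_ hκ0.le
    calc κ₀ ^ 3 * κ < t ^ 3 * κ * g ^ 3 := h
      _ = _ := by ring
  -- The weight of the second lower bound: the total coefficient of p³q becomes 4κ₀/3 and that of q⁴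
  -- becomes κ₀t³/3, in the ratio required by Young's inequality.
  set l := κ₀ / (3 * κ) with hl
  have hl0 : 0 < l := by positivity
  have hlκ : l * κ = κ₀ / 3 := by rw [hl]; field_simp
  refine ⟨(g - κ₀ / t) / (1 + l), ?_, ?_⟩
  · have : κ₀ / t < g := by rw [div_lt_iff₀ ht]; linarith
    have : 0 < g - κ₀ / t := by linarith
    positivity
  intro p q N hp hq h1 h2
  rw [div_mul_eq_mul_div, div_le_iff₀ (by positivity)]
  have h3 : 4 * (p ^ 3 * q) ≤ 3 * p ^ 4 / t + t ^ 3 * q ^ 4 := by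
    have : 0 ≤ (p - t * q) ^ 2 * (3 * p ^ 2 + 2 * (p * (t * q)) + (t * q) ^ 2) := by positivity
    have e : 3 * p ^ 4 / t + t ^ 3 * q ^ 4 = (3 * p ^ 4 + t ^ 4 * q ^ 4) / t := by field_simp
    rw [e, le_div_iff₀ ht]
    nlinarith
  have h4 : l * (w * q ^ 4 - κ * (p ^ 3 * q)) ≤ l * N := by gcongr
  have e4 : l * (w * q ^ 4 - κ * (p ^ 3 * q)) = κ₀ / 3 * (t ^ 3 * q ^ 4 - p ^ 3 * q) := by
    rw [hwt, ← hlκ]; ring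
  have h5 : κ₀ / 3 * (4 * (p ^ 3 * q)) ≤ κ₀ / 3 * (3 * p ^ 4 / t + t ^ 3 * q ^ 4) := by gcongr
  have e5 : κ₀ / 3 * (3 * p ^ 4 / t + t ^ 3 * q ^ 4)
      = κ₀ / t * p ^ 4 + κ₀ / 3 * (t ^ 3 * q ^ 4) := by ring
  rw [e4] at h4
  rw [e5] at h5
  linarith

theorem largeFrequency_numerics {β w : ℝ} (hβ : 0 ≤ β) (hw : 0 ≤ w) :
    (7072 / 10000 * β) ^ 3 * (7072 / 10000 * β + 648 / 100 * w)
      ≤ 87 / 200 * (β ^ 2 + 9 * w ^ 2) ^ 2 := by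
  -- Scaled by about 10⁻⁴ this square reproduces the difference of the β⁴ coefficients, about
  -- 0.1849, and slightly overcompensates the coefficient 2.292 of β³w. It uses about 7.13 of the
  -- available 7.83 in β²w².
  have h1 : 0 ≤ β ^ 2 * (43 * β - 267 * w) ^ 2 := by positivity
  have h2 : 0 ≤ β ^ 2 * w ^ 2 := by positivity
  have h3 : 0 ≤ w ^ 4 := by positivity
  have h4 : 0 ≤ β ^ 4 := by positivity
  have h5 : 0 ≤ β ^ 3 * w := by positivity
  nlinarith

/-! ### The Sobolev spaces on `I'` -/

section Sobolev

variable {ε : ℝ}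

theorem latMeasure_memLp_of_continuousOn {f : ℝ → ℂ} {p : ℝ≥0∞}
    (hf : ContinuousOn f (Icc ε (Real.pi - ε))) : MemLp f p (latMeasure ε) :=
  Clamped.memLp_of_continuousOn hf

/-- Weighted integrals are inner products with L² functions. Both the weak derivative relations and
the boundary conditions are expressed by them, so they define closed subspaces. -/
theorem exists_clm_integral_smul {χ : ℝ → ℝ} (hχ : ContinuousOn χ (Icc ε (Real.pi - ε))) :
    ∃ l : LatL2 ε →L[ℂ] ℂ, ∀ u, l u = ∫ x, χ x • u x ∂(latMeasure ε) := by
  have hm : MemLp (fun x => (χ x : ℂ)) 2 (latMeasure ε) :=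
    latMeasure_memLp_of_continuousOn (Complex.continuous_ofReal.comp_continuousOn hχ)
  refine ⟨innerSL ℂ (hm.toLp _), fun u => ?_⟩
  rw [innerSL_apply_apply, L2.inner_def]
  refine integral_congr_ae ?_
  filter_upwards [hm.coeFn_toLp] with x hx
  rw [hx]
  simp [mul_comm]

theorem integrableOn_latL2 (u : LatL2 ε) : IntegrableOn u (Ioo ε (Real.pi - ε)) :=
  (Lp.memLp u).integrable (by norm_num)

theorem norm_sq_latL2 (u : LatL2 ε) : ‖u‖ ^ 2 = ∫ x, ‖u x‖ ^ 2 ∂(latMeasure ε) := by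
  have h := inner_self_eq_norm_sq_to_K (𝕜 := ℂ) u
  rw [L2.inner_def] at h
  have e : ∫ x, inner ℂ (u x) (u x) ∂(latMeasure ε)
      = ((∫ x, ‖u x‖ ^ 2 ∂(latMeasure ε) : ℝ) : ℂ) := by
    rw [← integral_complex_ofReal]
    refine integral_congr_ae (Eventually.of_forall fun x => ?_)
    simp [inner_self_eq_norm_sq_to_K]
  rw [e] at h
  refine Complex.ofReal_injective ?_
  rw [h, Complex.ofReal_pow]
  rfl

theorem isClosed_sobolev (ε : ℝ) (k : ℕ) :
    IsClosed (sobolev ε k : Set (PiLp 2 fun _ : Fin (k + 1) => LatL2 ε)) := by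
  have : (sobolev ε k : Set (PiLp 2 fun _ : Fin (k + 1) => LatL2 ε)) =
      ⋂ (j : Fin k) (φ : ℝ → ℝ) (_ : ContDiff ℝ (⊤ : ℕ∞) φ) (_ : HasCompactSupport φ)
        (_ : tsupport φ ⊆ Ioo ε (Real.pi - ε)),
        {u | ∫ x in Ioo ε (Real.pi - ε), deriv φ x • u j.castSucc x
          = - ∫ x in Ioo ε (Real.pi - ε), φ x • u j.succ x} := by
    ext u
    simp only [mem_iInter]
    rfl
  rw [this]
  refine isClosed_iInter fun j => isClosed_iInter fun φ => isClosed_iInter fun h1 =>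
    isClosed_iInter fun h2 => isClosed_iInter fun h3 => ?_
  obtain ⟨l₁, hl₁⟩ := exists_clm_integral_smul (ε := ε) (χ := deriv φ)
    (h1.continuous_deriv (by simp)).continuousOn
  obtain ⟨l₂, hl₂⟩ := exists_clm_integral_smul (ε := ε) (χ := φ) h1.continuous.continuousOn
  simp only [← hl₁, ← hl₂]
  exact isClosed_eq (l₁.continuous.comp (PiLp.continuous_apply 2 (fun _ => LatL2 ε) j.castSucc))
    (l₂.continuous.comp (PiLp.continuous_apply 2 (fun _ => LatL2 ε) j.succ)).neg

instance (ε : ℝ) (k : ℕ) : CompleteSpace (sobolev ε k) :=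
  (isClosed_sobolev ε k).completeSpace_coe

theorem sobolev_exists_acDeriv (h : ε < Real.pi - ε) {k : ℕ} (u : sobolev ε k) (j : Fin k) :
    ∃ F : ℝ → ℂ, ACDeriv ε (Real.pi - ε) F (u.1 j.succ) ∧ u.1 j.castSucc =ᵐ[latMeasure ε] F :=
  (u.2 j).exists_acDeriv h (integrableOn_latL2 _) (integrableOn_latL2 _)

theorem eqOn_Icc_of_ae_eq {a b : ℝ} (hab : a < b) {f g : ℝ → ℂ} (hf : ContinuousOn f (Icc a b))
    (hg : ContinuousOn g (Icc a b)) (h : f =ᵐ[volume.restrict (Ioo a b)] g) :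
    EqOn f g (Icc a b) := by
  refine Measure.eqOn_Icc_of_ae_eq volume hab.ne ?_ hf hg
  rwa [← restrict_Ioo_eq_restrict_Icc]

theorem HasBoundaryValues.eq (h : ε < Real.pi - ε) {f F : ℝ → ℂ} {v w : ℂ}
    (hb : HasBoundaryValues ε f v w) (hF : ContinuousOn F (Icc ε (Real.pi - ε)))
    (hf : f =ᵐ[latMeasure ε] F) : F ε = v ∧ F (Real.pi - ε) = w := by
  obtain ⟨g, hg, hfg, h0, h1⟩ := hb
  have := eqOn_Icc_of_ae_eq h hF hg (hf.symm.trans hfg)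
  exact ⟨(this (left_mem_Icc.2 h.le)).trans h0, (this (right_mem_Icc.2 h.le)).trans h1⟩

/-- For the absolutely continuous representative F on [a, b], the first integral is F(b) - F(a) and
the second expression is bF(b) - aF(a). Both vanish only if both end values do, so the trace
condition consists of L²-continuous equations. -/
theorem hasBoundaryValues_zero_iff (h : ε < Real.pi - ε) {k : ℕ} (u : sobolev ε k) (j : Fin k) :
    HasBoundaryValues ε (u.1 j.castSucc) 0 0 ↔
      (∫ x, (1 : ℝ) • u.1 j.succ x ∂(latMeasure ε) = 0) ∧
      (∫ x, (1 : ℝ) • u.1 j.castSucc x ∂(latMeasure ε))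
        + ∫ x, x • u.1 j.succ x ∂(latMeasure ε) = 0 := by
  obtain ⟨F, hF, hu⟩ := sobolev_exists_acDeriv h u j
  have e1 : ∫ x, (1 : ℝ) • u.1 j.succ x ∂(latMeasure ε) = F (Real.pi - ε) - F ε := by
    simp only [one_smul]
    exact hF.integral_eq_sub h.le
  have e2 : (∫ x, (1 : ℝ) • u.1 j.castSucc x ∂(latMeasure ε))
        + ∫ x, x • u.1 j.succ x ∂(latMeasure ε)
        = (Real.pi - ε) • F (Real.pi - ε) - ε • F ε := by
    rw [← hF.integral_deriv_smul (φ := fun x => x) h.le contDiff_id]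
    congr 1
    refine integral_congr_ae ?_
    filter_upwards [hu] with x hx
    rw [hx]
    simp
  rw [e1, e2]
  constructor
  · intro hb
    obtain ⟨h0, h1⟩ := hb.eq h (hF.continuousOn h.le) hu
    simp [h0, h1]
  · rintro ⟨h0, h1⟩
    have h2 : F (Real.pi - ε) = F ε := sub_eq_zero.1 h0
    rw [h2, ← sub_smul, smul_eq_zero] at h1
    have h3 : F ε = 0 := h1.resolve_left (by linarith)
    exact ⟨F, hF.continuousOn h.le, hu, h3, h2.trans h3⟩

theorem isClosed_sobolev₀ (h : ε < Real.pi - ε) (k : ℕ) (hk : 2 ≤ k) :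
    IsClosed (sobolev₀ ε k : Set (sobolev ε k)) := by
  obtain ⟨l₁, hl₁⟩ := exists_clm_integral_smul (ε := ε) (χ := fun _ => 1) continuousOn_const
  obtain ⟨l₂, hl₂⟩ := exists_clm_integral_smul (ε := ε) (χ := fun x => x) continuousOn_id
  have : (sobolev₀ ε k : Set (sobolev ε k)) =
      ⋂ (j : Fin k) (_ : (j : ℕ) < 2), {u : sobolev ε k | l₁ (u.1 j.succ) = 0 ∧
        l₁ (u.1 j.castSucc) + l₂ (u.1 j.succ) = 0} := by
    ext u
    simp only [mem_iInter, hl₁, hl₂]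
    constructor
    · intro hu j hj
      exact (hasBoundaryValues_zero_iff h u j).1 (hu j.castSucc hj)
    · intro hu j hj
      have := (hasBoundaryValues_zero_iff h u ⟨j, hj.trans_le hk⟩).2 (hu ⟨j, hj.trans_le hk⟩ hj)
      exact this
  rw [this]
  have hc : ∀ j : Fin (k + 1), Continuous fun u : sobolev ε k => u.1 j := fun j =>
    (PiLp.continuous_apply 2 _ j).comp continuous_subtype_val
  refine isClosed_iInter fun j => isClosed_iInter fun _ => IsClosed.inter ?_ ?_
  · exact isClosed_eq (l₁.continuous.comp (hc _)) continuous_const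
  · exact isClosed_eq ((l₁.continuous.comp (hc _)).add (l₂.continuous.comp (hc _)))
      continuous_const

theorem norm_apply_le {k : ℕ} (u : sobolev ε k) (j : Fin (k + 1)) : ‖u.1 j‖ ≤ ‖u‖ :=
  PiLp.norm_apply_le u.1 j

theorem integral_norm_latL2_le (h : ε < Real.pi - ε) (u : LatL2 ε) :
    ∫ x, ‖u x‖ ∂(latMeasure ε) ≤ √(Real.pi - ε - ε) * ‖u‖ := by
  have h1 := abs_integral_mul_le (μ := latMeasure ε) (f := fun _ => (1 : ℝ)) (g := fun x => ‖u x‖)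
    (by simp) ((memLp_two_iff_integrable_sq_norm (Lp.memLp u).1).1 (Lp.memLp u))
    (by simpa using (integrableOn_latL2 u).norm)
  rw [← norm_sq_latL2, Real.sqrt_mul' _ (sq_nonneg _), Real.sqrt_sq (norm_nonneg _)] at h1
  have e : ∫ _ : ℝ, (1 : ℝ) ^ 2 ∂(latMeasure ε) = Real.pi - ε - ε := by
    simp [Measure.real, ENNReal.toReal_ofReal (by linarith : 0 ≤ Real.pi - ε - ε)]
  rw [e] at h1
  simpa using (le_abs_self _).trans h1

/-- Functions in `H¹(I')` are bounded. -/
theorem sobolev_exists_bound (h : ε < Real.pi - ε) : ∃ C, 0 ≤ C ∧ ∀ {k : ℕ} (u : sobolev ε k)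
    (j : Fin k), ∀ᵐ x ∂(latMeasure ε), ‖u.1 j.castSucc x‖ ≤ C * ‖u‖ := by
  set d := Real.pi - ε - ε with hd
  have hd0 : 0 < d := by linarith
  refine ⟨√d / d + √d, by positivity, fun {k} u j => ?_⟩
  obtain ⟨F, hF, hu⟩ := sobolev_exists_acDeriv h u j
  have hFc := hF.continuousOn h.le
  have hFi : IntegrableOn (fun x => ‖F x‖) (Ioo ε (Real.pi - ε)) :=
    Clamped.integrableOn_of_continuousOn hFc.norm
  have h1 : ∫ x in Ioo ε (Real.pi - ε), ‖F x‖ ≤ √d * ‖u‖ := by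
    refine le_trans (le_of_eq ?_) ((integral_norm_latL2_le h (u.1 j.castSucc)).trans
      (mul_le_mul_of_nonneg_left (norm_apply_le u _) (Real.sqrt_nonneg _)))
    refine integral_congr_ae ?_
    filter_upwards [hu] with x hx
    rw [hx]
  have h2 : ∫ x in Ioo ε (Real.pi - ε), ‖u.1 j.succ x‖ ≤ √d * ‖u‖ :=
    (integral_norm_latL2_le h (u.1 j.succ)).trans
      (mul_le_mul_of_nonneg_left (norm_apply_le u _) (Real.sqrt_nonneg _))
  filter_upwards [hu, ae_restrict_mem measurableSet_Ioo] with x hx hxI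
  rw [hx]
  have hxI' := Ioo_subset_Icc_self hxI
  -- The value at `x` is compared with the mean over I'; the oscillation is bounded by the integral
  -- of the derivative.
  have h3 : ∫ _ in Ioo ε (Real.pi - ε), ‖F x‖ ≤ ∫ y in Ioo ε (Real.pi - ε), (‖F y‖ + √d * ‖u‖) := by
    refine setIntegral_mono_on (integrable_const _) (hFi.add (integrable_const _))
      measurableSet_Ioo fun y hy => ?_
    have h4 := (hF.norm_sub_le h.le hxI' (Ioo_subset_Icc_self hy)).trans h2
    linarith [norm_sub_norm_le (F x) (F y)]
  rw [integral_add hFi (integrable_const _)] at h3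
  simp only [integral_const, Measure.real, Measure.restrict_apply, MeasurableSet.univ, univ_inter,
    Real.volume_Ioo, ← hd, ENNReal.toReal_ofReal hd0.le, smul_eq_mul] at h3
  have h5 : d * ‖F x‖ ≤ d * ((√d / d + √d) * ‖u‖) := by
    have : d * ((√d / d + √d) * ‖u‖) = √d * ‖u‖ + d * (√d * ‖u‖) := by field_simp
    linarith
  exact le_of_mul_le_mul_left h5 hd0

theorem sobolev_memLp_top (h : ε < Real.pi - ε) {k : ℕ} (u : sobolev ε k) (j : Fin k) :
    MemLp (u.1 j.castSucc) ⊤ (latMeasure ε) := by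
  obtain ⟨C, _, hC⟩ := sobolev_exists_bound h
  exact memLp_top_of_bound (Lp.memLp _).1 _ (hC u j)

/-- Representatives of elements of `H²_0(I')`. -/
theorem sobolev₀_exists_clamped (hε : 0 < ε) (h : ε < Real.pi - ε) (u : sobolev₀ ε 2) :
    ∃ y₀ y₁ : ℝ → ℂ, Clamped ε (Real.pi - ε) y₀ y₁ (u.1.1 2) ∧ u.1.1 0 =ᵐ[latMeasure ε] y₀ ∧
      u.1.1 1 =ᵐ[latMeasure ε] y₁ := by
  obtain ⟨y₁, h1, hu1⟩ := sobolev_exists_acDeriv h u.1 1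
  obtain ⟨y₀, h0, hu0⟩ := sobolev_exists_acDeriv h u.1 0
  have b0 := (u.2 0 (by norm_num)).eq h (h0.continuousOn h.le) hu0
  have b1 := (u.2 1 (by norm_num)).eq h (h1.continuousOn h.le) hu1
  exact ⟨y₀, y₁, ⟨hε, h, by linarith, h0.congr_deriv hu1, h1, Lp.memLp _, b0.1, b0.2, b1.1, b1.2⟩,
    hu0, hu1⟩

/-- In Bochner's formula all terms are nonnegative, so X bounds ∫ |y''|² sin and, through G, ∫ |y'|²
sin. Since sin is at least sin ε on I' the weights can be dropped, and y itself is integrated from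
the left end. This also covers μ = 0 and the constant does not depend on μ. -/
theorem exists_norm_sq_le_lapEnergy (hε : 0 < ε) (h : ε < Real.pi - ε) :
    ∃ C, 0 < C ∧ ∀ (μ : ℝ) (u : sobolev₀ ε 2) (y₀ y₁ : ℝ → ℂ),
      Clamped ε (Real.pi - ε) y₀ y₁ (u.1.1 2) → u.1.1 0 =ᵐ[latMeasure ε] y₀ →
      u.1.1 1 =ᵐ[latMeasure ε] y₁ →
      ‖u‖ ^ 2 ≤ C * lapEnergy ε (Real.pi - ε) μ y₀ y₁ (u.1.1 2) := by
  have hσ : 0 < Real.sin ε := Real.sin_pos_of_mem_Ioo ⟨hε, by linarith⟩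
  set d := Real.pi - ε - ε with hd
  have hd0 : 0 < d := by linarith
  refine ⟨(d ^ 2 + 2) / Real.sin ε, by positivity, fun μ u y₀ y₁ hc hu0 hu1 => ?_⟩
  set X := lapEnergy ε (Real.pi - ε) μ y₀ y₁ (u.1.1 2) with hX
  have hsin : ∀ x ∈ Ioo ε (Real.pi - ε), Real.sin ε ≤ Real.sin x := by
    intro x hx
    rcases le_total x (Real.pi / 2) with h1 | h1
    · exact Real.sin_le_sin_of_le_of_le_pi_div_two (by linarith) h1 hx.1.le
    · rw [← Real.sin_pi_sub x]
      exact Real.sin_le_sin_of_le_of_le_pi_div_two (by linarith) (by linarith) (by linarith [hx.2])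
  have key : ∀ {y : ℝ → ℂ}, MemLp y 2 (latMeasure ε) →
      ∫ x, ‖y x‖ ^ 2 ∂(latMeasure ε) ≤ massEnergy ε (Real.pi - ε) y / Real.sin ε := by
    intro y hy
    rw [le_div_iff₀ hσ, mul_comm, massEnergy, ← integral_const_mul]
    refine setIntegral_mono_on
      (((memLp_two_iff_integrable_sq_norm hy.1).1 hy).const_mul _)
      (Clamped.integrable_sin_mul_norm_sq hy) measurableSet_Ioo fun x hx => ?_
    gcongr
    exact hsin x hx
  have hB := hc.lapEnergy_eq (μ := μ)
  have hG := hc.gradEnergy_nonneg (μ := μ)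
  have hm := hc.massEnergy_nonneg (u.1.1 2)
  have hR : 0 ≤ ∫ x in Ioo ε (Real.pi - ε),
      (2 * μ ^ 2 * (‖y₁ x - ((Real.cos x / Real.sin x : ℝ) : ℂ) * y₀ x‖ ^ 2 / Real.sin x)
        + Real.sin x * ‖((Real.cos x / Real.sin x : ℝ) : ℂ) * y₁ x
          - ((μ ^ 2 / Real.sin x ^ 2 : ℝ) : ℂ) * y₀ x‖ ^ 2) :=
    setIntegral_nonneg measurableSet_Ioo fun x hx => by
      have := hc.sin_pos (Ioo_subset_Icc_self hx)
      positivity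
  have hD : massEnergy ε (Real.pi - ε) y₁ ≤ gradEnergy ε (Real.pi - ε) μ y₀ y₁ := by
    rw [gradEnergy]
    nlinarith [mul_nonneg (sq_nonneg μ) (hc.angularEnergy_nonneg y₀)]
  have n2 : ‖u.1.1 2‖ ^ 2 ≤ X / Real.sin ε := by
    rw [norm_sq_latL2]
    refine (key (Lp.memLp _)).trans ?_
    gcongr
    linarith
  have hy1 : ∫ x, ‖y₁ x‖ ^ 2 ∂(latMeasure ε) ≤ X / Real.sin ε := by
    refine (key (Clamped.memLp_of_continuousOn hc.continuousOn₁)).trans ?_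
    gcongr
    linarith
  have e1 : ‖u.1.1 1‖ ^ 2 = ∫ x, ‖y₁ x‖ ^ 2 ∂(latMeasure ε) := by
    rw [norm_sq_latL2]
    refine integral_congr_ae ?_
    filter_upwards [hu1] with x hx
    rw [hx]
  have e0 : ‖u.1.1 0‖ ^ 2 = ∫ x, ‖y₀ x‖ ^ 2 ∂(latMeasure ε) := by
    rw [norm_sq_latL2]
    refine integral_congr_ae ?_
    filter_upwards [hu0] with x hx
    rw [hx]
  have hI : ∫ x in Ioo ε (Real.pi - ε), ‖y₁ x‖ ≤ √d * ‖u.1.1 1‖ := by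
    refine le_trans (le_of_eq (integral_congr_ae ?_)) (integral_norm_latL2_le h (u.1.1 1))
    filter_upwards [hu1] with x hx
    rw [hx]
  have hy0 : ∫ x, ‖y₀ x‖ ^ 2 ∂(latMeasure ε) ≤ d ^ 2 * (X / Real.sin ε) := by
    have h1 : ∫ x, ‖y₀ x‖ ^ 2 ∂(latMeasure ε) ≤ ∫ _, d * ‖u.1.1 1‖ ^ 2 ∂(latMeasure ε) := by
      refine setIntegral_mono_on (Clamped.integrableOn_of_continuousOn
        (hc.continuousOn₀.norm.pow 2)) (integrable_const _) measurableSet_Ioo fun x hx => ?_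
      have h2 := hc.ac₀.norm_sub_le h.le (Ioo_subset_Icc_self hx) (left_mem_Icc.2 h.le)
      rw [hc.left₀, sub_zero] at h2
      calc ‖y₀ x‖ ^ 2 ≤ (√d * ‖u.1.1 1‖) ^ 2 := by gcongr; exact h2.trans hI
        _ = d * ‖u.1.1 1‖ ^ 2 := by rw [mul_pow, Real.sq_sqrt hd0.le]
    simp only [integral_const, Measure.real, Measure.restrict_apply, MeasurableSet.univ, univ_inter,
      Real.volume_Ioo, ← hd, ENNReal.toReal_ofReal hd0.le, smul_eq_mul] at h1
    rw [e1] at h1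
    have h5 : d * (d * ∫ x, ‖y₁ x‖ ^ 2 ∂(latMeasure ε)) ≤ d * (d * (X / Real.sin ε)) := by gcongr
    linarith [sq d]
  have hn : ‖u‖ ^ 2 = ‖u.1.1 0‖ ^ 2 + ‖u.1.1 1‖ ^ 2 + ‖u.1.1 2‖ ^ 2 := by
    change ‖u.1.1‖ ^ 2 = _
    rw [PiLp.norm_sq_eq_of_L2, Fin.sum_univ_three]
  rw [hn, e0, e1]
  have : (d ^ 2 + 2) / Real.sin ε * X = d ^ 2 * (X / Real.sin ε) + X / Real.sin ε
    + X / Real.sin ε := by ring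
  rw [this]
  gcongr

end Sobolev

/-! ### Sesquilinear forms given by a matrix of coefficients -/

section Form

variable {ε : ℝ}

/-- The form `∑ᵢⱼ ∫ cᵢⱼ u⁽ⁱ⁾ conj(v⁽ʲ⁾)`. -/
noncomputable def coeffForm (ε : ℝ) (c : Fin 3 → Fin 3 → ℝ → ℂ) (u v : Fin 3 → ℝ → ℂ) : ℂ :=
  ∑ i, ∑ j, ∫ x, c i j x * u i x * conj (v j x) ∂(latMeasure ε)

/-- The coefficients are square integrable, and the top order one is bounded. -/
structure AdmissibleCoeff (ε : ℝ) (c : Fin 3 → Fin 3 → ℝ → ℂ) : Prop where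
  memLp : ∀ i j, MemLp (c i j) 2 (latMeasure ε)
  top : MemLp (c 2 2) ⊤ (latMeasure ε)

/-- The coefficients of the adjoint form. -/
def adjointCoeff (c : Fin 3 → Fin 3 → ℝ → ℂ) : Fin 3 → Fin 3 → ℝ → ℂ :=
  fun i j x => conj (c j i x)

theorem memLp_conj {f : ℝ → ℂ} {p : ℝ≥0∞} (hf : MemLp f p (latMeasure ε)) :
    MemLp (fun x => conj (f x)) p (latMeasure ε) :=
  hf.star

theorem AdmissibleCoeff.adjoint {c : Fin 3 → Fin 3 → ℝ → ℂ} (hc : AdmissibleCoeff ε c) :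
    AdmissibleCoeff ε (adjointCoeff c) :=
  ⟨fun i j => memLp_conj (hc.memLp j i), memLp_conj hc.top⟩

theorem conj_coeffForm (c : Fin 3 → Fin 3 → ℝ → ℂ) (u v : Fin 3 → ℝ → ℂ) :
    conj (coeffForm ε c v u) = coeffForm ε (adjointCoeff c) u v := by
  simp only [coeffForm, map_sum]
  rw [Finset.sum_comm]
  refine Finset.sum_congr rfl fun i _ => Finset.sum_congr rfl fun j _ => ?_
  rw [← integral_conj]
  refine integral_congr_ae (Eventually.of_forall fun x => ?_)
  simp only [adjointCoeff, map_mul, Complex.conj_conj]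
  ring

theorem jet_memLp {k : ℕ} (u : sobolev ε (k + 2)) (i : Fin 3) : MemLp (jet u i) 2 (latMeasure ε) :=
  Lp.memLp _

theorem jet_memLp_top (h : ε < Real.pi - ε) {k : ℕ} (u : sobolev ε (k + 2)) {i : Fin 3}
    (hi : i ≠ 2) : MemLp (jet u i) ⊤ (latMeasure ε) := by
  have := sobolev_memLp_top h u ⟨i, by omega⟩
  exact this

theorem jet_bound (h : ε < Real.pi - ε) : ∃ C, 0 ≤ C ∧ ∀ {k : ℕ} (u : sobolev ε (k + 2)) {i : Fin 3},
    i ≠ 2 → ∀ᵐ x ∂(latMeasure ε), ‖jet u i x‖ ≤ C * ‖u‖ := by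
  obtain ⟨C, hC, H⟩ := sobolev_exists_bound h
  exact ⟨C, hC, fun {k} u {i} hi => H u ⟨i, by omega⟩⟩

theorem integrable_mul_of_memLp {f g : ℝ → ℂ} (hf : MemLp f 2 (latMeasure ε))
    (hg : MemLp g 2 (latMeasure ε)) : Integrable (fun x => f x * g x) (latMeasure ε) :=
  hf.integrable_mul hg

theorem memLp_mul_top {f g : ℝ → ℂ} (hf : MemLp f 2 (latMeasure ε))
    (hg : MemLp g ⊤ (latMeasure ε)) : MemLp (fun x => f x * g x) 2 (latMeasure ε) :=
  hg.mul hf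

theorem memLp_top_mul {f g : ℝ → ℂ} (hf : MemLp f ⊤ (latMeasure ε))
    (hg : MemLp g 2 (latMeasure ε)) : MemLp (fun x => f x * g x) 2 (latMeasure ε) :=
  hg.mul hf

/-- Unless both indices equal 2, one of the two functions is bounded, and an L² coefficient is
enough. This matters because Ω' is only square integrable. -/
theorem AdmissibleCoeff.integrable {c : Fin 3 → Fin 3 → ℝ → ℂ} (hc : AdmissibleCoeff ε c)
    (h : ε < Real.pi - ε) {k l : ℕ} (u : sobolev ε (k + 2)) (v : sobolev ε (l + 2)) (i j : Fin 3) :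
    Integrable (fun x => c i j x * jet u i x * conj (jet v j x)) (latMeasure ε) := by
  by_cases hi : i = 2
  · by_cases hj : j = 2
    · subst hi hj
      exact integrable_mul_of_memLp (memLp_top_mul hc.top (jet_memLp u 2))
        (memLp_conj (jet_memLp v 2))
    · have := integrable_mul_of_memLp (memLp_mul_top (hc.memLp i j)
        (memLp_conj (jet_memLp_top h v hj))) (jet_memLp u i)
      exact this.congr (Eventually.of_forall fun x => by ring)
  · exact integrable_mul_of_memLp (memLp_mul_top (hc.memLp i j) (jet_memLp_top h u hi))
      (memLp_conj (jet_memLp v j))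

theorem norm_integral_mul_mul_le {f g k : ℝ → ℂ} {M : ℝ} (hM : 0 ≤ M)
    (hf : ∀ᵐ x ∂(latMeasure ε), ‖f x‖ ≤ M)
    (hg : MemLp g 2 (latMeasure ε)) (hk : MemLp k 2 (latMeasure ε)) :
    ‖∫ x, f x * g x * k x ∂(latMeasure ε)‖
      ≤ M * √((∫ x, ‖g x‖ ^ 2 ∂(latMeasure ε)) * ∫ x, ‖k x‖ ^ 2 ∂(latMeasure ε)) := by
  have hi : Integrable (fun x => ‖g x‖ * ‖k x‖) (latMeasure ε) := hg.norm.integrable_mul hk.norm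
  have h1 := abs_integral_mul_le (μ := latMeasure ε) (f := fun x => ‖g x‖) (g := fun x => ‖k x‖)
    ((memLp_two_iff_integrable_sq_norm hg.1).1 hg) ((memLp_two_iff_integrable_sq_norm hk.1).1 hk) hi
  refine (norm_integral_le_integral_norm _).trans (le_trans ?_
    (mul_le_mul_of_nonneg_left ((le_abs_self _).trans h1) hM))
  rw [← integral_const_mul]
  refine integral_mono_of_nonneg (Eventually.of_forall fun x => norm_nonneg _) (hi.const_mul M) ?_
  filter_upwards [hf] with x hx
  rw [norm_mul, norm_mul, mul_assoc]
  gcongr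

theorem jet_norm_sq {k : ℕ} (u : sobolev ε (k + 2)) (i : Fin 3) :
    ∫ x, ‖jet u i x‖ ^ 2 ∂(latMeasure ε) ≤ ‖u‖ ^ 2 := by
  have := norm_apply_le u (Fin.castLE (by omega) i)
  refine le_trans (le_of_eq (norm_sq_latL2 _).symm) ?_
  gcongr

theorem AdmissibleCoeff.exists_bound {c : Fin 3 → Fin 3 → ℝ → ℂ} (hc : AdmissibleCoeff ε c)
    (h : ε < Real.pi - ε) : ∃ C, 0 ≤ C ∧ ∀ u v : sobolev ε 2,
      ‖coeffForm ε c (jet u) (jet v)‖ ≤ C * ‖u‖ * ‖v‖ := by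
  have key : ∀ i j : Fin 3, ∃ C, 0 ≤ C ∧ ∀ u v : sobolev ε 2,
      ‖∫ x, c i j x * jet u i x * conj (jet v j x) ∂(latMeasure ε)‖ ≤ C * ‖u‖ * ‖v‖ := by
    intro i j
    obtain ⟨C, hC, H⟩ := jet_bound h
    set K := √(∫ x, ‖c i j x‖ ^ 2 ∂(latMeasure ε)) with hK
    have hK0 : 0 ≤ K := Real.sqrt_nonneg _
    have hsq : ∀ (w : sobolev ε 2) (l : Fin 3),
        √(∫ x, ‖jet w l x‖ ^ 2 ∂(latMeasure ε)) ≤ ‖w‖ := fun w l =>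
      Real.sqrt_le_iff.2 ⟨norm_nonneg _, jet_norm_sq w l⟩
    have hI0 : ∀ f : ℝ → ℂ, 0 ≤ ∫ x, ‖f x‖ ^ 2 ∂(latMeasure ε) := fun f =>
      integral_nonneg fun x => sq_nonneg _
    by_cases hi : i = 2
    · by_cases hj : j = 2
      · subst hi hj
        set M := (eLpNorm (c 2 2) ⊤ (latMeasure ε)).toReal with hM
        have hMb : ∀ᵐ x ∂(latMeasure ε), ‖c 2 2 x‖ ≤ M := by
          have := hc.top.2
          filter_upwards [ae_le_eLpNormEssSup (f := c 2 2) (μ := latMeasure ε)] with x hx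
          rw [hM, eLpNorm_exponent_top, ← toReal_enorm]
          exact ENNReal.toReal_mono (by rw [← eLpNorm_exponent_top]; exact this.ne) hx
        refine ⟨M, ENNReal.toReal_nonneg, fun u v => ?_⟩
        refine (norm_integral_mul_mul_le ENNReal.toReal_nonneg hMb (jet_memLp u 2)
          (memLp_conj (jet_memLp v 2))).trans ?_
        simp only [RCLike.norm_conj]
        rw [Real.sqrt_mul (hI0 _), mul_assoc]
        gcongr
        · exact hsq u 2
        · exact hsq v 2
      · refine ⟨C * K, by positivity, fun u v => ?_⟩
        have h1 := norm_integral_mul_mul_le (f := fun x => conj (jet v j x)) (M := C * ‖v‖)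
          (by positivity) (by simpa using H v hj) (hc.memLp i j) (jet_memLp u i)
        rw [Real.sqrt_mul (hI0 _)] at h1
        have e : ∫ x, c i j x * jet u i x * conj (jet v j x) ∂(latMeasure ε)
            = ∫ x, conj (jet v j x) * c i j x * jet u i x ∂(latMeasure ε) :=
          integral_congr_ae (Eventually.of_forall fun x => by simp only []; ring)
        rw [e]
        refine h1.trans ?_
        calc C * ‖v‖ * (K * √(∫ x, ‖jet u i x‖ ^ 2 ∂(latMeasure ε))) ≤ C * ‖v‖ * (K * ‖u‖) := by
              gcongr; exact hsq u i
          _ = _ := by ring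
    · refine ⟨C * K, by positivity, fun u v => ?_⟩
      have h1 := norm_integral_mul_mul_le (f := jet u i) (M := C * ‖u‖)
        (by positivity) (H u hi) (hc.memLp i j) (memLp_conj (jet_memLp v j))
      simp only [RCLike.norm_conj] at h1
      rw [Real.sqrt_mul (hI0 _)] at h1
      have e : ∫ x, c i j x * jet u i x * conj (jet v j x) ∂(latMeasure ε)
          = ∫ x, jet u i x * c i j x * conj (jet v j x) ∂(latMeasure ε) :=
        integral_congr_ae (Eventually.of_forall fun x => by simp only []; ring)
      rw [e]
      refine h1.trans ?_
      calc C * ‖u‖ * (K * √(∫ x, ‖jet v j x‖ ^ 2 ∂(latMeasure ε))) ≤ C * ‖u‖ * (K * ‖v‖) := by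
            gcongr; exact hsq v j
        _ = _ := by ring
  choose C hC H using key
  refine ⟨∑ i, ∑ j, C i j, Finset.sum_nonneg fun i _ => Finset.sum_nonneg fun j _ => hC i j,
    fun u v => ?_⟩
  rw [coeffForm, Finset.sum_mul, Finset.sum_mul]
  refine (norm_sum_le _ _).trans (Finset.sum_le_sum fun i _ => ?_)
  rw [Finset.sum_mul, Finset.sum_mul]
  exact (norm_sum_le _ _).trans (Finset.sum_le_sum fun j _ => H i j u v)

theorem jet_add {k : ℕ} (u v : sobolev ε (k + 2)) (i : Fin 3) :
    jet (u + v) i =ᵐ[latMeasure ε] fun x => jet u i x + jet v i x :=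
  Lp.coeFn_add _ _

theorem jet_smul {k : ℕ} (a : ℂ) (u : sobolev ε (k + 2)) (i : Fin 3) :
    jet (a • u) i =ᵐ[latMeasure ε] fun x => a * jet u i x :=
  Lp.coeFn_smul _ _

/-- A bounded sesquilinear form defines a bounded operator to the antidual space. -/
theorem exists_operator_of_bounded {V W : Type*} [NormedAddCommGroup V] [NormedSpace ℂ V]
    [NormedAddCommGroup W] [NormedSpace ℂ W] (a : V → W → ℂ) (C : ℝ)
    (add_left : ∀ u u' v, a (u + u') v = a u v + a u' v)
    (smul_left : ∀ (c : ℂ) u v, a (c • u) v = c • a u v)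
    (add_right : ∀ u v v', a u (v + v') = a u v + a u v')
    (smul_right : ∀ (c : ℂ) u v, a u (c • v) = conj c • a u v)
    (H : ∀ u v, ‖a u v‖ ≤ C * ‖u‖ * ‖v‖) : ∃ B : V →L[ℂ] (W →L⋆[ℂ] ℂ), ∀ u v, B u v = a u v :=
  ⟨LinearMap.mkContinuous₂ (LinearMap.mk₂'ₛₗ (RingHom.id ℂ) (starRingEnd ℂ) a
    add_left smul_left add_right smul_right) C H, fun _ _ => rfl⟩

/-- The operator `H²(I') → H⁻²(I')` associated with a form. -/
theorem AdmissibleCoeff.exists_operator {c : Fin 3 → Fin 3 → ℝ → ℂ} (hc : AdmissibleCoeff ε c)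
    (h : ε < Real.pi - ε) : ∃ B : sobolev ε 2 →L[ℂ] SobolevDual ε, ∀ (u : sobolev ε 2)
      (v : sobolev₀ ε 2), B u v = coeffForm ε c (jet u) (jet v.1) := by
  obtain ⟨C, hC, H⟩ := hc.exists_bound h
  have add_left : ∀ (u u' : sobolev ε 2) (v : sobolev₀ ε 2),
      coeffForm ε c (jet (u + u')) (jet v.1)
        = coeffForm ε c (jet u) (jet v.1) + coeffForm ε c (jet u') (jet v.1) := by
    intro u u' v
    simp only [coeffForm, ← Finset.sum_add_distrib]
    refine Finset.sum_congr rfl fun i _ => Finset.sum_congr rfl fun j _ => ?_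
    rw [← integral_add (hc.integrable h u v.1 i j) (hc.integrable h u' v.1 i j)]
    refine integral_congr_ae ?_
    filter_upwards [jet_add u u' i] with x hx
    rw [hx]
    ring
  have smul_left : ∀ (a : ℂ) (u : sobolev ε 2) (v : sobolev₀ ε 2),
      coeffForm ε c (jet (a • u)) (jet v.1) = a • coeffForm ε c (jet u) (jet v.1) := by
    intro a u v
    simp only [coeffForm, smul_eq_mul, Finset.mul_sum]
    refine Finset.sum_congr rfl fun i _ => Finset.sum_congr rfl fun j _ => ?_
    rw [← integral_const_mul]
    refine integral_congr_ae ?_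
    filter_upwards [jet_smul a u i] with x hx
    rw [hx]
    ring
  have add_right : ∀ (u : sobolev ε 2) (v v' : sobolev₀ ε 2),
      coeffForm ε c (jet u) (jet (v + v').1)
        = coeffForm ε c (jet u) (jet v.1) + coeffForm ε c (jet u) (jet v'.1) := by
    intro u v v'
    simp only [coeffForm, ← Finset.sum_add_distrib]
    refine Finset.sum_congr rfl fun i _ => Finset.sum_congr rfl fun j _ => ?_
    rw [← integral_add (hc.integrable h u v.1 i j) (hc.integrable h u v'.1 i j)]
    refine integral_congr_ae ?_
    filter_upwards [jet_add v.1 v'.1 j] with x hx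
    change c i j x * jet u i x * conj (jet (v.1 + v'.1) j x) = _
    rw [hx, map_add]
    ring
  have smul_right : ∀ (a : ℂ) (u : sobolev ε 2) (v : sobolev₀ ε 2),
      coeffForm ε c (jet u) (jet (a • v).1) = conj a • coeffForm ε c (jet u) (jet v.1) := by
    intro a u v
    simp only [coeffForm, smul_eq_mul, Finset.mul_sum]
    refine Finset.sum_congr rfl fun i _ => Finset.sum_congr rfl fun j _ => ?_
    rw [← integral_const_mul]
    refine integral_congr_ae ?_
    filter_upwards [jet_smul a v.1 j] with x hx
    change c i j x * jet u i x * conj (jet (a • v.1) j x) = _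
    rw [hx, map_mul]
    ring
  exact exists_operator_of_bounded
    (fun (u : sobolev ε 2) (v : sobolev₀ ε 2) => coeffForm ε c (jet u) (jet v.1)) C
    add_left smul_left add_right smul_right fun u v => H u v.1

/-! ### The wave form as a matrix of coefficients -/

/-- The coefficients of the separated Laplacian on the unit sphere. -/
noncomputable def lapCoeff (m : ℤ) : Fin 3 → ℝ → ℝ :=
  ![fun x => -((m : ℝ) ^ 2 / Real.sin x ^ 2), fun x => Real.cos x / Real.sin x, fun _ => 1]

/-- The coefficients of the gradient form. -/
noncomputable def gradCoeff (m : ℤ) : Fin 3 → Fin 3 → ℝ → ℝ :=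
  ![![fun x => (m : ℝ) ^ 2 / Real.sin x, 0, 0], ![0, Real.sin, 0], ![0, 0, 0]]

/-- The coefficients of the vorticity gradient form, without the factor `-i m`. -/
noncomputable def vorticityCoeff (Ω Ω₁ : ℝ → ℝ) : Fin 3 → Fin 3 → ℝ → ℝ :=
  ![![0, fun x => Ω₁ x * Real.sin x + 2 * Ω x * Real.cos x, 0],
    ![fun x => Ω₁ x * Real.sin x + 2 * Ω x * Real.cos x, 0, 0], ![0, 0, 0]]

/-- The coefficients of the advection form, without the factor `-i m`. -/
noncomputable def advectionCoeff (m : ℤ) (Ωref : ℝ) (Ω : ℝ → ℝ) : Fin 3 → Fin 3 → ℝ → ℝ :=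
  fun i => ![fun x => (Ω x - Ωref) * Real.sin x * lapCoeff m i x, 0, 0]

/-- The coefficients of the wave form. -/
noncomputable def waveCoeff (r γ ω Ωref : ℝ) (m : ℤ) (Ω Ω₁ : ℝ → ℝ) (i j : Fin 3) (x : ℝ) : ℂ :=
  ((γ / r ^ 2 * Real.sin x * lapCoeff m i x * lapCoeff m j x : ℝ) : ℂ)
    - Complex.I * ω * (gradCoeff m i j x : ℝ) - Complex.I * m * (vorticityCoeff Ω Ω₁ i j x : ℝ)
    - Complex.I * m * (advectionCoeff m Ωref Ω i j x : ℝ)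

theorem lat_sin_pos (hε : 0 < ε) {x : ℝ} (hx : x ∈ Icc ε (Real.pi - ε)) : 0 < Real.sin x :=
  Real.sin_pos_of_mem_Ioo ⟨hε.trans_le hx.1, by linarith [hx.2]⟩

theorem continuousOn_lapCoeff (hε : 0 < ε) (m : ℤ) (i : Fin 3) :
    ContinuousOn (lapCoeff m i) (Icc ε (Real.pi - ε)) := by
  have h0 : ∀ x ∈ Icc ε (Real.pi - ε), Real.sin x ≠ 0 := fun x hx => (lat_sin_pos hε hx).ne'
  fin_cases i
  · exact (ContinuousOn.div (by fun_prop) (by fun_prop) fun x hx => pow_ne_zero 2 (h0 x hx)).neg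
  · exact ContinuousOn.div (by fun_prop) (by fun_prop) h0
  · exact continuousOn_const

theorem continuousOn_gradCoeff (hε : 0 < ε) (m : ℤ) (i j : Fin 3) :
    ContinuousOn (gradCoeff m i j) (Icc ε (Real.pi - ε)) := by
  have h0 : ∀ x ∈ Icc ε (Real.pi - ε), Real.sin x ≠ 0 := fun x hx => (lat_sin_pos hε hx).ne'
  fin_cases i <;> fin_cases j <;> simp only [gradCoeff] <;>
    first
    | exact continuousOn_const
    | exact Real.continuous_sin.continuousOn
    | exact ContinuousOn.div (by fun_prop) (by fun_prop) h0

theorem memLp_ofReal_of_continuousOn {f : ℝ → ℝ} {p : ℝ≥0∞}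
    (hf : ContinuousOn f (Icc ε (Real.pi - ε))) : MemLp (fun x => (f x : ℂ)) p (latMeasure ε) :=
  latMeasure_memLp_of_continuousOn (Complex.continuous_ofReal.comp_continuousOn hf)

theorem memLp_ofReal {f : ℝ → ℝ} {p : ℝ≥0∞} (hf : MemLp f p (latMeasure ε)) :
    MemLp (fun x => (f x : ℂ)) p (latMeasure ε) := hf.ofReal

theorem memLp_mul_continuousOn {f g : ℝ → ℝ} (hf : MemLp f 2 (latMeasure ε))
    (hg : ContinuousOn g (Icc ε (Real.pi - ε))) : MemLp (fun x => f x * g x) 2 (latMeasure ε) :=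
  (Clamped.memLp_of_continuousOn (p := ⊤) hg).mul hf

theorem memLp_vorticity {Ω Ω₁ : ℝ → ℝ} (hΩ : MemLp Ω 2 (latMeasure ε))
    (hΩ₁ : MemLp Ω₁ 2 (latMeasure ε)) :
    MemLp (fun x => Ω₁ x * Real.sin x + 2 * Ω x * Real.cos x) 2 (latMeasure ε) :=
  (memLp_mul_continuousOn hΩ₁ (by fun_prop)).add
    (memLp_mul_continuousOn (hΩ.const_mul 2) (by fun_prop))

theorem waveCoeff_admissible (hε : 0 < ε) (r γ ω Ωref : ℝ) (m : ℤ) {Ω Ω₁ : ℝ → ℝ}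
    (hΩ : MemLp Ω 2 (latMeasure ε)) (hΩ₁ : MemLp Ω₁ 2 (latMeasure ε)) :
    AdmissibleCoeff ε (waveCoeff r γ ω Ωref m Ω Ω₁) := by
  have hv : ∀ i j, MemLp (vorticityCoeff Ω Ω₁ i j) 2 (latMeasure ε) := by
    intro i j
    fin_cases i <;> fin_cases j <;> simp only [vorticityCoeff] <;>
      first
      | exact MemLp.zero
      | exact memLp_vorticity hΩ hΩ₁
  have ha : ∀ i j, MemLp (advectionCoeff m Ωref Ω i j) 2 (latMeasure ε) := by
    intro i j
    fin_cases j <;> simp only [advectionCoeff] <;>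
      first
      | exact MemLp.zero
      | exact memLp_mul_continuousOn (memLp_mul_continuousOn (hΩ.sub (memLp_const Ωref))
          (by fun_prop)) (continuousOn_lapCoeff hε m i)
  have hl : ∀ i j, ContinuousOn (fun x => γ / r ^ 2 * Real.sin x * lapCoeff m i x * lapCoeff m j x)
      (Icc ε (Real.pi - ε)) := fun i j =>
    (ContinuousOn.mul (by fun_prop) (continuousOn_lapCoeff hε m i)).mul
      (continuousOn_lapCoeff hε m j)
  refine ⟨fun i j => ?_, ?_⟩
  · exact (((memLp_ofReal_of_continuousOn (hl i j)).sub
      ((memLp_ofReal_of_continuousOn (continuousOn_gradCoeff hε m i j)).const_mul _)).sub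
      ((memLp_ofReal (hv i j)).const_mul _)).sub ((memLp_ofReal (ha i j)).const_mul _)
  · have : waveCoeff r γ ω Ωref m Ω Ω₁ 2 2
        = fun x => ((γ / r ^ 2 * Real.sin x * lapCoeff m 2 x * lapCoeff m 2 x : ℝ) : ℂ) := by
      ext x
      simp [waveCoeff, gradCoeff, vorticityCoeff, advectionCoeff]
    rw [this]
    exact memLp_ofReal_of_continuousOn (hl 2 2)

theorem lap_eq_sum (r : ℝ) (m : ℤ) (u : Fin 3 → ℝ → ℂ) (x : ℝ) :
    lap r m u x = (∑ i, (lapCoeff m i x : ℂ) * u i x) / (r : ℂ) ^ 2 := by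
  simp only [lap, Fin.sum_univ_three, lapCoeff, Matrix.cons_val_zero, Matrix.cons_val_one,
    Matrix.cons_val]
  push_cast
  ring

theorem memLp_lap (hε : 0 < ε) (r : ℝ) (m : ℤ) {k : ℕ} (u : sobolev ε (k + 2)) :
    MemLp (lap r m (jet u)) 2 (latMeasure ε) := by
  have h1 : MemLp (fun x => ((r : ℂ) ^ 2)⁻¹ * ∑ i, (lapCoeff m i x : ℂ) * jet u i x) 2
      (latMeasure ε) :=
    (memLp_finsetSum _ fun i _ => memLp_top_mul
      (memLp_ofReal_of_continuousOn (continuousOn_lapCoeff hε m i)) (jet_memLp u i)).const_mul _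
  refine h1.ae_eq (Eventually.of_forall fun x => ?_)
  simp only [lap_eq_sum]
  ring

/-- The orders of the two arguments are independent because the regularity statement pairs elements
of H⁴_0(I') with elements of H²_0(I'), in either position. -/
theorem waveForm_eq_coeffForm (hε : 0 < ε) (h : ε < Real.pi - ε) {r : ℝ} (hr : 0 < r)
    (γ ω Ωref : ℝ) (m : ℤ)
    {Ω Ω₁ : ℝ → ℝ} (hΩ : MemLp Ω 2 (latMeasure ε)) (hΩ₁ : MemLp Ω₁ 2 (latMeasure ε)) {k l : ℕ}
    (u : sobolev ε (k + 2)) (v : sobolev ε (l + 2)) :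
    waveForm r ε γ ω Ωref m Ω Ω₁ (jet u) (jet v)
      = coeffForm ε (waveCoeff r γ ω Ωref m Ω Ω₁) (jet u) (jet v) := by
  have hc := waveCoeff_admissible hε r γ ω Ωref m hΩ hΩ₁
  have hs0 : ∀ x ∈ Icc ε (Real.pi - ε), Real.sin x ≠ 0 := fun x hx => (lat_sin_pos hε hx).ne'
  have hw : MemLp (fun x => ((r ^ 2 * Real.sin x : ℝ) : ℂ)) ⊤ (latMeasure ε) :=
    memLp_ofReal_of_continuousOn (by fun_prop)
  have hu0 := jet_memLp_top h u (i := 0) (by decide)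
  have hv0 := jet_memLp_top h v (i := 0) (by decide)
  have hv1 := jet_memLp_top h v (i := 1) (by decide)
  have iA : Integrable (fun x => lap r m (jet u) x * conj (lap r m (jet v) x)
      * ((r ^ 2 * Real.sin x : ℝ) : ℂ)) (latMeasure ε) :=
    (integrable_mul_of_memLp (memLp_top_mul hw (memLp_lap hε r m u))
      (memLp_conj (memLp_lap hε r m v))).congr (Eventually.of_forall fun x => by simp only []; ring)
  have iB1 : Integrable (fun x => jet u 1 x / r * conj (jet v 1 x / r)
      * ((r ^ 2 * Real.sin x : ℝ) : ℂ)) (latMeasure ε) :=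
    ((integrable_mul_of_memLp (memLp_top_mul hw (jet_memLp u 1))
      (memLp_conj (jet_memLp v 1))).const_mul (1 / (r : ℂ) ^ 2)).congr
      (Eventually.of_forall fun x => by simp only [map_div₀, Complex.conj_ofReal]; ring)
  have hw' : MemLp (fun x => ((1 / (r * Real.sin x) ^ 2 : ℝ) : ℂ)) ⊤ (latMeasure ε) :=
    memLp_ofReal_of_continuousOn (ContinuousOn.div (by fun_prop) (by fun_prop) fun x hx =>
      pow_ne_zero 2 (mul_ne_zero hr.ne' (hs0 x hx)))
  have iB2 : Integrable (fun x => Complex.I * m * jet u 0 x / (r * Real.sin x : ℝ)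
      * conj (Complex.I * m * jet v 0 x / (r * Real.sin x : ℝ))
      * ((r ^ 2 * Real.sin x : ℝ) : ℂ)) (latMeasure ε) :=
    ((integrable_mul_of_memLp (memLp_top_mul hw (jet_memLp u 0))
      (memLp_top_mul hw' (memLp_conj (jet_memLp v 0)))).const_mul ((m : ℂ) ^ 2)).congr
      (Eventually.of_forall fun x => by
        simp only [map_div₀, map_mul, Complex.conj_ofReal, Complex.conj_I, map_intCast]
        push_cast
        linear_combination ((m : ℂ) ^ 2 * jet u 0 x * conj (jet v 0 x) * r ^ 2 * Complex.sin x
          / (r * Complex.sin x) ^ 2) * Complex.I_sq)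
  have hα : MemLp (fun x => ((Ω₁ x * Real.sin x + 2 * Ω x * Real.cos x : ℝ) : ℂ)) 2
      (latMeasure ε) := memLp_ofReal (memLp_vorticity hΩ hΩ₁)
  have iC : Integrable (fun x => ((Ω₁ x * Real.sin x + 2 * Ω x * Real.cos x : ℝ) : ℂ)
      * (jet u 1 x * conj (jet v 0 x) + jet u 0 x * conj (jet v 1 x))) (latMeasure ε) :=
    integrable_mul_of_memLp hα ((memLp_mul_top (jet_memLp u 1) (memLp_conj hv0)).add
      (memLp_mul_top (jet_memLp u 0) (memLp_conj hv1)))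
  have hβ : MemLp (fun x => ((Ω x - Ωref : ℝ) : ℂ)) 2 (latMeasure ε) :=
    memLp_ofReal (hΩ.sub (memLp_const Ωref))
  have iD : Integrable (fun x => ((Ω x - Ωref : ℝ) : ℂ) * lap r m (jet u) x * conj (jet v 0 x)
      * ((r ^ 2 * Real.sin x : ℝ) : ℂ)) (latMeasure ε) :=
    (integrable_mul_of_memLp (memLp_mul_top hβ (memLp_conj hv0))
      (memLp_top_mul hw (memLp_lap hε r m u))).congr
      (Eventually.of_forall fun x => by simp only []; ring)
  have eL : waveForm r ε γ ω Ωref m Ω Ω₁ (jet u) (jet v) = ∫ x, ((γ : ℂ) *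
      (lap r m (jet u) x * conj (lap r m (jet v) x) * ((r ^ 2 * Real.sin x : ℝ) : ℂ))
      - Complex.I * ω * (jet u 1 x / r * conj (jet v 1 x / r) * ((r ^ 2 * Real.sin x : ℝ) : ℂ)
        + Complex.I * m * jet u 0 x / (r * Real.sin x : ℝ)
          * conj (Complex.I * m * jet v 0 x / (r * Real.sin x : ℝ))
          * ((r ^ 2 * Real.sin x : ℝ) : ℂ))
      + -(Complex.I * m) * (((Ω₁ x * Real.sin x + 2 * Ω x * Real.cos x : ℝ) : ℂ)
      * (jet u 1 x * conj (jet v 0 x) + jet u 0 x * conj (jet v 1 x)))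
      - Complex.I * m * (((Ω x - Ωref : ℝ) : ℂ) * lap r m (jet u) x * conj (jet v 0 x)
      * ((r ^ 2 * Real.sin x : ℝ) : ℂ))) ∂(latMeasure ε) := by
    have iB := (iB1.fun_add iB2).const_mul (Complex.I * ω)
    have iAB := (iA.const_mul (γ : ℂ)).sub iB
    have iABC := iAB.add (iC.const_mul (-(Complex.I * m)))
    refine Eq.trans ?_ (integral_sub iABC (iD.const_mul (Complex.I * m))).symm
    refine Eq.trans ?_ (congrArg₂ _ (integral_add iAB (iC.const_mul _)).symm rfl)
    refine Eq.trans ?_ (congrArg₂ _ (congrArg₂ _ (integral_sub (iA.const_mul _) iB).symm rfl) rfl)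
    rw [integral_const_mul, integral_const_mul, integral_const_mul, integral_const_mul,
      integral_add iB1 iB2]
    rfl
  rw [eL, coeffForm]
  simp only [← integral_finsetSum _ fun j _ => hc.integrable h u v _ j]
  rw [← integral_finsetSum _ fun i _ => integrable_finsetSum _ fun j _ => hc.integrable h u v i j]
  refine setIntegral_congr_fun measurableSet_Ioo fun x hx => ?_
  have hs := hs0 x (Ioo_subset_Icc_self hx)
  have hsC : Complex.sin x ≠ 0 := by
    rw [← Complex.ofReal_sin]; exact_mod_cast hs
  have hrC : (r : ℂ) ≠ 0 := by exact_mod_cast hr.ne'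
  simp only [Fin.sum_univ_three, waveCoeff, lapCoeff, gradCoeff, vorticityCoeff, advectionCoeff,
    lap, Matrix.cons_val_zero, Matrix.cons_val_one, Matrix.cons_val, Pi.zero_apply, map_div₀,
    map_mul, map_sub, map_add, map_pow, Complex.conj_ofReal, Complex.conj_I, map_intCast]
  push_cast
  have hI := Complex.I_sq
  field_simp
  simp only [hI]
  ring

end Form

/-! ### Coercivity of the wave form -/

section Coercive

variable {ε : ℝ}

theorem ZonalL2.integrableOn (hε : 0 < ε) {f : ℝ → ℝ} (hf : ZonalL2 f) :
    IntegrableOn (fun x => f x ^ 2 * Real.sin x) (Ioo ε (Real.pi - ε)) :=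
  hf.2.mono_set (Ioo_subset_Ioo hε.le (by linarith))

theorem ZonalL2.integral_le (hε : 0 < ε) {f : ℝ → ℝ} (hf : ZonalL2 f) :
    ∫ x in Ioo ε (Real.pi - ε), Real.sin x * f x ^ 2 ≤ ∫ x in Ioo 0 Real.pi, f x ^ 2 * Real.sin x := by
  simp only [mul_comm (Real.sin _)]
  refine setIntegral_mono_set hf.2 ?_ (Ioo_subset_Ioo hε.le (by linarith)).eventuallyLE
  filter_upwards [ae_restrict_mem measurableSet_Ioo] with x hx
  have := Real.sin_pos_of_mem_Ioo hx
  positivity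

theorem sin_le_sin_of_mem_lat (hε : 0 < ε) {x : ℝ} (hx : x ∈ Ioo ε (Real.pi - ε)) :
    Real.sin ε ≤ Real.sin x := by
  rcases le_total x (Real.pi / 2) with h1 | h1
  · exact Real.sin_le_sin_of_le_of_le_pi_div_two (by linarith [Real.pi_pos]) h1 hx.1.le
  · rw [← Real.sin_pi_sub x]
    exact Real.sin_le_sin_of_le_of_le_pi_div_two (by linarith [Real.pi_pos]) (by linarith)
      (by linarith [hx.2])

theorem ZonalL2.memLp (hε : 0 < ε) (h : ε < Real.pi - ε) {f : ℝ → ℝ} (hf : ZonalL2 f) :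
    MemLp f 2 (latMeasure ε) := by
  have hs : Ioo ε (Real.pi - ε) ⊆ Ioo 0 Real.pi := Ioo_subset_Ioo hε.le (by linarith)
  have hm : AEStronglyMeasurable f (latMeasure ε) := hf.1.mono_measure (Measure.restrict_mono_set _ hs)
  have hσ : 0 < Real.sin ε := Real.sin_pos_of_mem_Ioo ⟨hε, by linarith⟩
  refine (memLp_two_iff_integrable_sq hm).2 ?_
  refine Integrable.mono' ((hf.integrableOn hε).const_mul (1 / Real.sin ε)) (hm.pow 2) ?_
  filter_upwards [ae_restrict_mem measurableSet_Ioo] with x hx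
  rw [Real.norm_of_nonneg (sq_nonneg _), one_div, inv_mul_eq_div, le_div_iff₀ hσ]
  gcongr
  exact sin_le_sin_of_mem_lat hε hx

theorem ZonalH1.exists_acDeriv (hε : 0 < ε) (h : ε < Real.pi - ε) {Ω Ω₁ : ℝ → ℝ}
    (hΩ : ZonalH1 Ω Ω₁) :
    ∃ O, ACDeriv ε (Real.pi - ε) O Ω₁ ∧ Ω =ᵐ[latMeasure ε] O :=
  (hΩ.weakDeriv.mono hε.le (by linarith)).exists_acDeriv h
    ((hΩ.memL2.memLp hε h).integrable one_le_two) ((hΩ.deriv_memL2.memLp hε h).integrable one_le_two)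

theorem ZonalL2.sub_const {f : ℝ → ℝ} (hf : ZonalL2 f) (c : ℝ) : ZonalL2 fun x => f x - c := by
  refine ⟨hf.1.sub aestronglyMeasurable_const, ?_⟩
  have hi : IntegrableOn (fun x => 2 * (f x ^ 2 * Real.sin x) + 2 * c ^ 2 * Real.sin x)
      (Ioo 0 Real.pi) :=
    (hf.2.const_mul 2).add (Clamped.integrableOn_of_continuousOn (by fun_prop))
  refine Integrable.mono' hi (((hf.1.sub aestronglyMeasurable_const).pow 2).mul
    Real.continuous_sin.aestronglyMeasurable) ?_
  filter_upwards [ae_restrict_mem measurableSet_Ioo] with x hx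
  have := Real.sin_pos_of_mem_Ioo hx
  rw [Real.norm_of_nonneg (by positivity)]
  nlinarith [mul_nonneg (sq_nonneg (f x + c)) this.le]

variable {y₀ y₁ y₂ : ℝ → ℂ} {u : Fin 3 → ℝ → ℂ} {r : ℝ} {m : ℤ}

theorem lap_eq_unitLap (h0 : u 0 =ᵐ[latMeasure ε] y₀) (h1 : u 1 =ᵐ[latMeasure ε] y₁) :
    lap r m u =ᵐ[latMeasure ε] fun x => unitLap |(m : ℝ)| y₀ y₁ (u 2) x / (r : ℂ) ^ 2 := by
  filter_upwards [h0, h1] with x e0 e1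
  rw [lap, unitLap, e0, e1, sq_abs]

theorem pairing_lap_lap (hr : 0 < r) (h0 : u 0 =ᵐ[latMeasure ε] y₀)
    (h1 : u 1 =ᵐ[latMeasure ε] y₁) :
    pairing r ε (lap r m u) (lap r m u)
      = ((lapEnergy ε (Real.pi - ε) |(m : ℝ)| y₀ y₁ (u 2) / r ^ 2 : ℝ) : ℂ) := by
  rw [pairing, lapEnergy, ← integral_div, ← integral_complex_ofReal]
  refine integral_congr_ae ?_
  filter_upwards [lap_eq_unitLap (r := r) (m := m) h0 h1] with x hx
  have hrC : (r : ℂ) ≠ 0 := by exact_mod_cast hr.ne'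
  simp only [hx, map_div₀, map_pow, Complex.conj_ofReal]
  push_cast
  rw [← Complex.mul_conj']
  field_simp

theorem gradPairing_self (hr : 0 < r) (hc : Clamped ε (Real.pi - ε) y₀ y₁ y₂)
    (h0 : u 0 =ᵐ[latMeasure ε] y₀) (h1 : u 1 =ᵐ[latMeasure ε] y₁) :
    gradPairing r ε m u u = ((gradEnergy ε (Real.pi - ε) |(m : ℝ)| y₀ y₁ : ℝ) : ℂ) := by
  have hrC : (r : ℂ) ≠ 0 := by exact_mod_cast hr.ne'
  rw [gradPairing, gradEnergy, Complex.ofReal_add, Complex.ofReal_mul]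
  congr 1
  · rw [pairing, massEnergy, ← integral_complex_ofReal]
    refine integral_congr_ae ?_
    filter_upwards [h1] with x hx
    simp only [hx, map_div₀, Complex.conj_ofReal]
    push_cast
    rw [← Complex.mul_conj']
    field_simp
  · rw [pairing, angularEnergy, ← integral_complex_ofReal, ← integral_const_mul]
    refine integral_congr_ae ?_
    filter_upwards [h0, ae_restrict_mem measurableSet_Ioo] with x hx hxI
    have hs : (Real.sin x : ℂ) ≠ 0 := by
      exact_mod_cast (hc.sin_pos (Ioo_subset_Icc_self hxI)).ne'
    simp only [hx, map_div₀, map_mul, Complex.conj_ofReal, Complex.conj_I, map_intCast, sq_abs]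
    push_cast [-Complex.ofReal_sin]
    rw [← Complex.mul_conj']
    field_simp
    linear_combination (-(m : ℂ) ^ 2 * y₀ x * conj (y₀ x)) * Complex.I_sq

theorem alphaForm_self {Ω O Ω₁ : ℝ → ℝ} (hO : Ω =ᵐ[latMeasure ε] O)
    (h0 : u 0 =ᵐ[latMeasure ε] y₀) (h1 : u 1 =ᵐ[latMeasure ε] y₁) :
    alphaForm ε m Ω Ω₁ u u = -(Complex.I * m) * ((∫ x in Ioo ε (Real.pi - ε),
      (Ω₁ x * Real.sin x + 2 * O x * Real.cos x)
        * (2 * ((y₁ x).re * (y₀ x).re + (y₁ x).im * (y₀ x).im)) : ℝ) : ℂ) := by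
  rw [alphaForm, ← integral_complex_ofReal]
  congr 1
  refine integral_congr_ae ?_
  filter_upwards [h0, h1, hO] with x e0 e1 e2
  simp only [e0, e1, e2]
  rw [Complex.ofReal_mul]
  congr 1
  apply Complex.ext <;> simp <;> ring

/-- `∫ β L conj(y₀) sin`. -/
noncomputable def advectionIntegral (a b μ : ℝ) (β : ℝ → ℝ) (y₀ y₁ y₂ : ℝ → ℂ) : ℂ :=
  ∫ x in Ioo a b, ((Real.sin x * β x : ℝ) : ℂ) * (unitLap μ y₀ y₁ y₂ x * conj (y₀ x))

theorem pairing_advection (hr : 0 < r) {Ω O : ℝ → ℝ} (Ωref : ℝ) (hO : Ω =ᵐ[latMeasure ε] O)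
    (h0 : u 0 =ᵐ[latMeasure ε] y₀) (h1 : u 1 =ᵐ[latMeasure ε] y₁) :
    pairing r ε (fun θ => ((Ω θ - Ωref : ℝ) : ℂ) * lap r m u θ) (u 0)
      = advectionIntegral ε (Real.pi - ε) |(m : ℝ)| (fun x => O x - Ωref) y₀ y₁ (u 2) := by
  rw [pairing, advectionIntegral]
  refine integral_congr_ae ?_
  filter_upwards [h0, hO, lap_eq_unitLap (r := r) (m := m) h0 h1] with x e0 e2 e3
  have hrC : (r : ℂ) ≠ 0 := by exact_mod_cast hr.ne'
  simp only [e0, e2, e3]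
  push_cast
  field_simp

theorem integrable_advection {a b μ : ℝ} (hc : Clamped a b y₀ y₁ y₂) {β : ℝ → ℝ}
    (hβ : ContinuousOn β (Icc a b)) :
    IntegrableOn (fun x => ((Real.sin x * β x : ℝ) : ℂ) * (unitLap μ y₀ y₁ y₂ x * conj (y₀ x)))
      (Ioo a b) := by
  have h1 : MemLp (fun x => (((Real.sin x * β x : ℝ) : ℂ) * conj (y₀ x)) * unitLap μ y₀ y₁ y₂ x) 2
      (volume.restrict (Ioo a b)) := by
    refine Clamped.memLp_continuousOn_mul ?_ hc.memLp_unitLap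
    exact (Complex.continuous_ofReal.comp_continuousOn (ContinuousOn.mul (by fun_prop) hβ)).mul
      (Complex.continuous_conj.comp_continuousOn hc.continuousOn₀)
  have : IsFiniteMeasure (volume.restrict (Ioo a b)) := ⟨by simp⟩
  exact (h1.integrable one_le_two).congr (Eventually.of_forall fun x => by simp only []; ring)

theorem norm_advectionIntegral_le {a b μ : ℝ} (hc : Clamped a b y₀ y₁ y₂) (β : ℝ → ℝ) :
    ‖advectionIntegral a b μ β y₀ y₁ y₂‖
      ≤ ∫ x in Ioo a b, Real.sin x * (‖(β x : ℂ)‖ * (‖unitLap μ y₀ y₁ y₂ x‖ * ‖y₀ x‖)) := by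
  refine (norm_integral_le_integral_norm _).trans (le_of_eq ?_)
  refine setIntegral_congr_fun measurableSet_Ioo fun x hx => ?_
  have := hc.sin_pos (Ioo_subset_Icc_self hx)
  simp only [norm_mul, RCLike.norm_conj, Complex.ofReal_mul, Complex.norm_real,
    Real.norm_of_nonneg this.le]
  ring

theorem advectionIntegral_im {a b μ : ℝ} (hc : Clamped a b y₀ y₁ y₂) {β : ℝ → ℝ}
    (hβ : ContinuousOn β (Icc a b)) :
    (advectionIntegral a b μ β y₀ y₁ y₂).im = ∫ x in Ioo a b, Real.sin x * (β x *
      ((unitLap μ y₀ y₁ y₂ x).im * (y₀ x).re - (unitLap μ y₀ y₁ y₂ x).re * (y₀ x).im)) := by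
  rw [advectionIntegral, ← Complex.imCLM_apply,
    ← Complex.imCLM.integral_comp_comm (integrable_advection hc hβ)]
  refine integral_congr_ae (Eventually.of_forall fun x => ?_)
  beta_reduce
  rw [Complex.imCLM_apply, Complex.im_ofReal_mul, Complex.mul_im, Complex.conj_re,
    Complex.conj_im]
  ring

/-- On the diagonal the two energies are real and the vorticity integral is real up to the factor
-im, so the advection integral is the only term contributing to both parts. -/
theorem waveForm_self (hr : 0 < r) (hc : Clamped ε (Real.pi - ε) y₀ y₁ (u 2)) (γ ω Ωref : ℝ)
    {Ω O Ω₁ : ℝ → ℝ} (hO : Ω =ᵐ[latMeasure ε] O)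
    (h0 : u 0 =ᵐ[latMeasure ε] y₀) (h1 : u 1 =ᵐ[latMeasure ε] y₁) :
    (waveForm r ε γ ω Ωref m Ω Ω₁ u u).re
        = γ / r ^ 2 * lapEnergy ε (Real.pi - ε) |(m : ℝ)| y₀ y₁ (u 2)
          + m * (advectionIntegral ε (Real.pi - ε) |(m : ℝ)| (fun x => O x - Ωref) y₀ y₁ (u 2)).im ∧
      (waveForm r ε γ ω Ωref m Ω Ω₁ u u).im
        = -(ω * gradEnergy ε (Real.pi - ε) |(m : ℝ)| y₀ y₁)
          - m * (∫ x in Ioo ε (Real.pi - ε), (Ω₁ x * Real.sin x + 2 * O x * Real.cos x)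
            * (2 * ((y₁ x).re * (y₀ x).re + (y₁ x).im * (y₀ x).im)))
          - m * (advectionIntegral ε (Real.pi - ε) |(m : ℝ)| (fun x => O x - Ωref)
            y₀ y₁ (u 2)).re := by
  rw [waveForm, pairing_lap_lap hr h0 h1, gradPairing_self hr hc h0 h1, alphaForm_self hO h0 h1,
    pairing_advection hr Ωref hO h0 h1]
  generalize lapEnergy ε (Real.pi - ε) |(m : ℝ)| y₀ y₁ (u 2) = X
  generalize gradEnergy ε (Real.pi - ε) |(m : ℝ)| y₀ y₁ = G
  generalize advectionIntegral ε (Real.pi - ε) |(m : ℝ)| (fun x => O x - Ωref) y₀ y₁ (u 2) = Z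
  generalize (∫ x in Ioo ε (Real.pi - ε), (Ω₁ x * Real.sin x + 2 * O x * Real.cos x)
            * (2 * ((y₁ x).re * (y₀ x).re + (y₁ x).im * (y₀ x).im))) = T
  have hm : (m : ℂ) = ((m : ℝ) : ℂ) := by simp
  rw [hm]
  constructor
  · simp only [Complex.sub_re, Complex.add_re, Complex.mul_re, Complex.mul_im, Complex.ofReal_re,
      Complex.ofReal_im, Complex.I_re, Complex.I_im, Complex.neg_re, Complex.neg_im]
    ring
  · simp only [Complex.sub_im, Complex.add_im, Complex.mul_re, Complex.mul_im, Complex.ofReal_re,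
      Complex.ofReal_im, Complex.I_re, Complex.I_im, Complex.neg_re, Complex.neg_im]
    ring

/-- Integrality of m enters the coercivity estimate only here, to supply the dichotomy of
`Clamped.integral_twist_le`. -/
theorem abs_intCast_eq_one_or {m : ℤ} (hm : m ≠ 0) : |(m : ℝ)| = 1 ∨ 2 ≤ |(m : ℝ)| := by
  have h : |m| = 1 ∨ 2 ≤ |m| := by
    have := Int.one_le_abs hm
    omega
  rcases h with h | h
  · left; exact_mod_cast h
  · right; exact_mod_cast h

/-- The wave form is bounded below by the energy of the Laplacian. -/
theorem exists_lapEnergy_le_norm_waveForm (hε : 0 < ε) (h : ε < Real.pi - ε) (hr : 0 < r) {γ ω Ωref : ℝ}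
    (hγ : 0 < γ) (m : ℤ) {Ω Ω₁ : ℝ → ℝ} (hΩ : ZonalH1 Ω Ω₁)
    (hcond : LargeFrequency r γ ω Ωref Ω Ω₁ ∨ SmallShear r γ m Ω₁) :
    ∃ c, 0 < c ∧ ∀ (u : Fin 3 → ℝ → ℂ) (y₀ y₁ : ℝ → ℂ), Clamped ε (Real.pi - ε) y₀ y₁ (u 2) →
      u 0 =ᵐ[latMeasure ε] y₀ → u 1 =ᵐ[latMeasure ε] y₁ →
      c * lapEnergy ε (Real.pi - ε) |(m : ℝ)| y₀ y₁ (u 2)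
        ≤ ‖waveForm r ε γ ω Ωref m Ω Ω₁ u u‖ := by
  obtain ⟨O, hOac, hO⟩ := hΩ.exists_acDeriv hε h
  have hOc : ContinuousOn (fun x => O x - Ωref) (Icc ε (Real.pi - ε)) :=
    (hOac.continuousOn h.le).sub continuousOn_const
  -- Advection and vorticity carry a factor m, so for m = 0 the real part alone is coercive,
  -- whatever ω is.
  by_cases hm : m = 0
  · subst hm
    refine ⟨γ / r ^ 2, by positivity, fun u y₀ y₁ hc h0 h1 => ?_⟩
    have e := (waveForm_self (m := 0) hr hc γ ω Ωref (Ω₁ := Ω₁) hO h0 h1).1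
    simp only [Int.cast_zero, zero_mul, add_zero] at e
    refine le_trans (le_of_eq ?_) (Complex.re_le_norm _)
    rw [e]
    simp
  have hμ := abs_intCast_eq_one_or hm
  have hμ1 : 1 ≤ |(m : ℝ)| := by rcases hμ with h | h <;> linarith
  set Jb := ∫ θ in Ioo 0 Real.pi, (Ω θ - Ωref) ^ 2 * Real.sin θ with hJb
  set Jw := ∫ θ in Ioo 0 Real.pi, Ω θ ^ 2 * Real.sin θ with hJw
  set Js := ∫ θ in Ioo 0 Real.pi, Ω₁ θ ^ 2 * Real.sin θ with hJs
  rcases hcond with hcond | hcond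
  · have hlt := hcond.lt hr hγ
    rw [← hJb, ← hJw] at hlt
    have hJb0 : 0 ≤ Jb := integral_sq_mul_sin_nonneg _
    have hJw0 : 0 ≤ Jw := integral_sq_mul_sin_nonneg _
    have hn := largeFrequency_numerics (Real.sqrt_nonneg Jb) (Real.sqrt_nonneg Jw)
    rw [Real.sq_sqrt hJb0, Real.sq_sqrt hJw0] at hn
    have hb0 := Real.sqrt_nonneg Jb
    have hw0 := Real.sqrt_nonneg Jw
    -- The real part contains only the advection term, hence `κ₀`; the imaginary part contains
    -- advection and vorticity, hence `κ`. The factor r⁶ comes from the cube of `g`.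
    obtain ⟨c, hc0, H⟩ := exists_pos_mul_pow_four_le (g := γ / r ^ 2) (w := |ω|)
      (κ₀ := 7072 / 10000 * √Jb) (κ := 7072 / 10000 * √Jb + 648 / 100 * √Jw) (by positivity)
      (abs_nonneg _) (by positivity) (by linarith) (by
        rw [div_pow, ← mul_div_assoc, lt_div_iff₀ (by positivity)]
        calc _ ≤ 87 / 200 * (Jb + 9 * Jw) ^ 2 * (r ^ 2) ^ 3 := by gcongr
          _ = 87 / 200 * (Jb + 9 * Jw) ^ 2 * r ^ 6 := by ring
          _ < _ := hlt)
    refine ⟨c, hc0, fun u y₀ y₁ hc h0 h1 => ?_⟩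
    obtain ⟨e1, e2⟩ := waveForm_self (m := m) hr hc γ ω Ωref (Ω₁ := Ω₁) hO h0 h1
    have hX := hc.lapEnergy_nonneg (μ := |(m : ℝ)|)
    have hG := hc.gradEnergy_nonneg (μ := |(m : ℝ)|)
    have hroot : ∀ x : ℝ, 0 ≤ x → √(√x) ^ 4 = x := fun x hx => by
      rw [show √(√x) ^ 4 = (√(√x) ^ 2) ^ 2 by ring, Real.sq_sqrt (Real.sqrt_nonneg _),
        Real.sq_sqrt hx]
    set X := lapEnergy ε (Real.pi - ε) |(m : ℝ)| y₀ y₁ (u 2) with hXdef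
    set G := gradEnergy ε (Real.pi - ε) |(m : ℝ)| y₀ y₁ with hGdef
    set Z := advectionIntegral ε (Real.pi - ε) |(m : ℝ)| (fun x => O x - Ωref) y₀ y₁ (u 2) with hZ
    set T := (∫ x in Ioo ε (Real.pi - ε), (Ω₁ x * Real.sin x + 2 * O x * Real.cos x)
            * (2 * ((y₁ x).re * (y₀ x).re + (y₁ x).im * (y₀ x).im))) with hT
    have hp0 := Real.sqrt_nonneg (√X)
    have hq0 := Real.sqrt_nonneg (√G)
    have hA := hc.norm_integral_advection_le (abs_nonneg _) ((hroot X hX).trans hXdef)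
      ((hroot G hG).trans hGdef) hp0 hq0 hOc
    have hV := hc.abs_integral_vorticity_le hμ ((hroot X hX).trans hXdef)
      ((hroot G hG).trans hGdef) hp0 hq0 hOac
    have hZn := norm_advectionIntegral_le (μ := |(m : ℝ)|) hc (fun x => O x - Ωref)
    rw [← hZ] at hZn
    rw [← hT] at hV
    have cb : ∫ x in Ioo ε (Real.pi - ε), Real.sin x * (O x - Ωref) ^ 2 ≤ Jb := by
      refine le_trans (le_of_eq (integral_congr_ae ?_)) ((hΩ.memL2.sub_const Ωref).integral_le hε)
      filter_upwards [hO] with x hx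
      rw [hx]
    have cw : ∫ x in Ioo ε (Real.pi - ε), Real.sin x * O x ^ 2 ≤ Jw := by
      refine le_trans (le_of_eq (integral_congr_ae ?_)) (hΩ.memL2.integral_le hε)
      filter_upwards [hO] with x hx
      rw [hx]
    have hpq : 0 ≤ √(√X) ^ 3 * √(√G) := by positivity
    have hZ1 : |(m : ℝ)| * ‖Z‖ ≤ 7072 / 10000 * √Jb * (√(√X) ^ 3 * √(√G)) := by
      refine (mul_le_mul_of_nonneg_left hZn (abs_nonneg _)).trans (hA.trans ?_)
      gcongr
    have hV1 : |(m : ℝ)| * |T| ≤ 648 / 100 * √Jw * (√(√X) ^ 3 * √(√G)) := by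
      refine hV.trans ?_
      gcongr
    have k1 : |(m : ℝ) * Z.im| ≤ |(m : ℝ)| * ‖Z‖ := by
      rw [abs_mul]; gcongr; exact Complex.abs_im_le_norm Z
    have k2 : |(m : ℝ) * Z.re| ≤ |(m : ℝ)| * ‖Z‖ := by
      rw [abs_mul]; gcongr; exact Complex.abs_re_le_norm Z
    have k3 : |(m : ℝ) * T| = |(m : ℝ)| * |T| := abs_mul _ _
    have fin := H (√(√X)) (√(√G)) ‖waveForm r ε γ ω Ωref m Ω Ω₁ u u‖ hp0 hq0
    rw [hroot X hX, hroot G hG] at fin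
    refine fin ?_ ?_
    · refine le_trans ?_ (Complex.re_le_norm _)
      rw [e1]
      linarith [neg_abs_le ((m : ℝ) * Z.im)]
    · refine le_trans ?_ (Complex.abs_im_le_norm _)
      rw [e2]
      have k4 : |ω| * G = |ω * G| := by rw [abs_mul, abs_of_nonneg hG]
      have k5 : |ω * G| - |(m : ℝ) * T| - |(m : ℝ) * Z.re|
          ≤ |-(ω * G) - (m : ℝ) * T - (m : ℝ) * Z.re| := by
        have e : -(ω * G) - (m : ℝ) * T - (m : ℝ) * Z.re
          = -(ω * G + (m : ℝ) * T + (m : ℝ) * Z.re) := by ring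
        rw [e, abs_neg]
        have a1 := abs_sub (ω * G + (m : ℝ) * T + (m : ℝ) * Z.re) ((m : ℝ) * Z.re)
        have a2 := abs_sub (ω * G + (m : ℝ) * T) ((m : ℝ) * T)
        rw [add_sub_cancel_right] at a1 a2
        linarith
      rw [k4]
      refine le_trans ?_ k5
      rw [k3]
      linarith
  · have hlt := hcond.lt hr hγ
    rw [← hJs] at hlt
    -- The constant 0.287 of the shear estimate is below the 27/80 guaranteed by the small shear
    -- condition.
    have hd : 0 < γ / r ^ 2 - 287 / 1000 * (|(m : ℝ)| * √Js) := by
      have h1 : 287 / 1000 * (|(m : ℝ)| * √Js) < γ / r ^ 2 := by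
        rw [lt_div_iff₀ (by positivity)]
        have h2 : 0 ≤ |(m : ℝ)| * √Js := by positivity
        have h3 : 287 / 1000 * (|(m : ℝ)| * √Js) ≤ 27 / 80 * (|(m : ℝ)| * √Js) := by linarith
        exact (mul_le_mul_of_nonneg_right h3 (sq_nonneg r)).trans_lt hlt
      linarith
    refine ⟨_, hd, fun u y₀ y₁ hc h0 h1 => ?_⟩
    have e1 := (waveForm_self (m := m) hr hc γ ω Ωref (Ω₁ := Ω₁) hO h0 h1).1
    have hX := hc.lapEnergy_nonneg (μ := |(m : ℝ)|)
    have hS := hc.abs_integral_shear_le hμ1 hOac Ωref (hΩ.deriv_memL2.memLp hε h)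
    rw [← advectionIntegral_im hc hOc] at hS
    refine le_trans ?_ (Complex.re_le_norm _)
    rw [e1]
    set X := lapEnergy ε (Real.pi - ε) |(m : ℝ)| y₀ y₁ (u 2) with hXdef
    set Z := advectionIntegral ε (Real.pi - ε) |(m : ℝ)| (fun x => O x - Ωref) y₀ y₁ (u 2) with hZ
    have k1 : |(m : ℝ) * Z.im| ≤ |(m : ℝ)| * (287 / 1000 * √Js * X) := by
      rw [abs_mul]
      gcongr
      refine hS.trans ?_
      gcongr
      exact hΩ.deriv_memL2.integral_le hε
    have := neg_abs_le ((m : ℝ) * Z.im)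
    linarith

theorem waveForm_coercive (hε : 0 < ε) (h : ε < Real.pi - ε) (hr : 0 < r) {γ ω Ωref : ℝ}
    (hγ : 0 < γ) (m : ℤ) {Ω Ω₁ : ℝ → ℝ} (hΩ : ZonalH1 Ω Ω₁)
    (hcond : LargeFrequency r γ ω Ωref Ω Ω₁ ∨ SmallShear r γ m Ω₁) :
    ∃ c, 0 < c ∧ ∀ u : sobolev₀ ε 2,
      c * ‖u‖ ^ 2 ≤ ‖waveForm r ε γ ω Ωref m Ω Ω₁ (jet u.1) (jet u.1)‖ := by
  obtain ⟨c, hc, H⟩ := exists_lapEnergy_le_norm_waveForm hε h hr hγ m hΩ hcond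
  obtain ⟨C, hC, H'⟩ := exists_norm_sq_le_lapEnergy hε h
  refine ⟨c / C, by positivity, fun u => ?_⟩
  obtain ⟨y₀, y₁, hy, h0, h1⟩ := sobolev₀_exists_clamped hε h u
  refine le_trans ?_ (H (jet u.1) y₀ y₁ hy h0 h1)
  rw [div_mul_eq_mul_div, div_le_iff₀ hC, mul_assoc, mul_comm _ C]
  exact mul_le_mul_of_nonneg_left (H' _ u y₀ y₁ hy h0 h1) hc.le

end Coercive

/-! ### The Lax-Milgram theorem -/

section LaxMilgram

variable {V : Type*} [NormedAddCommGroup V] [InnerProductSpace ℂ V] [CompleteSpace V]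

theorem exists_riesz (l : V →L⋆[ℂ] ℂ) : ∃ v : V, ∀ w, inner ℂ w v = l w := by
  let l' : V →L[ℂ] ℂ :=
    { toFun := fun w => conj (l w)
      map_add' := fun x y => by simp
      map_smul' := fun c x => by simp
      cont := Complex.continuous_conj.comp l.continuous }
  refine ⟨(InnerProductSpace.toDual ℂ V).symm l', fun w => ?_⟩
  rw [← inner_conj_symm, InnerProductSpace.toDual_symm_apply]
  exact Complex.conj_conj _

/-- A bounded sesquilinear form whose diagonal is bounded below by the square of the norm defines
an isomorphism onto the antidual space. -/
theorem exists_equiv_of_le_norm (B : V →L[ℂ] (V →L⋆[ℂ] ℂ)) {c : ℝ} (hc : 0 < c)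
    (h : ∀ v, c * ‖v‖ ^ 2 ≤ ‖B v v‖) :
    ∃ e : V ≃L[ℂ] (V →L⋆[ℂ] ℂ), ∀ v, e v = B v := by
  have bound : ∀ v, c * ‖v‖ ≤ ‖B v‖ := by
    intro v
    rcases (norm_nonneg v).eq_or_lt with h0 | h0
    · rw [← h0]; simp
    · refine le_of_mul_le_mul_right ?_ h0
      calc c * ‖v‖ * ‖v‖ = c * ‖v‖ ^ 2 := by ring
        _ ≤ ‖B v v‖ := h v
        _ ≤ ‖B v‖ * ‖v‖ := (B v).le_opNorm v
  have anti : AntilipschitzWith (Real.toNNReal c⁻¹) B := by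
    refine ContinuousLinearMap.antilipschitz_of_bound B fun v => ?_
    rw [Real.coe_toNNReal _ (by positivity), ← div_eq_inv_mul, le_div_iff₀ hc, mul_comm]
    exact bound v
  let ι : V →L[ℂ] (V →L⋆[ℂ] ℂ) := (innerSL ℂ).flip
  have hι : ∀ v w, ι v w = inner ℂ w v := fun v w => rfl
  let e₀ : V ≃L[ℂ] (V →L⋆[ℂ] ℂ) := ContinuousLinearEquiv.ofBijective ι
    (LinearMap.ker_eq_bot'.2 fun v hv => by
      have : ι v v = 0 := by
        change (ι : V →ₗ[ℂ] (V →L⋆[ℂ] ℂ)) v v = 0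
        rw [hv]; rfl
      rwa [hι, inner_self_eq_zero] at this)
    (LinearMap.range_eq_top.2 fun l => by
      obtain ⟨v, hv⟩ := exists_riesz l
      exact ⟨v, by ext w; exact hv w⟩)
  have he₀ : ∀ v w, e₀ v w = inner ℂ w v := fun v w => rfl
  let T : V →L[ℂ] V := (e₀.symm : (V →L⋆[ℂ] ℂ) →L[ℂ] V).comp B
  have hT : ∀ v w, inner ℂ w (T v) = B v w := fun v w => by
    rw [← he₀]
    change e₀ (e₀.symm (B v)) w = _
    rw [e₀.apply_symm_apply]
  have hTanti := e₀.symm.antilipschitz.comp anti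
  have hclosed : IsClosed (T.range : Set V) :=
    hTanti.isClosed_range (f := T) T.uniformContinuous
  -- The range is closed by the lower bound. A vector `w` orthogonal to it satisfies `B w w = 0`, so
  -- the lower bound on the diagonal forces `w = 0`.
  have hTtop : T.range = ⊤ := by
    have := hclosed.completeSpace_coe
    rw [← T.range.orthogonal_orthogonal, Submodule.eq_top_iff']
    intro v w hw
    have h1 : inner ℂ w (T w) = 0 := by
      rw [← inner_conj_symm]
      have h2 : inner ℂ (T w) w = 0 := hw _ ⟨w, rfl⟩
      rw [h2, map_zero]
    have h2 := h w
    rw [← hT, h1, norm_zero] at h2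
    have h3 : w = 0 := by
      by_contra hne
      have : 0 < ‖w‖ := norm_pos_iff.2 hne
      have : 0 < c * ‖w‖ ^ 2 := by positivity
      linarith
    rw [h3, inner_zero_left]
  refine ⟨ContinuousLinearEquiv.ofBijective B (LinearMap.ker_eq_bot.2 anti.injective)
    (LinearMap.range_eq_top.2 fun l => ?_), fun v => rfl⟩
  obtain ⟨v, hv⟩ : e₀.symm l ∈ T.range := hTtop ▸ Submodule.mem_top
  exact ⟨v, e₀.symm.injective hv⟩

end LaxMilgram

/-! ### Cauchy data -/

section Cauchy

variable {ε : ℝ}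

theorem exists_sobolev {k : ℕ} (f : ℕ → ℝ → ℂ) (hf : ∀ j ≤ k, MemLp (f j) 2 (latMeasure ε))
    (hw : ∀ j < k, HasWeakDerivOn ε (Real.pi - ε) (f j) (f (j + 1))) :
    ∃ u : sobolev ε k, ∀ j : Fin (k + 1), u.1 j =ᵐ[latMeasure ε] f j := by
  have hF : ∀ j : Fin (k + 1), MemLp (f j) 2 (latMeasure ε) := fun j => hf j (by omega)
  refine ⟨⟨WithLp.toLp 2 fun j => (hF j).toLp _, fun j => ?_⟩, fun j => (hF j).coeFn_toLp⟩
  exact (hw j j.2).congr (hF j.castSucc).coeFn_toLp.symm (hF j.succ).coeFn_toLp.symm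

theorem hasDerivAt_iteratedDeriv {u : ℝ → ℂ} {s : Set ℝ} (hs : IsOpen s)
    (hu : ContDiffOn ℝ (⊤ : ℕ∞) u s) (j : ℕ) {x : ℝ} (hx : x ∈ s) :
    HasDerivAt (iteratedDeriv j u) (iteratedDeriv (j + 1) u x) x := by
  rw [iteratedDeriv_succ]
  refine DifferentiableAt.hasDerivAt ?_
  have h1 := hu.differentiableOn_iteratedDerivWithin (m := j)
    (by exact_mod_cast WithTop.coe_lt_top j) hs.uniqueDiffOn
  have h2 := (h1 x hx).differentiableAt (hs.mem_nhds hx)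
  exact h2.congr_of_eventuallyEq
    (((iteratedDerivWithin_of_isOpen hs).symm).eventuallyEq_of_mem (hs.mem_nhds hx))

theorem exists_sobolev_of_contDiffOn (hε : 0 < ε) (h : ε < Real.pi - ε) {u : ℝ → ℂ}
    (hu : ContDiffOn ℝ (⊤ : ℕ∞) u (Ioo 0 Real.pi)) (k : ℕ) :
    ∃ U : sobolev ε k, ∀ j : Fin (k + 1), U.1 j =ᵐ[latMeasure ε] iteratedDeriv (j : ℕ) u := by
  have hs : Icc ε (Real.pi - ε) ⊆ Ioo 0 Real.pi := fun x hx =>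
    ⟨hε.trans_le hx.1, by linarith [hx.2]⟩
  have hd : ∀ j, ∀ x ∈ Icc ε (Real.pi - ε),
      HasDerivAt (iteratedDeriv j u) (iteratedDeriv (j + 1) u x) x := fun j x hx =>
    hasDerivAt_iteratedDeriv isOpen_Ioo hu j (hs hx)
  have hc : ∀ j, ContinuousOn (iteratedDeriv j u) (Icc ε (Real.pi - ε)) := fun j x hx =>
    (hd j x hx).continuousAt.continuousWithinAt
  exact exists_sobolev _ (fun j _ => latMeasure_memLp_of_continuousOn (hc j)) fun j _ =>
    (ACDeriv.of_hasDerivAt h.le (hd j) (hc (j + 1))).hasWeakDerivOn h.le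

theorem HasBoundaryValues.add {f g : ℝ → ℂ} {v w v' w' : ℂ} (hf : HasBoundaryValues ε f v w)
    (hg : HasBoundaryValues ε g v' w') :
    HasBoundaryValues ε (fun x => f x + g x) (v + v') (w + w') := by
  obtain ⟨F, hF, hfF, hF0, hF1⟩ := hf
  obtain ⟨G, hG, hgG, hG0, hG1⟩ := hg
  exact ⟨fun x => F x + G x, hF.add hG, hfF.add hgG, by simp only [hF0, hG0],
    by simp only [hF1, hG1]⟩

theorem HasBoundaryValues.sub {f g : ℝ → ℂ} {v w v' w' : ℂ} (hf : HasBoundaryValues ε f v w)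
    (hg : HasBoundaryValues ε g v' w') :
    HasBoundaryValues ε (fun x => f x - g x) (v - v') (w - w') := by
  obtain ⟨F, hF, hfF, hF0, hF1⟩ := hf
  obtain ⟨G, hG, hgG, hG0, hG1⟩ := hg
  exact ⟨fun x => F x - G x, hF.sub hG, hfF.sub hgG, by simp only [hF0, hG0],
    by simp only [hF1, hG1]⟩

theorem HasBoundaryValues.congr {f g : ℝ → ℂ} {v w : ℂ} (hf : HasBoundaryValues ε f v w)
    (h : g =ᵐ[latMeasure ε] f) : HasBoundaryValues ε g v w := by
  obtain ⟨F, hF, hfF, hF0, hF1⟩ := hf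
  exact ⟨F, hF, h.trans hfF, hF0, hF1⟩

/-- Hermite interpolation at two points. -/
theorem exists_contDiff_hermite {s t : ℝ} (hst : s ≠ t) (a b : Fin 2 → ℂ) :
    ∃ u : ℝ → ℂ, ContDiff ℝ (⊤ : ℕ∞) u ∧ u s = a 0 ∧ u t = a 1 ∧ deriv u s = b 0 ∧
      deriv u t = b 1 := by
  have hne : ((t : ℂ) - s) ≠ 0 := sub_ne_zero.2 fun h => hst (by exact_mod_cast h.symm)
  set l : ℂ := (t : ℂ) - s with hl
  -- The cubic is expanded at `s`, which fixes its first two coefficients; `p` and `q` solve the two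
  -- linear equations at `t`.
  set p := 3 * (a 1 - a 0) / l ^ 2 - (2 * b 0 + b 1) / l with hp
  set q := -2 * (a 1 - a 0) / l ^ 3 + (b 0 + b 1) / l ^ 2 with hq
  have hd : ∀ x : ℝ, HasDerivAt (fun x : ℝ => a 0 + b 0 * ((x : ℂ) - s) + p * ((x : ℂ) - s) ^ 2
      + q * ((x : ℂ) - s) ^ 3) (b 0 + 2 * p * ((x : ℂ) - s) + 3 * q * ((x : ℂ) - s) ^ 2) x := by
    intro x
    have h1 : HasDerivAt (fun x : ℝ => (x : ℂ) - s) 1 x := (Complex.ofRealCLM.hasDerivAt).sub_const _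
    have h2 := (((h1.const_mul (b 0)).const_add (a 0)).add ((h1.pow 2).const_mul p)).add
      ((h1.pow 3).const_mul q)
    refine HasDerivAt.congr_deriv h2 ?_
    push_cast
    ring
  refine ⟨_, ?_, ?_, ?_, (hd s).deriv.trans ?_, (hd t).deriv.trans ?_⟩
  · have h1 : ContDiff ℝ (⊤ : ℕ∞) fun x : ℝ => (x : ℂ) - s :=
      Complex.ofRealCLM.contDiff.sub contDiff_const
    exact ((contDiff_const.add (contDiff_const.mul h1)).add (contDiff_const.mul (h1.pow 2))).add
      (contDiff_const.mul (h1.pow 3))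
  · simp
  · rw [← hl, hp, hq]; field_simp; ring
  · simp
  · rw [← hl, hp, hq]; field_simp; ring

variable {r γ ω Ωref : ℝ} {m : ℤ} {Ω Ω₁ : ℝ → ℝ}

theorem hasBoundaryValues_iteratedDeriv (hε : 0 < ε) {u : ℝ → ℂ}
    (hu : ContDiffOn ℝ (⊤ : ℕ∞) u (Ioo 0 Real.pi)) (j : ℕ) :
    HasBoundaryValues ε (iteratedDeriv j u) (iteratedDeriv j u ε) (iteratedDeriv j u (Real.pi - ε)) :=
  ⟨_, fun _ hx => (hasDerivAt_iteratedDeriv isOpen_Ioo hu j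
    ⟨hε.trans_le hx.1, by linarith [hx.2]⟩).continuousAt.continuousWithinAt, .rfl, rfl, rfl⟩

theorem isWaveSolution_symm_add (Bfull : sobolev ε 2 →L[ℂ] SobolevDual ε)
    (B : sobolev₀ ε 2 ≃L[ℂ] SobolevDual ε)
    (hfull : ∀ (u : sobolev ε 2) (ψ : sobolev₀ ε 2),
      Bfull u ψ = waveForm r ε γ ω Ωref m Ω Ω₁ (jet u) (jet ψ.1))
    (hB : ∀ Ψ : sobolev₀ ε 2, B Ψ = Bfull Ψ.1) (f : SobolevDual ε) {a b : Fin 2 → ℂ}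
    {U : sobolev ε 2} (h0 : HasBoundaryValues ε (U.1 0) (a 0) (a 1))
    (h1 : HasBoundaryValues ε (U.1 1) (b 0) (b 1)) :
    IsWaveSolution r ε γ ω Ωref m Ω Ω₁ f a b ((B.symm (f - Bfull U)).1 + U) := by
  refine ⟨fun ψ => ?_, ?_, ?_⟩
  · rw [← hfull, map_add, ← hB, B.apply_symm_apply]
    change f ψ - Bfull U ψ + Bfull U ψ = f ψ
    ring
  all_goals set V := B.symm (f - Bfull U)
  · have := (V.2 0 (by norm_num)).add h0
    rw [zero_add, zero_add] at this
    exact this.congr (Lp.coeFn_add (V.1.1 0) (U.1 0))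
  · have := (V.2 1 (by norm_num)).add h1
    rw [zero_add, zero_add] at this
    exact this.congr (Lp.coeFn_add (V.1.1 1) (U.1 1))

/-- The difference of two solutions has vanishing Cauchy data, hence lies in H²_0(I'), where B is
injective. -/
theorem IsWaveSolution.unique (Bfull : sobolev ε 2 →L[ℂ] SobolevDual ε)
    (B : sobolev₀ ε 2 ≃L[ℂ] SobolevDual ε)
    (hfull : ∀ (u : sobolev ε 2) (ψ : sobolev₀ ε 2),
      Bfull u ψ = waveForm r ε γ ω Ωref m Ω Ω₁ (jet u) (jet ψ.1))
    (hB : ∀ Ψ : sobolev₀ ε 2, B Ψ = Bfull Ψ.1) {f : SobolevDual ε} {a b : Fin 2 → ℂ}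
    {Φ Ψ : sobolev ε 2} (hΦ : IsWaveSolution r ε γ ω Ωref m Ω Ω₁ f a b Φ)
    (hΨ : IsWaveSolution r ε γ ω Ωref m Ω Ω₁ f a b Ψ) : Φ = Ψ := by
  have hmem : Φ - Ψ ∈ sobolev₀ ε 2 := by
    intro j hj
    have hj' : j = 0 ∨ j = 1 := by
      fin_cases j <;> simp_all
    rcases hj' with rfl | rfl
    · have := hΦ.boundary.sub hΨ.boundary
      rw [sub_self, sub_self] at this
      exact this.congr (Lp.coeFn_sub _ _)
    · have := hΦ.boundary'.sub hΨ.boundary'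
      rw [sub_self, sub_self] at this
      exact this.congr (Lp.coeFn_sub _ _)
  have h0 : B ⟨Φ - Ψ, hmem⟩ = 0 := by
    ext ψ
    rw [hB, map_sub]
    change Bfull Φ ψ - Bfull Ψ ψ = 0
    rw [hfull, hfull, hΦ.weak, hΨ.weak, sub_self]
  have h1 := B.map_eq_zero_iff.1 h0
  exact sub_eq_zero.1 (congrArg Subtype.val h1)

/-- Existence, uniqueness and representation of solutions with given Cauchy data. -/
theorem exists_isWaveSolution (hε : 0 < ε) (h : ε < Real.pi - ε)
    (Bfull : sobolev ε 2 →L[ℂ] SobolevDual ε)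
    (B : sobolev₀ ε 2 ≃L[ℂ] SobolevDual ε)
    (hfull : ∀ (u : sobolev ε 2) (ψ : sobolev₀ ε 2),
      Bfull u ψ = waveForm r ε γ ω Ωref m Ω Ω₁ (jet u) (jet ψ.1))
    (hB : ∀ Ψ : sobolev₀ ε 2, B Ψ = Bfull Ψ.1) (f : SobolevDual ε) (a b : Fin 2 → ℂ) :
    ∃ Ψ : sobolev ε 2,
        IsWaveSolution r ε γ ω Ωref m Ω Ω₁ f a b Ψ ∧
        (∀ Φ : sobolev ε 2, IsWaveSolution r ε γ ω Ωref m Ω Ω₁ f a b Φ → Φ = Ψ) ∧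
        ∀ u : ℝ → ℂ, ContDiffOn ℝ (⊤ : ℕ∞) u (Ioo 0 Real.pi) →
          u ε = a 0 → u (Real.pi - ε) = a 1 →
          deriv u ε = b 0 → deriv u (Real.pi - ε) = b 1 →
          ∃ U : sobolev ε 2,
            (∀ j : Fin 3, U.1 j =ᵐ[latMeasure ε] iteratedDeriv (j : ℕ) u) ∧
            Ψ = (B.symm (f - Bfull U)).1 + U := by
  have key : ∀ u : ℝ → ℂ, ContDiffOn ℝ (⊤ : ℕ∞) u (Ioo 0 Real.pi) →
      u ε = a 0 → u (Real.pi - ε) = a 1 → deriv u ε = b 0 → deriv u (Real.pi - ε) = b 1 →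
      ∃ U : sobolev ε 2, (∀ j : Fin 3, U.1 j =ᵐ[latMeasure ε] iteratedDeriv (j : ℕ) u) ∧
        IsWaveSolution r ε γ ω Ωref m Ω Ω₁ f a b ((B.symm (f - Bfull U)).1 + U) := by
    intro u hu e1 e2 e3 e4
    obtain ⟨U, hU⟩ := exists_sobolev_of_contDiffOn hε h hu 2
    refine ⟨U, hU, isWaveSolution_symm_add Bfull B hfull hB f ?_ ?_⟩
    · have := (hasBoundaryValues_iteratedDeriv hε hu 0).congr (hU 0)
      rwa [iteratedDeriv_zero, e1, e2] at this
    · have := (hasBoundaryValues_iteratedDeriv hε hu 1).congr (hU 1)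
      rwa [iteratedDeriv_one, e3, e4] at this
  -- One function with the given data is needed for existence. The representation for every other
  -- `u` then follows from uniqueness.
  obtain ⟨v, hv, e1, e2, e3, e4⟩ := exists_contDiff_hermite h.ne a b
  obtain ⟨U, -, hU⟩ := key v hv.contDiffOn e1 e2 e3 e4
  refine ⟨_, hU, fun Φ hΦ => hΦ.unique Bfull B hfull hB hU, fun u hu e1 e2 e3 e4 => ?_⟩
  obtain ⟨U', hU', hs⟩ := key u hu e1 e2 e3 e4
  exact ⟨U', hU', hU.unique Bfull B hfull hB hs⟩

end Cauchy

/-! ### Sobolev regularity of functions on `I'` -/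

section IsSobolev

variable {ε : ℝ}

/-- `f` is square integrable on `I'` together with its weak derivatives of order at most `n`. -/
def IsSobolev (ε : ℝ) : ℕ → (ℝ → ℂ) → Prop
  | 0, f => MemLp f 2 (latMeasure ε)
  | n + 1, f => MemLp f 2 (latMeasure ε) ∧
      ∃ g, HasWeakDerivOn ε (Real.pi - ε) f g ∧ IsSobolev ε n g

namespace IsSobolev

variable {f g : ℝ → ℂ} {n : ℕ}

theorem memLp (hf : IsSobolev ε n f) : MemLp f 2 (latMeasure ε) := by
  cases n with
  | zero => exact hf
  | succ n => exact hf.1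

theorem congr (hf : IsSobolev ε n f) (h : f =ᵐ[latMeasure ε] g) : IsSobolev ε n g := by
  cases n with
  | zero => exact hf.memLp.ae_eq h
  | succ n =>
    obtain ⟨h1, k, h2, h3⟩ := hf
    exact ⟨h1.ae_eq h, k, h2.congr h .rfl, h3⟩

theorem of_succ (hf : IsSobolev ε (n + 1) f) : IsSobolev ε n f := by
  induction n generalizing f with
  | zero => exact hf.memLp
  | succ n ih =>
    obtain ⟨h1, k, h2, h3⟩ := hf
    exact ⟨h1, k, h2, ih h3⟩

theorem of_acDeriv (h : ε < Real.pi - ε) (hf : ACDeriv ε (Real.pi - ε) f g) (hg : IsSobolev ε n g) :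
    IsSobolev ε (n + 1) f :=
  ⟨latMeasure_memLp_of_continuousOn (hf.continuousOn h.le), g, hf.hasWeakDerivOn h.le, hg⟩

theorem exists_acDeriv (h : ε < Real.pi - ε) (hf : IsSobolev ε (n + 1) f) :
    ∃ F g, ACDeriv ε (Real.pi - ε) F g ∧ f =ᵐ[latMeasure ε] F ∧ IsSobolev ε n g := by
  obtain ⟨h1, k, h2, h3⟩ := hf
  obtain ⟨F, hF, hfF⟩ := h2.exists_acDeriv h (h1.integrable one_le_two)
    (h3.memLp.integrable one_le_two)
  exact ⟨F, k, hF, hfF, h3⟩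

theorem memLp_top (h : ε < Real.pi - ε) (hf : IsSobolev ε (n + 1) f) :
    MemLp f ⊤ (latMeasure ε) := by
  obtain ⟨F, g, hF, hfF, -⟩ := hf.exists_acDeriv h
  exact (latMeasure_memLp_of_continuousOn (hF.continuousOn h.le)).ae_eq hfF.symm

theorem add (h : ε < Real.pi - ε) (hf : IsSobolev ε n f) (hg : IsSobolev ε n g) :
    IsSobolev ε n fun x => f x + g x := by
  induction n generalizing f g with
  | zero => exact hf.memLp.add hg.memLp
  | succ n ih =>
    obtain ⟨F, F', hF, hfF, hF'⟩ := hf.exists_acDeriv h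
    obtain ⟨G, G', hG, hgG, hG'⟩ := hg.exists_acDeriv h
    refine (of_acDeriv h (hF.add hG) (ih hF' hG')).congr ?_
    filter_upwards [hfF, hgG] with x h1 h2
    rw [h1, h2]

theorem conjugate (h : ε < Real.pi - ε) (hf : IsSobolev ε n f) :
    IsSobolev ε n fun x => starRingEnd ℂ (f x) := by
  induction n generalizing f with
  | zero => exact memLp_conj hf.memLp
  | succ n ih =>
    obtain ⟨F, F', hF, hfF, hF'⟩ := hf.exists_acDeriv h
    refine (of_acDeriv h (hF.clm Complex.conjCLE.toContinuousLinearMap) (ih hF')).congr ?_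
    filter_upwards [hfF] with x h1
    rw [h1]
    rfl

/-- One extra order on one factor suffices: the base case is a bounded function times an L²
function, and in (FG)' = F'G + FG' each product again has a factor one order better. -/
theorem mul_succ (h : ε < Real.pi - ε) (hf : IsSobolev ε (n + 1) f) (hg : IsSobolev ε n g) :
    IsSobolev ε n fun x => f x * g x := by
  induction n generalizing f g with
  | zero => exact memLp_top_mul (hf.memLp_top h) hg.memLp
  | succ n ih =>
    obtain ⟨F, F', hF, hfF, hF'⟩ := hf.exists_acDeriv h
    obtain ⟨G, G', hG, hgG, hG'⟩ := hg.exists_acDeriv h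
    have h1 := ih hF' (hg.of_succ.congr hgG)
    have h2 := ih (hf.of_succ.congr hfF) hG'
    refine (of_acDeriv h (hF.mul h.le hG) (h1.add h h2)).congr ?_
    filter_upwards [hfF, hgG] with x h1 h2
    rw [h1, h2]

/-- The space H^(n+1) is an algebra in one dimension, since both terms of the product rule are
covered by `mul_succ`. -/
theorem mul (h : ε < Real.pi - ε) (hf : IsSobolev ε (n + 1) f) (hg : IsSobolev ε (n + 1) g) :
    IsSobolev ε (n + 1) fun x => f x * g x := by
  obtain ⟨F, F', hF, hfF, hF'⟩ := hf.exists_acDeriv h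
  obtain ⟨G, G', hG, hgG, hG'⟩ := hg.exists_acDeriv h
  have h1 := ((hg.congr hgG).mul_succ h hF').congr (Eventually.of_forall fun x => mul_comm _ _)
  have h2 := (hf.congr hfF).mul_succ h hG'
  refine (of_acDeriv h (hF.mul h.le hG) (h1.add h h2)).congr ?_
  filter_upwards [hfF, hgG] with x h1 h2
  rw [h1, h2]

theorem of_contDiffOn (hε : 0 < ε) (h : ε < Real.pi - ε)
    (hf : ContDiffOn ℝ (⊤ : ℕ∞) f (Ioo 0 Real.pi)) (n : ℕ) : IsSobolev ε n f := by
  have hs : Icc ε (Real.pi - ε) ⊆ Ioo 0 Real.pi := fun x hx =>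
    ⟨hε.trans_le hx.1, by linarith [hx.2]⟩
  have hd : ∀ j, ∀ x ∈ Icc ε (Real.pi - ε),
      HasDerivAt (iteratedDeriv j f) (iteratedDeriv (j + 1) f x) x := fun j x hx =>
    hasDerivAt_iteratedDeriv isOpen_Ioo hf j (hs hx)
  have hc : ∀ j, ContinuousOn (iteratedDeriv j f) (Icc ε (Real.pi - ε)) := fun j x hx =>
    (hd j x hx).continuousAt.continuousWithinAt
  have key : ∀ n j, IsSobolev ε n (iteratedDeriv j f) := by
    intro n
    induction n with
    | zero => exact fun j => latMeasure_memLp_of_continuousOn (hc j)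
    | succ n ih => exact fun j => of_acDeriv h (.of_hasDerivAt h.le (hd j) (hc (j + 1))) (ih _)
  simpa using key n 0

theorem ofReal_of_contDiffOn (hε : 0 < ε) (h : ε < Real.pi - ε) {f : ℝ → ℝ}
    (hf : ContDiffOn ℝ (⊤ : ℕ∞) f (Ioo 0 Real.pi)) (n : ℕ) :
    IsSobolev ε n fun x => (f x : ℂ) :=
  of_contDiffOn hε h (Complex.ofRealCLM.contDiff.comp_contDiffOn hf) n

theorem const (hε : 0 < ε) (h : ε < Real.pi - ε) (c : ℂ) (n : ℕ) : IsSobolev ε n fun _ => c :=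
  of_contDiffOn hε h contDiffOn_const n

theorem const_mul (hε : 0 < ε) (h : ε < Real.pi - ε) (hf : IsSobolev ε n f) (c : ℂ) :
    IsSobolev ε n fun x => c * f x :=
  (const hε h c (n + 1)).mul_succ h hf

theorem sub (hε : 0 < ε) (h : ε < Real.pi - ε) (hf : IsSobolev ε n f) (hg : IsSobolev ε n g) :
    IsSobolev ε n fun x => f x - g x :=
  (hf.add h (hg.const_mul hε h (-1))).congr (Eventually.of_forall fun x => by ring)

theorem sum (h : ε < Real.pi - ε) {f : Fin 3 → ℝ → ℂ} (hf : ∀ i, IsSobolev ε n (f i)) :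
    IsSobolev ε n fun x => ∑ i, f i x :=
  (((hf 0).add h (hf 1)).add h (hf 2)).congr
    (Eventually.of_forall fun x => by simp only [Fin.sum_univ_three])

theorem ofReal_of_weakDeriv (h : ε < Real.pi - ε) {f g : ℝ → ℝ} (hf : MemLp f 2 (latMeasure ε))
    (hg : MemLp g 2 (latMeasure ε)) (hfg : HasWeakDerivOn ε (Real.pi - ε) f g)
    (hn : IsSobolev ε n fun x => (g x : ℂ)) : IsSobolev ε (n + 1) fun x => (f x : ℂ) := by
  obtain ⟨F, hF, hfF⟩ := hfg.exists_acDeriv h (hf.integrable one_le_two) (hg.integrable one_le_two)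
  refine (of_acDeriv h (hF.clm Complex.ofRealCLM) hn).congr ?_
  filter_upwards [hfF] with x hx
  rw [hx]
  rfl

end IsSobolev

theorem sobolev_isSobolev {k : ℕ} (u : sobolev ε k) :
    ∀ (n : ℕ) (j : Fin (k + 1)), (j : ℕ) + n ≤ k → IsSobolev ε n (u.1 j) := by
  intro n
  induction n with
  | zero => exact fun j _ => Lp.memLp _
  | succ n ih =>
    intro j hj
    exact ⟨Lp.memLp _, _, u.2 ⟨j, by omega⟩, ih ⟨j + 1, by omega⟩ (by simp only; omega)⟩

end IsSobolev

/-! ### The second order du Bois-Reymond lemma -/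

theorem exists_testFunction_integral_eq_one {a b : ℝ} (hab : a < b) :
    ∃ η : ℝ → ℝ, ContDiff ℝ (⊤ : ℕ∞) η ∧ HasCompactSupport η ∧ tsupport η ⊆ Ioo a b ∧
      ∫ x, η x = 1 := by
  let B : ContDiffBump ((a + b) / 2) := ⟨(b - a) / 8, (b - a) / 4, by linarith, by linarith⟩
  refine ⟨B.normed volume, B.contDiff_normed, B.hasCompactSupport_normed, ?_, B.integral_normed⟩
  rw [B.tsupport_normed_eq]
  intro x hx
  rw [Metric.mem_closedBall, Real.dist_eq, abs_le] at hx
  change -((b - a) / 4) ≤ _ ∧ _ ≤ (b - a) / 4 at hx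
  exact ⟨by linarith [hx.1], by linarith [hx.2]⟩

theorem integrableOn_smul_of_continuous {a b : ℝ} {φ : ℝ → ℝ} {f : ℝ → ℂ} (hφ : Continuous φ)
    (hf : IntegrableOn f (Ioo a b)) : IntegrableOn (fun x => φ x • f x) (Ioo a b) := by
  obtain ⟨C, hC⟩ := isCompact_Icc.exists_bound_of_continuousOn (s := Icc a b) hφ.continuousOn
  exact hf.bdd_smul C hφ.aestronglyMeasurable (Clamped.ae_of_forall hC)

/-- The functional η ↦ ∫ η'f + ∫ ηg vanishes on derivatives of test functions, that is on test
functions of mean zero. It is therefore K times the mean of η, with K its value at a test function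
of integral one. -/
theorem exists_hasWeakDerivOn_of_second_order {a b : ℝ} (hab : a < b) {f g : ℝ → ℂ}
    (hf : IntegrableOn f (Ioo a b)) (hg : IntegrableOn g (Ioo a b))
    (H : ∀ φ : ℝ → ℝ, ContDiff ℝ (⊤ : ℕ∞) φ → HasCompactSupport φ → tsupport φ ⊆ Ioo a b →
      (∫ x in Ioo a b, deriv (deriv φ) x • f x) + ∫ x in Ioo a b, deriv φ x • g x = 0) :
    ∃ K : ℂ, HasWeakDerivOn a b f fun x => g x - K := by
  obtain ⟨η₀, h1, h2, h3, h4⟩ := exists_testFunction_integral_eq_one hab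
  refine ⟨(∫ x in Ioo a b, deriv η₀ x • f x) + ∫ x in Ioo a b, η₀ x • g x, ?_⟩
  intro η k1 k2 k3
  set J := ∫ x, η x with hJ
  set K := (∫ x in Ioo a b, deriv η₀ x • f x) + ∫ x in Ioo a b, η₀ x • g x with hK
  have hd : ∀ {χ : ℝ → ℝ}, ContDiff ℝ (⊤ : ℕ∞) χ → Continuous (deriv χ) := fun hχ =>
    hχ.continuous_deriv (by simp)
  obtain ⟨φ, p1, p2, p3, p4⟩ := exists_testFunction_primitive (a := a) (b := b)
    (η := fun x => η x - J * η₀ x) (k1.sub (contDiff_const.mul h1))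
    (k2.sub (h2.mul_left (f := fun _ => J))) (by
      refine (tsupport_sub _ _).trans (union_subset k3 ?_)
      exact (tsupport_mul_subset_right (f := fun _ => J)).trans h3)
    (by
      rw [integral_sub (k1.continuous.integrable_of_hasCompactSupport k2)
        ((h1.continuous.integrable_of_hasCompactSupport h2).const_mul _), integral_const_mul, h4,
        mul_one, sub_self])
  have hφ := H φ p1 p2 p3
  rw [p4] at hφ
  have hd2 : deriv (fun x => η x - J * η₀ x) = fun x => deriv η x - J * deriv η₀ x := by
    ext x
    have a1 := (k1.differentiable (by simp) x).hasDerivAt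
    have a2 := (h1.differentiable (by simp) x).hasDerivAt
    exact (a1.sub (a2.const_mul J)).deriv
  rw [hd2] at hφ
  have split : ∀ {χ χ₀ : ℝ → ℝ} {k : ℝ → ℂ}, Continuous χ → Continuous χ₀ →
      IntegrableOn k (Ioo a b) → ∫ x in Ioo a b, (χ x - J * χ₀ x) • k x
        = (∫ x in Ioo a b, χ x • k x) - J * ∫ x in Ioo a b, χ₀ x • k x := by
    intro χ χ₀ k hχ hχ₀ hk
    rw [← integral_const_mul, ← integral_sub (integrableOn_smul_of_continuous hχ hk)
      ((integrableOn_smul_of_continuous hχ₀ hk).const_mul _)]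
    refine integral_congr_ae (Eventually.of_forall fun x => ?_)
    simp only [Complex.real_smul]
    push_cast
    ring
  rw [split (hd k1) (hd h1) hf, split k1.continuous h1.continuous hg] at hφ
  have hJ' : ∫ x in Ioo a b, η x • K = J * K := by
    rw [integral_smul_const, Complex.real_smul, hJ]
    congr 2
    refine setIntegral_eq_integral_of_forall_compl_eq_zero fun x hx => ?_
    exact image_eq_zero_of_notMem_tsupport fun h => hx (k3 h)
  have e : ∫ x in Ioo a b, η x • (g x - K) = (∫ x in Ioo a b, η x • g x) - J * K := by
    rw [← hJ', ← integral_sub (integrableOn_smul_of_continuous k1.continuous hg)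
      (integrableOn_smul_of_continuous k1.continuous (integrable_const K))]
    simp only [smul_sub]
  rw [e]
  linear_combination hφ + (J : ℂ) * hK

/-! ### Lifted regularity -/

section Regularity

variable {ε : ℝ}

/-- Coefficients for which weak solutions with square integrable right hand side have square
integrable derivatives of fourth order. -/
structure RegularCoeff (ε : ℝ) (c : Fin 3 → Fin 3 → ℝ → ℂ) : Prop where
  one : ∀ i j, IsSobolev ε 1 (c i j)
  two : ∀ i, IsSobolev ε 2 (c i 2)
  exists_inv : ∃ d, IsSobolev ε 2 d ∧ ∀ᵐ x ∂(latMeasure ε), d x * c 2 2 x = 1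

/-- The coefficient of the `j`-th derivative of the second argument of the form. -/
noncomputable def flux (c : Fin 3 → Fin 3 → ℝ → ℂ) (u : Fin 3 → ℝ → ℂ) (j : Fin 3) (x : ℝ) : ℂ :=
  ∑ i, c i j x * u i x

namespace RegularCoeff

variable {c : Fin 3 → Fin 3 → ℝ → ℂ}

theorem admissible (h : ε < Real.pi - ε) (hc : RegularCoeff ε c) : AdmissibleCoeff ε c :=
  ⟨fun i j => (hc.one i j).memLp, (hc.one 2 2).memLp_top h⟩

theorem jet_isSobolev {k : ℕ} (u : sobolev ε (k + 2)) (i : Fin 3) {n : ℕ} (hn : (i : ℕ) + n ≤ k + 2) :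
    IsSobolev ε n (jet u i) :=
  sobolev_isSobolev u n _ hn

theorem flux_memLp (h : ε < Real.pi - ε) (hc : RegularCoeff ε c) {k : ℕ} (u : sobolev ε (k + 2))
    (j : Fin 3) : MemLp (flux c (jet u) j) 2 (latMeasure ε) :=
  IsSobolev.sum (n := 0) h fun i => (hc.one i j).mul_succ h (jet_memLp u i)

theorem coeffForm_eq (h : ε < Real.pi - ε) (hc : RegularCoeff ε c) {k l : ℕ}
    (u : sobolev ε (k + 2)) (v : sobolev ε (l + 2)) :
    coeffForm ε c (jet u) (jet v)
      = ∑ j, ∫ x, flux c (jet u) j x * conj (jet v j x) ∂(latMeasure ε) := by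
  rw [coeffForm, Finset.sum_comm]
  refine Finset.sum_congr rfl fun j _ => ?_
  rw [← integral_finsetSum _ fun i _ => (hc.admissible h).integrable h u v i j]
  simp only [flux, Finset.sum_mul]

end RegularCoeff

theorem sobolev₀_ext {k : ℕ} {u v : sobolev₀ ε k} (h : ∀ j, u.1.1 j =ᵐ[latMeasure ε] v.1.1 j) :
    u = v :=
  Subtype.ext (Subtype.ext (PiLp.ext fun j => Lp.ext (h j)))

theorem iteratedDeriv_eq_zero_of_notMem {φ : ℝ → ℝ} {a b : ℝ} (h3 : tsupport φ ⊆ Ioo a b) (j : ℕ)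
    {x : ℝ} (hx : x ∉ Ioo a b) : iteratedDeriv j φ x = 0 := by
  have h : ∀ j, tsupport (iteratedDeriv j φ) ⊆ tsupport φ := by
    intro j
    induction j with
    | zero => rw [iteratedDeriv_zero]
    | succ j ih =>
      rw [iteratedDeriv_succ]
      exact (closure_minimal support_deriv_subset isClosed_closure).trans ih
  exact image_eq_zero_of_notMem_tsupport fun hx' => hx (h3 (h j hx'))

/-- Test functions as elements of `H²_0(I')`. -/
theorem exists_sobolev₀_of_testFunction (h : ε < Real.pi - ε) {φ : ℝ → ℝ}
    (h1 : ContDiff ℝ (⊤ : ℕ∞) φ) (h3 : tsupport φ ⊆ Ioo ε (Real.pi - ε)) :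
    ∃ ψ : sobolev₀ ε 2, ∀ j : Fin 3,
      jet ψ.1 j =ᵐ[latMeasure ε] fun x => ((iteratedDeriv (j : ℕ) φ x : ℝ) : ℂ) := by
  have hc : ∀ j, Continuous (iteratedDeriv j φ) := fun j =>
    h1.continuous_iteratedDeriv j (by exact_mod_cast le_top)
  have hd : ∀ j x, HasDerivAt (iteratedDeriv j φ) (iteratedDeriv (j + 1) φ x) x := fun j x => by
    rw [iteratedDeriv_succ]
    exact (h1.differentiable_iteratedDeriv j (by exact_mod_cast WithTop.coe_lt_top j) x).hasDerivAt
  obtain ⟨ψ, hψ⟩ := exists_sobolev (ε := ε) (k := 2)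
    (fun j x => ((iteratedDeriv j φ x : ℝ) : ℂ))
    (fun j _ => latMeasure_memLp_of_continuousOn
      (Complex.continuous_ofReal.comp (hc j)).continuousOn)
    fun j _ => ((ACDeriv.of_hasDerivAt h.le (fun x _ => hd j x)
      (hc (j + 1)).continuousOn).clm Complex.ofRealCLM).hasWeakDerivOn h.le
  refine ⟨⟨ψ, fun j _ => ⟨fun x => ((iteratedDeriv (j : ℕ) φ x : ℝ) : ℂ),
    (Complex.continuous_ofReal.comp (hc j)).continuousOn, hψ j, ?_, ?_⟩⟩, fun j => hψ j⟩ <;>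
  · beta_reduce
    rw [iteratedDeriv_eq_zero_of_notMem h3 _ (by simp), Complex.ofReal_zero]

/-- The antilinear functional defined by a square integrable function. -/
theorem exists_pairing_operator (r ε : ℝ) : ∃ J : LatL2 ε →L[ℂ] SobolevDual ε,
    ∀ (F : LatL2 ε) (ψ : sobolev₀ ε 2), J F ψ = pairing r ε F (jet ψ.1 0) := by
  have hw : MemLp (fun x => ((r ^ 2 * Real.sin x : ℝ) : ℂ)) ⊤ (latMeasure ε) :=
    memLp_ofReal_of_continuousOn (by fun_prop)
  have hi : ∀ (F : LatL2 ε) (ψ : sobolev₀ ε 2), Integrable (fun x => F x * conj (jet ψ.1 0 x)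
      * ((r ^ 2 * Real.sin x : ℝ) : ℂ)) (latMeasure ε) := fun F ψ =>
    (integrable_mul_of_memLp (memLp_top_mul hw (Lp.memLp F)) (memLp_conj (jet_memLp ψ.1 0))).congr
      (Eventually.of_forall fun x => by simp only []; ring)
  refine exists_operator_of_bounded (fun (F : LatL2 ε) (ψ : sobolev₀ ε 2) =>
    pairing r ε F (jet ψ.1 0)) (r ^ 2) ?_ ?_ ?_ ?_ ?_
  · intro F G ψ
    simp only [pairing]
    rw [← integral_add (hi F ψ) (hi G ψ)]
    refine integral_congr_ae ?_
    filter_upwards [Lp.coeFn_add F G] with x hx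
    rw [hx, Pi.add_apply]
    ring
  · intro a F ψ
    simp only [pairing, smul_eq_mul]
    rw [← integral_const_mul]
    refine integral_congr_ae ?_
    filter_upwards [Lp.coeFn_smul a F] with x hx
    rw [hx, Pi.smul_apply, smul_eq_mul]
    ring
  · intro F ψ χ
    simp only [pairing]
    rw [← integral_add (hi F ψ) (hi F χ)]
    refine integral_congr_ae ?_
    filter_upwards [jet_add ψ.1 χ.1 0] with x hx
    change F x * conj (jet (ψ.1 + χ.1) 0 x) * _ = _
    rw [hx, map_add]
    ring
  · intro a F ψ
    simp only [pairing, smul_eq_mul]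
    rw [← integral_const_mul]
    refine integral_congr_ae ?_
    filter_upwards [jet_smul a ψ.1 0] with x hx
    change F x * conj (jet (a • ψ.1) 0 x) * _ = _
    rw [hx, map_mul]
    ring
  · intro F ψ
    have hn := norm_integral_mul_mul_le (ε := ε) (f := fun x => ((r ^ 2 * Real.sin x : ℝ) : ℂ))
      (sq_nonneg r) (Eventually.of_forall fun x => by
        rw [Complex.norm_real, Real.norm_eq_abs, abs_mul, abs_of_nonneg (sq_nonneg r)]
        exact mul_le_of_le_one_right (sq_nonneg r) (Real.abs_sin_le_one x)) (Lp.memLp F)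
      (memLp_conj (jet_memLp ψ.1 0))
    simp only [RCLike.norm_conj] at hn
    rw [← norm_sq_latL2, Real.sqrt_mul (sq_nonneg _), Real.sqrt_sq (norm_nonneg _)] at hn
    have e : pairing r ε F (jet ψ.1 0) = ∫ x, ((r ^ 2 * Real.sin x : ℝ) : ℂ) * F x
        * conj (jet ψ.1 0 x) ∂(latMeasure ε) :=
      integral_congr_ae (Eventually.of_forall fun x => by simp only []; ring)
    rw [e]
    refine hn.trans ?_
    rw [← mul_assoc]
    gcongr
    exact Real.sqrt_le_iff.2 ⟨norm_nonneg _, jet_norm_sq ψ.1 0⟩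

/-- Test functions belong to H²_0(I') and the weight r² sin is positive on I'. Hence L²(I') embeds
injectively in the dual space. -/
theorem eq_zero_of_pairing_eq_zero (hε : 0 < ε) (h : ε < Real.pi - ε) {r : ℝ} (hr : 0 < r)
    (F : LatL2 ε) (hF : ∀ ψ : sobolev₀ ε 2, pairing r ε F (jet ψ.1 0) = 0) : F = 0 := by
  have hi : IntegrableOn (fun x => ((r ^ 2 * Real.sin x : ℝ) : ℂ) * F x) (Ioo ε (Real.pi - ε)) :=
    (memLp_top_mul (memLp_ofReal_of_continuousOn (by fun_prop)) (Lp.memLp F)).integrable one_le_two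
  have h0 := isOpen_Ioo.ae_eq_zero_of_integral_contDiff_smul_eq_zero hi.locallyIntegrableOn
    fun φ h1 h2 h3 => by
      obtain ⟨ψ, hψ⟩ := exists_sobolev₀_of_testFunction h h1 h3
      have h4 := hF ψ
      rw [← h4, pairing, ← setIntegral_eq_integral_of_forall_compl_eq_zero
        (s := Ioo ε (Real.pi - ε)) fun x hx => by
          rw [image_eq_zero_of_notMem_tsupport fun h => hx (h3 h), zero_smul]]
      refine integral_congr_ae ?_
      filter_upwards [hψ 0] with x hx
      rw [hx, Complex.conj_ofReal, Complex.real_smul, Fin.val_zero, iteratedDeriv_zero]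
      ring
  refine Lp.ext ?_
  filter_upwards [(ae_restrict_iff' measurableSet_Ioo).2 h0, Lp.coeFn_zero ℂ 2 (latMeasure ε),
    ae_restrict_mem measurableSet_Ioo] with x hx hx0 hxI
  rw [hx0, Pi.zero_apply]
  have hs := lat_sin_pos hε (Ioo_subset_Icc_self hxI)
  have hw : ((r ^ 2 * Real.sin x : ℝ) : ℂ) ≠ 0 := by
    exact_mod_cast (by positivity : r ^ 2 * Real.sin x ≠ 0)
  exact (mul_eq_zero.1 hx).resolve_left hw

/-- The inclusion of `H⁴_0(I')` in `H²_0(I')`. -/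
theorem exists_inclusion (ε : ℝ) : ∃ i : sobolev₀ ε 4 →L[ℂ] sobolev₀ ε 2,
    ∀ (Ψ : sobolev₀ ε 4) (j : Fin 3), (i Ψ).1.1 j = Ψ.1.1 (Fin.castLE (by norm_num) j) := by
  let i : sobolev₀ ε 4 →ₗ[ℂ] sobolev₀ ε 2 :=
    { toFun := fun Ψ => ⟨⟨WithLp.toLp 2 fun j : Fin 3 => Ψ.1.1 (Fin.castLE (by norm_num) j),
        fun j => Ψ.1.2 (Fin.castLE (by norm_num) j)⟩,
        fun j hj => Ψ.2 (Fin.castLE (by norm_num) j) hj⟩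
      map_add' := fun _ _ => rfl
      map_smul' := fun _ _ => rfl }
  refine ⟨i.mkContinuous 1 fun Ψ => ?_, fun Ψ j => rfl⟩
  rw [one_mul]
  change ‖(i Ψ).1.1‖ ≤ ‖Ψ.1.1‖
  refine le_of_sq_le_sq ?_ (norm_nonneg _)
  rw [PiLp.norm_sq_eq_of_L2, PiLp.norm_sq_eq_of_L2, Fin.sum_univ_three, Fin.sum_univ_five]
  change ‖Ψ.1.1 0‖ ^ 2 + ‖Ψ.1.1 1‖ ^ 2 + ‖Ψ.1.1 2‖ ^ 2 ≤ _
  have := sq_nonneg ‖Ψ.1.1 3‖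
  have := sq_nonneg ‖Ψ.1.1 4‖
  linarith

/-- Two operators with the same graph up to isomorphisms: closed graph theorem. -/
theorem exists_equiv_of_exists {X Y V D : Type*} [NormedAddCommGroup X] [NormedSpace ℂ X]
    [CompleteSpace X] [NormedAddCommGroup Y] [NormedSpace ℂ Y] [CompleteSpace Y]
    [NormedAddCommGroup V] [NormedSpace ℂ V] [NormedAddCommGroup D] [NormedSpace ℂ D]
    (i : X →L[ℂ] V) (J : Y →L[ℂ] D) (B : V ≃L[ℂ] D) (hi : Function.Injective i)
    (hJ : Function.Injective J) (h1 : ∀ x, ∃ y, B (i x) = J y) (h2 : ∀ y, ∃ x, B (i x) = J y) :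
    ∃ e : X ≃L[ℂ] Y, ∀ x, B (i x) = J (e x) := by
  choose T hT using h1
  let L : X →ₗ[ℂ] Y :=
    { toFun := T
      map_add' := fun x y => hJ (by rw [← hT, map_add, map_add, map_add, hT, hT])
      map_smul' := fun a x => hJ (by
        rw [← hT, map_smul, map_smul, RingHom.id_apply, map_smul, hT]) }
  have hL : ∀ x, J (L x) = B (i x) := fun x => (hT x).symm
  -- By injectivity of `J` the graph is the set where two continuous maps agree.
  have hg : IsClosed (L.graph : Set (X × Y)) := by
    have : (L.graph : Set (X × Y)) = {p | J p.2 = B (i p.1)} := by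
      ext p
      rw [SetLike.mem_coe, LinearMap.mem_graph_iff, mem_ofPred_eq, ← hL]
      exact hJ.eq_iff.symm
    rw [this]
    exact isClosed_eq (by fun_prop) (by fun_prop)
  let Lc : X →L[ℂ] Y := ⟨L, L.continuous_of_isClosed_graph hg⟩
  refine ⟨ContinuousLinearEquiv.ofBijective Lc (LinearMap.ker_eq_bot.2 fun x y hxy => ?_)
    (LinearMap.range_eq_top.2 fun y => ?_), hT⟩
  · refine hi (B.injective ?_)
    rw [← hL, ← hL]
    exact congrArg J hxy
  · obtain ⟨x, hx⟩ := h2 y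
    exact ⟨x, hJ ((hL x).trans hx)⟩

theorem HasWeakDerivOn.eq_zero_of_ae_eq_zero {f : ℝ → ℂ} {g : LatL2 ε}
    (hfg : HasWeakDerivOn ε (Real.pi - ε) f g) (hf : f =ᵐ[latMeasure ε] 0) : g = 0 := by
  have h0 := isOpen_Ioo.ae_eq_zero_of_integral_contDiff_smul_eq_zero
    (integrableOn_latL2 g).locallyIntegrableOn fun φ h1 h2 h3 => by
      have h4 := hfg φ h1 h2 h3
      have h5 : ∫ x in Ioo ε (Real.pi - ε), deriv φ x • f x = 0 := by
        refine integral_eq_zero_of_ae ?_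
        filter_upwards [hf] with x hx
        rw [hx, Pi.zero_apply, smul_zero]
      rw [h5, zero_eq_neg] at h4
      rw [← h4]
      exact (setIntegral_eq_integral_of_forall_compl_eq_zero fun x hx => by
        rw [image_eq_zero_of_notMem_tsupport fun h => hx (h3 h), zero_smul]).symm
  refine Lp.ext ?_
  filter_upwards [(ae_restrict_iff' measurableSet_Ioo).2 h0, Lp.coeFn_zero ℂ 2 (latMeasure ε)]
    with x hx hx0
  rw [hx0, hx, Pi.zero_apply]

/-- The components of order three and four are weak derivatives of the preceding ones, so they
vanish once the second derivative does. -/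
theorem inclusion_injective {i : sobolev₀ ε 4 →L[ℂ] sobolev₀ ε 2}
    (hi : ∀ (Ψ : sobolev₀ ε 4) (j : Fin 3), (i Ψ).1.1 j = Ψ.1.1 (Fin.castLE (by norm_num) j)) :
    Function.Injective i := by
  refine (injective_iff_map_eq_zero i).2 fun Ψ hΨ => ?_
  have h0 : ∀ j : Fin 3, Ψ.1.1 (Fin.castLE (by norm_num) j) = 0 := fun j => by
    rw [← hi, hΨ]; rfl
  have h2 : Ψ.1.1 2 = 0 := h0 2
  have step : ∀ j : Fin 4, Ψ.1.1 j.castSucc = 0 → Ψ.1.1 j.succ = 0 := fun j hj =>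
    (Ψ.1.2 j).eq_zero_of_ae_eq_zero (by rw [hj]; exact Lp.coeFn_zero ℂ 2 _)
  have h3 : Ψ.1.1 3 = 0 := step 2 h2
  have h4 : Ψ.1.1 4 = 0 := step 3 h3
  refine Subtype.ext (Subtype.ext (PiLp.ext fun j => ?_))
  fin_cases j
  · exact h0 0
  · exact h0 1
  · exact h2
  · exact h3
  · exact h4

end Regularity

/-! ### Weak solutions with square integrable right hand side -/

section LiftedRegularity

variable {ε : ℝ}

/-- The boundary terms vanish because ψ and ψ' do; nothing is required of `f` at the end points. -/
theorem integral_mul_conj_jet (h : ε < Real.pi - ε) {f g : ℝ → ℂ} (hf : MemLp f 2 (latMeasure ε))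
    (hg : MemLp g 2 (latMeasure ε)) (hfg : HasWeakDerivOn ε (Real.pi - ε) f g)
    (ψ : sobolev₀ ε 2) (j : Fin 2) :
    ∫ x, f x * conj (jet ψ.1 j.succ x) ∂(latMeasure ε)
      = - ∫ x, g x * conj (jet ψ.1 j.castSucc x) ∂(latMeasure ε) := by
  obtain ⟨F, hF, hfF⟩ := hfg.exists_acDeriv h (hf.integrable one_le_two) (hg.integrable one_le_two)
  obtain ⟨y, hy, hψy⟩ := sobolev_exists_acDeriv h ψ.1 j
  have hy0 := (ψ.2 j.castSucc j.2).eq h (hy.continuousOn h.le) hψy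
  have hm := (hF.mul h.le (hy.clm Complex.conjCLE.toContinuousLinearMap)).integral_eq_sub h.le
  simp only [ContinuousLinearEquiv.coe_coe, Complex.conjCLE_apply, hy0.1, hy0.2,
    map_zero, mul_zero, sub_zero] at hm
  have hFm : MemLp F ⊤ (latMeasure ε) := latMeasure_memLp_of_continuousOn (hF.continuousOn h.le)
  have hym : MemLp y ⊤ (latMeasure ε) := latMeasure_memLp_of_continuousOn (hy.continuousOn h.le)
  rw [integral_add ((memLp_mul_top hg (memLp_conj hym)).integrable one_le_two)
    ((memLp_top_mul hFm (memLp_conj (Lp.memLp _))).integrable one_le_two)] at hm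
  have e1 : ∫ x, f x * conj (jet ψ.1 j.succ x) ∂(latMeasure ε)
      = ∫ x, F x * conj (ψ.1.1 j.succ x) ∂(latMeasure ε) := by
    refine integral_congr_ae ?_
    filter_upwards [hfF] with x hx
    rw [hx]
    rfl
  have e2 : ∫ x, g x * conj (jet ψ.1 j.castSucc x) ∂(latMeasure ε)
      = ∫ x, g x * conj (y x) ∂(latMeasure ε) := by
    refine integral_congr_ae ?_
    filter_upwards [hψy] with x hx
    rw [← hx]
    rfl
  rw [e1, e2]
  exact eq_neg_of_add_eq_zero_right hm

theorem exists_equiv_sobolev₀ (h : ε < Real.pi - ε) (B : sobolev ε 2 →L[ℂ] SobolevDual ε) {δ : ℝ}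
    (hδ : 0 < δ) (H : ∀ v : sobolev₀ ε 2, δ * ‖v‖ ^ 2 ≤ ‖B v.1 v‖) :
    ∃ e : sobolev₀ ε 2 ≃L[ℂ] SobolevDual ε, ∀ v : sobolev₀ ε 2, e v = B v.1 := by
  have : CompleteSpace (sobolev₀ ε 2) := (isClosed_sobolev₀ h 2 le_rfl).completeSpace_coe
  have laxMilgram := exists_equiv_of_le_norm (V := sobolev₀ ε 2)
  let ι : sobolev₀ ε 2 →L[ℂ] sobolev ε 2 := (sobolev₀ ε 2).subtypeL
  exact laxMilgram (B.comp ι) hδ H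

namespace RegularCoeff

variable {c : Fin 3 → Fin 3 → ℝ → ℂ}

theorem flux_isSobolev (h : ε < Real.pi - ε) {n : ℕ} {u : Fin 3 → ℝ → ℂ} {j : Fin 3}
    (hc : ∀ i, IsSobolev ε (n + 1) (c i j)) (hu : ∀ i, IsSobolev ε (n + 1) (u i)) :
    IsSobolev ε (n + 1) (flux c u j) :=
  IsSobolev.sum h fun i => (hc i).mul h (hu i)

/-- Functions in `H⁴_0(I')` are mapped to square integrable functions. -/
theorem exists_pairing_eq (hε : 0 < ε) (h : ε < Real.pi - ε) {r : ℝ} (hr : 0 < r)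
    (hc : RegularCoeff ε c) (Ψ : sobolev₀ ε 4) :
    ∃ F : LatL2 ε, ∀ ψ : sobolev₀ ε 2,
      coeffForm ε c (jet Ψ.1) (jet ψ.1) = pairing r ε F (jet ψ.1 0) := by
  have f0 := hc.flux_memLp h Ψ.1 0
  obtain ⟨f1, t, hft, ht⟩ := flux_isSobolev (n := 0) h (fun i => hc.one i 1) fun i =>
    jet_isSobolev (k := 2) Ψ.1 i (by omega)
  obtain ⟨f2, p, hfp, hp, s, hps, hs⟩ := flux_isSobolev (n := 1) h hc.two fun i =>
    jet_isSobolev (k := 2) Ψ.1 i (by omega)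
  change MemLp t 2 (latMeasure ε) at ht
  change MemLp s 2 (latMeasure ε) at hs
  have hw : MemLp (fun x => ((1 / (r ^ 2 * Real.sin x) : ℝ) : ℂ)) ⊤ (latMeasure ε) := by
    refine memLp_ofReal_of_continuousOn (ContinuousOn.div (by fun_prop) (by fun_prop) fun x hx => ?_)
    have := lat_sin_pos hε hx
    positivity
  -- With `s` the second derivative of flux 2 and `t` the derivative of flux 1, two and one
  -- integrations by parts give r² sin F = s - t + flux 0.
  have hF := memLp_top_mul hw ((hs.sub ht).add f0)
  refine ⟨hF.toLp _, fun ψ => ?_⟩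
  rw [hc.coeffForm_eq h (k := 2) (l := 0), Fin.sum_univ_three]
  have e1 := integral_mul_conj_jet h f1 ht hft ψ 0
  have e2 := integral_mul_conj_jet h f2 hp hfp ψ 1
  have e3 := integral_mul_conj_jet h hp hs hps ψ 0
  simp only [Fin.succ_zero_eq_one, Fin.castSucc_zero, Fin.succ_one_eq_two, Fin.castSucc_one]
    at e1 e2 e3
  rw [e1, e2, e3]
  have hv := memLp_conj (jet_memLp ψ.1 0)
  have i0 := integrable_mul_of_memLp f0 hv
  have i1 := integrable_mul_of_memLp ht hv
  have i2 := integrable_mul_of_memLp hs hv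
  rw [neg_neg, ← sub_eq_add_neg, ← integral_sub i0 i1]
  refine Eq.trans (integral_add (i0.sub i1) i2).symm ?_
  rw [pairing]
  refine integral_congr_ae ?_
  filter_upwards [hF.coeFn_toLp, ae_restrict_mem measurableSet_Ioo] with x hx hxI
  have hs : (Real.sin x : ℂ) ≠ 0 := by
    exact_mod_cast (lat_sin_pos hε (Ioo_subset_Icc_self hxI)).ne'
  have hrC : (r : ℂ) ≠ 0 := by exact_mod_cast hr.ne'
  rw [hx]
  simp only [Pi.add_apply, Pi.sub_apply]
  push_cast [-Complex.ofReal_sin]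
  field_simp
  ring

/-- Weak solutions in `H²_0(I')` with square integrable right hand side are in `H⁴(I')`. -/
theorem isSobolev_of_weak (hε : 0 < ε) (h : ε < Real.pi - ε) {r : ℝ}
    (hc : RegularCoeff ε c) (u : sobolev₀ ε 2) (F : LatL2 ε)
    (hF : ∀ ψ : sobolev₀ ε 2, coeffForm ε c (jet u.1) (jet ψ.1) = pairing r ε F (jet ψ.1 0)) :
    IsSobolev ε 2 (jet u.1 2) := by
  have hw : MemLp (fun x => ((r ^ 2 * Real.sin x : ℝ) : ℂ)) ⊤ (latMeasure ε) :=
    memLp_ofReal_of_continuousOn (by fun_prop)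
  have f0 := hc.flux_memLp h (k := 0) u.1 0
  have f1 := hc.flux_memLp h (k := 0) u.1 1
  have f2 := hc.flux_memLp h (k := 0) u.1 2
  have hG := f0.sub (memLp_top_mul hw (Lp.memLp F))
  set G : ℝ → ℂ := fun x => flux c (jet u.1) 0 x - ((r ^ 2 * Real.sin x : ℝ) : ℂ) * F x with hGdef
  have hGm : MemLp G 2 (latMeasure ε) := hG
  have hGi : IntegrableOn G (Ioo ε (Real.pi - ε)) := hGm.integrable one_le_two
  have hq := ACDeriv.primitive h.le hGi
  set q : ℝ → ℂ := fun x => ∫ t in ε..x, G t with hqdef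
  have hq1 : IsSobolev ε 1 q := .of_acDeriv (n := 0) h hq hGm
  have hqi : IntegrableOn q (Ioo ε (Real.pi - ε)) := hq1.memLp.integrable one_le_two
  have i0 : IntegrableOn (flux c (jet u.1) 0) (Ioo ε (Real.pi - ε)) := f0.integrable one_le_two
  have i1 : IntegrableOn (flux c (jet u.1) 1) (Ioo ε (Real.pi - ε)) := f1.integrable one_le_two
  have i2 : IntegrableOn (flux c (jet u.1) 2) (Ioo ε (Real.pi - ε)) := f2.integrable one_le_two
  have iF : IntegrableOn (fun x => ((r ^ 2 * Real.sin x : ℝ) : ℂ) * F x) (Ioo ε (Real.pi - ε)) :=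
    (memLp_top_mul hw (Lp.memLp F)).integrable one_le_two
  -- The primitive `q` of flux 0 - r² sin F lets the zeroth order terms be tested by φ'. The weak
  -- equation then has the second order form and yields (flux 2)' = flux 1 - q - K.
  obtain ⟨K, hK⟩ := exists_hasWeakDerivOn_of_second_order h i2 (i1.sub hqi) (by
    intro φ h1 h2 h3
    obtain ⟨ψ, hψ⟩ := exists_sobolev₀_of_testFunction h h1 h3
    have e := hF ψ
    rw [hc.coeffForm_eq h (k := 0) (l := 0), Fin.sum_univ_three] at e
    have hflux : ∀ j : Fin 3, ∫ x, flux c (jet u.1) j x * conj (jet ψ.1 j x) ∂(latMeasure ε)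
        = ∫ x in Ioo ε (Real.pi - ε), iteratedDeriv (j : ℕ) φ x • flux c (jet u.1) j x := by
      intro j
      refine integral_congr_ae ?_
      filter_upwards [hψ j] with x hx
      rw [hx, Complex.conj_ofReal, Complex.real_smul, mul_comm]
    have hp : pairing r ε F (jet ψ.1 0) = ∫ x in Ioo ε (Real.pi - ε),
        φ x • (((r ^ 2 * Real.sin x : ℝ) : ℂ) * F x) := by
      refine integral_congr_ae ?_
      filter_upwards [hψ 0] with x hx
      rw [hx, Complex.conj_ofReal, Complex.real_smul, Fin.val_zero, iteratedDeriv_zero]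
      ring
    rw [hflux, hflux, hflux, hp] at e
    have d2 : iteratedDeriv 2 φ = deriv (deriv φ) := by rw [iteratedDeriv_succ, iteratedDeriv_one]
    simp only [Fin.val_zero, Fin.val_one, Fin.val_two, iteratedDeriv_zero, iteratedDeriv_one, d2]
      at e
    have hφc := h1.continuous
    have hφd : Continuous (deriv φ) := h1.continuous_deriv (by simp)
    have e3 := hq.hasWeakDerivOn h.le φ h1 h2 h3
    have e4 : ∫ x in Ioo ε (Real.pi - ε), φ x • G x
        = (∫ x in Ioo ε (Real.pi - ε), φ x • flux c (jet u.1) 0 x)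
          - ∫ x in Ioo ε (Real.pi - ε), φ x • (((r ^ 2 * Real.sin x : ℝ) : ℂ) * F x) := by
      rw [← integral_sub (integrableOn_smul_of_continuous hφc i0)
        (integrableOn_smul_of_continuous hφc iF)]
      simp only [hGdef, smul_sub]
    have e5 : ∫ x in Ioo ε (Real.pi - ε), deriv φ x • (flux c (jet u.1) 1 - q) x
        = (∫ x in Ioo ε (Real.pi - ε), deriv φ x • flux c (jet u.1) 1 x)
          - ∫ x in Ioo ε (Real.pi - ε), deriv φ x • q x := by
      rw [← integral_sub (integrableOn_smul_of_continuous hφd i1)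
        (integrableOn_smul_of_continuous hφd hqi)]
      simp only [Pi.sub_apply, smul_sub]
    rw [e5, e3, e4]
    linear_combination e)
  have hu0 : IsSobolev ε 2 (jet u.1 0) := jet_isSobolev (k := 0) u.1 0 (by norm_num)
  have hu1 : IsSobolev ε 1 (jet u.1 1) := jet_isSobolev (k := 0) u.1 1 (by norm_num)
  have hder : ∀ n, IsSobolev ε n (flux c (jet u.1) 1) → IsSobolev ε n q →
      IsSobolev ε (n + 1) (flux c (jet u.1) 2) := fun n h1 h2 =>
    ⟨f2, _, hK, (h1.sub hε h h2).sub hε h (.const hε h K n)⟩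
  obtain ⟨d, hd, hd1⟩ := hc.exists_inv
  -- The leading coefficient is invertible, so u'' is recovered from flux 2 and lower derivatives
  -- and inherits the regularity of flux 2.
  have hsolve : ∀ᵐ x ∂(latMeasure ε), d x * (flux c (jet u.1) 2 x - c 0 2 x * jet u.1 0 x
      - c 1 2 x * jet u.1 1 x) = jet u.1 2 x := by
    filter_upwards [hd1] with x hx
    simp only [flux, Fin.sum_univ_three]
    linear_combination jet u.1 2 x * hx
  -- First round of the bootstrap: flux 1 is in L², so flux 2 and u'' are in H¹. Then flux 1 is in
  -- H¹, and the final step repeats the argument one order higher.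
  have h1 : IsSobolev ε 1 (jet u.1 2) :=
    (hd.of_succ.mul h (((hder 0 f1 hq1.memLp).sub hε h ((hc.two 0).of_succ.mul h hu0.of_succ)).sub
      hε h ((hc.two 1).of_succ.mul h hu1))).congr hsolve
  have hu : ∀ i, IsSobolev ε 1 (jet u.1 i) := by
    intro i
    fin_cases i
    · exact hu0.of_succ
    · exact hu1
    · exact h1
  have hu1' : IsSobolev ε 2 (jet u.1 1) := ⟨hu1.memLp, _, u.1.2 1, h1⟩
  exact (hd.mul h (((hder 1 (flux_isSobolev (n := 0) h (fun i => hc.one i 1) hu) hq1).sub hε h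
    ((hc.two 0).mul h hu0)).sub hε h ((hc.two 1).mul h hu1'))).congr hsolve

/-- Only u and u' are constrained in H⁴_0(I'), so the boundary conditions carry over unchanged. -/
theorem exists_lift {i : sobolev₀ ε 4 →L[ℂ] sobolev₀ ε 2}
    (hi : ∀ (Ψ : sobolev₀ ε 4) (j : Fin 3), (i Ψ).1.1 j = Ψ.1.1 (Fin.castLE (by norm_num) j))
    (u : sobolev₀ ε 2) (hu : IsSobolev ε 2 (jet u.1 2)) : ∃ Ψ, i Ψ = u := by
  obtain ⟨h2, g₃, h3, hg3, g₄, h4, hg4⟩ := hu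
  change MemLp g₄ 2 (latMeasure ε) at hg4
  let f : ℕ → ℝ → ℂ := fun j =>
    match j with
    | 0 => u.1.1 0
    | 1 => u.1.1 1
    | 2 => u.1.1 2
    | 3 => g₃
    | _ => g₄
  obtain ⟨Ψ, hΨ⟩ := exists_sobolev (ε := ε) (k := 4) f
    (fun j hj => by
      interval_cases j
      · exact Lp.memLp _
      · exact Lp.memLp _
      · exact Lp.memLp _
      · exact hg3
      · exact hg4)
    (fun j hj => by
      interval_cases j
      · exact u.1.2 0
      · exact u.1.2 1
      · exact h3
      · exact h4)
  have hb : Ψ ∈ sobolev₀ ε 4 := by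
    intro j hj
    fin_cases j
    · exact (u.2 0 (by norm_num)).congr (hΨ 0)
    · exact (u.2 1 (by norm_num)).congr (hΨ 1)
    all_goals simp at hj
  refine ⟨⟨Ψ, hb⟩, sobolev₀_ext fun j => ?_⟩
  rw [hi]
  fin_cases j
  · exact hΨ 0
  · exact hΨ 1
  · exact hΨ 2

/-- The operator of the form restricts to an isomorphism `H⁴_0(I') → L²(I')`. -/
theorem exists_equiv (hε : 0 < ε) (h : ε < Real.pi - ε) {r : ℝ} (hr : 0 < r)
    (hc : RegularCoeff ε c) (B : sobolev₀ ε 2 ≃L[ℂ] SobolevDual ε)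
    (hB : ∀ u ψ : sobolev₀ ε 2, B u ψ = coeffForm ε c (jet u.1) (jet ψ.1)) :
    ∃ e : sobolev₀ ε 4 ≃L[ℂ] LatL2 ε, ∀ (Ψ : sobolev₀ ε 4) (ψ : sobolev₀ ε 2),
      coeffForm ε c (jet Ψ.1) (jet ψ.1) = pairing r ε (e Ψ) (jet ψ.1 0) := by
  obtain ⟨i, hi⟩ := exists_inclusion ε
  obtain ⟨J, hJ⟩ := exists_pairing_operator r ε
  have hjet : ∀ Ψ : sobolev₀ ε 4, jet (i Ψ).1 = jet Ψ.1 := fun Ψ => by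
    funext j
    exact congrArg (fun f : LatL2 ε => (f : ℝ → ℂ)) (hi Ψ j)
  have : CompleteSpace (sobolev₀ ε 4) := (isClosed_sobolev₀ h 4 (by norm_num)).completeSpace_coe
  have closedGraph := exists_equiv_of_exists (X := sobolev₀ ε 4) (Y := LatL2 ε)
    (V := sobolev₀ ε 2) (D := SobolevDual ε)
  obtain ⟨e, he⟩ := closedGraph i J B (inclusion_injective hi)
    ((injective_iff_map_eq_zero J).2 fun F hF => eq_zero_of_pairing_eq_zero hε h hr F fun ψ => by
      rw [← hJ, hF]; rfl)
    (fun Ψ => by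
      obtain ⟨F, hF⟩ := hc.exists_pairing_eq hε h hr Ψ
      refine ⟨F, ?_⟩
      ext ψ
      rw [hB, hJ, hjet]
      exact hF ψ)
    (fun F => by
      obtain ⟨Ψ, hΨ⟩ := exists_lift hi (B.symm (J F)) (hc.isSobolev_of_weak hε h (r := r) _ F
        fun ψ => by rw [← hB, B.apply_symm_apply, hJ])
      exact ⟨Ψ, by rw [hΨ, B.apply_symm_apply]⟩)
  refine ⟨e, fun Ψ ψ => ?_⟩
  rw [← hjet, ← hB, he, hJ]

end RegularCoeff

/-! ### Regularity of the coefficients of the wave form -/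

theorem contDiffOn_lapCoeff (m : ℤ) (i : Fin 3) :
    ContDiffOn ℝ (⊤ : ℕ∞) (lapCoeff m i) (Ioo 0 Real.pi) := by
  have h0 : ∀ x ∈ Ioo 0 Real.pi, Real.sin x ≠ 0 := fun x hx => (Real.sin_pos_of_mem_Ioo hx).ne'
  fin_cases i
  · exact (contDiffOn_const.div (Real.contDiff_sin.contDiffOn.pow 2)
      fun x hx => pow_ne_zero 2 (h0 x hx)).neg
  · exact Real.contDiff_cos.contDiffOn.div Real.contDiff_sin.contDiffOn h0
  · exact contDiffOn_const

theorem contDiffOn_gradCoeff (m : ℤ) (i j : Fin 3) :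
    ContDiffOn ℝ (⊤ : ℕ∞) (gradCoeff m i j) (Ioo 0 Real.pi) := by
  have h0 : ∀ x ∈ Ioo 0 Real.pi, Real.sin x ≠ 0 := fun x hx => (Real.sin_pos_of_mem_Ioo hx).ne'
  fin_cases i <;> fin_cases j <;> simp only [gradCoeff] <;>
    first
    | exact contDiffOn_const
    | exact Real.contDiff_sin.contDiffOn
    | exact contDiffOn_const.div Real.contDiff_sin.contDiffOn h0

variable {r γ ω Ωref : ℝ} {m : ℤ} {Ω Ω₁ : ℝ → ℝ}

theorem waveCoeff_isSobolev (hε : 0 < ε) (h : ε < Real.pi - ε) {n : ℕ}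
    (hΩ : IsSobolev ε n fun x => (Ω x : ℂ)) {i j : Fin 3}
    (hv : IsSobolev ε n fun x => (vorticityCoeff Ω Ω₁ i j x : ℂ)) :
    IsSobolev ε n (waveCoeff r γ ω Ωref m Ω Ω₁ i j) := by
  have ha : IsSobolev ε n fun x => (advectionCoeff m Ωref Ω i j x : ℂ) := by
    have h0 : IsSobolev ε n fun x => (((0 : ℝ → ℝ) x : ℝ) : ℂ) :=
      .ofReal_of_contDiffOn hε h contDiffOn_const n
    fin_cases j
    · have hs : ContDiffOn ℝ (⊤ : ℕ∞) (fun x => Real.sin x * lapCoeff m i x) (Ioo 0 Real.pi) :=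
        Real.contDiff_sin.contDiffOn.mul (contDiffOn_lapCoeff m i)
      refine ((IsSobolev.ofReal_of_contDiffOn hε h hs (n + 1)).mul_succ h
        (hΩ.sub hε h (.const hε h Ωref n))).congr (Eventually.of_forall fun x => ?_)
      simp only [advectionCoeff, Fin.zero_eta, Matrix.cons_val_zero]
      push_cast
      ring
    · exact h0
    · exact h0
  have hl : ContDiffOn ℝ (⊤ : ℕ∞) (fun x => γ / r ^ 2 * Real.sin x * lapCoeff m i x * lapCoeff m j x)
      (Ioo 0 Real.pi) :=
    ((contDiffOn_const.mul Real.contDiff_sin.contDiffOn).mul (contDiffOn_lapCoeff m i)).mul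
      (contDiffOn_lapCoeff m j)
  exact (((IsSobolev.ofReal_of_contDiffOn hε h hl n).sub hε h
    ((IsSobolev.ofReal_of_contDiffOn hε h (contDiffOn_gradCoeff m i j) n).const_mul hε h _)).sub hε h
    (hv.const_mul hε h _)).sub hε h (ha.const_mul hε h _)

/-- On I' the cotangent is bounded, so subtracting cot Ω' from the square integrable Laplacian
leaves Ω'' in L². -/
theorem ZonalH2.isSobolev (hε : 0 < ε) (h : ε < Real.pi - ε) {Ω₂ : ℝ → ℝ}
    (hΩ : ZonalH2 Ω Ω₁ Ω₂) :
    IsSobolev ε 2 (fun x => (Ω x : ℂ)) ∧ IsSobolev ε 1 (fun x => (Ω₁ x : ℂ)) := by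
  have h0 := hΩ.memH1.memL2.memLp hε h
  have h1 := hΩ.memH1.deriv_memL2.memLp hε h
  have h2 : MemLp Ω₂ 2 (latMeasure ε) := by
    have hk := memLp_mul_continuousOn h1 (continuousOn_lapCoeff hε 0 1)
    refine ((hΩ.laplacian_memL2.memLp hε h).sub hk).ae_eq (Eventually.of_forall fun x => ?_)
    simp only [Pi.sub_apply, lapCoeff, Matrix.cons_val_one, Matrix.cons_val_zero]
    ring
  have k1 : IsSobolev ε 1 (fun x => (Ω₁ x : ℂ)) :=
    .ofReal_of_weakDeriv (n := 0) h h1 h2 (hΩ.weakDeriv₂.mono hε.le (by linarith)) (memLp_ofReal h2)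
  exact ⟨.ofReal_of_weakDeriv h h0 h1 (hΩ.memH1.weakDeriv.mono hε.le (by linarith)) k1, k1⟩

theorem waveCoeff_isSobolev_one (hε : 0 < ε) (h : ε < Real.pi - ε) {Ω₂ : ℝ → ℝ}
    (hΩ : ZonalH2 Ω Ω₁ Ω₂) (i j : Fin 3) :
    IsSobolev ε 1 (waveCoeff r γ ω Ωref m Ω Ω₁ i j) := by
  obtain ⟨h2, h1⟩ := hΩ.isSobolev hε h
  refine waveCoeff_isSobolev hε h h2.of_succ ?_
  have hv : IsSobolev ε 1 fun x => ((Ω₁ x * Real.sin x + 2 * Ω x * Real.cos x : ℝ) : ℂ) := by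
    refine ((h1.mul h (.ofReal_of_contDiffOn hε h Real.contDiff_sin.contDiffOn 1)).add h
      ((h2.of_succ.const_mul hε h 2).mul h
        (.ofReal_of_contDiffOn hε h Real.contDiff_cos.contDiffOn 1))).congr
      (Eventually.of_forall fun x => ?_)
    push_cast
    ring
  have h0 : IsSobolev ε 1 fun x => (((0 : ℝ → ℝ) x : ℝ) : ℂ) :=
    .ofReal_of_contDiffOn hε h contDiffOn_const 1
  fin_cases i <;> fin_cases j <;> simp only [vorticityCoeff] <;>
    first
    | exact h0
    | exact hv

/-- The vorticity coefficients involve Ω', hence are only in H¹, but have no entry with an index 2.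
There Ω occurs only through the advection coefficient of u'' conj v. Row and column are both needed,
because the adjoint transposes the matrix. -/
theorem waveCoeff_isSobolev_two (hε : 0 < ε) (h : ε < Real.pi - ε) {Ω₂ : ℝ → ℝ}
    (hΩ : ZonalH2 Ω Ω₁ Ω₂) (i : Fin 3) :
    IsSobolev ε 2 (waveCoeff r γ ω Ωref m Ω Ω₁ i 2) ∧
      IsSobolev ε 2 (waveCoeff r γ ω Ωref m Ω Ω₁ 2 i) := by
  obtain ⟨h2, -⟩ := hΩ.isSobolev hε h
  have h0 : IsSobolev ε 2 fun x => (((0 : ℝ → ℝ) x : ℝ) : ℂ) :=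
    .ofReal_of_contDiffOn hε h contDiffOn_const 2
  constructor <;> refine waveCoeff_isSobolev hε h h2 ?_ <;> fin_cases i <;> exact h0

theorem waveCoeff_two_two (x : ℝ) :
    waveCoeff r γ ω Ωref m Ω Ω₁ 2 2 x = ((γ / r ^ 2 * Real.sin x : ℝ) : ℂ) := by
  simp [waveCoeff, gradCoeff, vorticityCoeff, advectionCoeff, lapCoeff]

theorem exists_isSobolev_inv (hε : 0 < ε) (h : ε < Real.pi - ε) (hr : 0 < r) (hγ : 0 < γ) :
    ∃ d, IsSobolev ε 2 d ∧
      ∀ᵐ x ∂(latMeasure ε), d x * ((γ / r ^ 2 * Real.sin x : ℝ) : ℂ) = 1 := by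
  refine ⟨fun x => ((r ^ 2 / γ / Real.sin x : ℝ) : ℂ), .ofReal_of_contDiffOn hε h
    (contDiffOn_const.div Real.contDiff_sin.contDiffOn fun x hx =>
      (Real.sin_pos_of_mem_Ioo hx).ne') 2, ?_⟩
  filter_upwards [ae_restrict_mem measurableSet_Ioo] with x hx
  have := lat_sin_pos hε (Ioo_subset_Icc_self hx)
  rw [← Complex.ofReal_mul, ← Complex.ofReal_one]
  congr 1
  field_simp

theorem regularCoeff_waveCoeff (hε : 0 < ε) (h : ε < Real.pi - ε) (hr : 0 < r) (hγ : 0 < γ)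
    {Ω₂ : ℝ → ℝ} (hΩ : ZonalH2 Ω Ω₁ Ω₂) : RegularCoeff ε (waveCoeff r γ ω Ωref m Ω Ω₁) := by
  refine ⟨waveCoeff_isSobolev_one hε h hΩ, fun i => (waveCoeff_isSobolev_two hε h hΩ i).1, ?_⟩
  simp only [waveCoeff_two_two]
  exact exists_isSobolev_inv hε h hr hγ

theorem regularCoeff_adjoint_waveCoeff (hε : 0 < ε) (h : ε < Real.pi - ε) (hr : 0 < r)
    (hγ : 0 < γ) {Ω₂ : ℝ → ℝ} (hΩ : ZonalH2 Ω Ω₁ Ω₂) :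
    RegularCoeff ε (adjointCoeff (waveCoeff r γ ω Ωref m Ω Ω₁)) := by
  refine ⟨fun i j => (waveCoeff_isSobolev_one hε h hΩ j i).conjugate h,
    fun i => (waveCoeff_isSobolev_two hε h hΩ i).2.conjugate h, ?_⟩
  simp only [adjointCoeff, waveCoeff_two_two, Complex.conj_ofReal]
  exact exists_isSobolev_inv hε h hr hγ

end LiftedRegularity

end InertialWave

/-! ### Assembly of the proposition -/

open InertialWave
theorem proposition3p9
    (r ε γ ω Ωref : ℝ) (hr : 0 < r) (hε : 0 < ε) (hε' : ε < Real.pi / 2) (hγ : 0 < γ)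
    (m : ℤ) (Ω Ω₁ : ℝ → ℝ) (hΩ : ZonalH1 Ω Ω₁)
    (hcond : LargeFrequency r γ ω Ωref Ω Ω₁ ∨ SmallShear r γ m Ω₁) :
    -- `Bfull : H²(I') → H⁻²(I')`, its restriction `B` to `H²_0(I')`, and the adjoint `Bstar`
    ∃ (Bfull : sobolev ε 2 →L[ℂ] SobolevDual ε) (B Bstar : sobolev₀ ε 2 ≃L[ℂ] SobolevDual ε),
      (∀ (u : sobolev ε 2) (ψ : sobolev₀ ε 2),
        Bfull u ψ = waveForm r ε γ ω Ωref m Ω Ω₁ (jet u) (jet ψ.1)) ∧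
      (∀ Ψ : sobolev₀ ε 2, B Ψ = Bfull Ψ.1) ∧
      (∀ Ψ ψ : sobolev₀ ε 2, Bstar Ψ ψ = conj (B ψ Ψ)) ∧
      -- the solution with prescribed Cauchy data
      (∀ (f : SobolevDual ε) (a b : Fin 2 → ℂ), ∃ Ψ : sobolev ε 2,
        IsWaveSolution r ε γ ω Ωref m Ω Ω₁ f a b Ψ ∧
        (∀ Φ : sobolev ε 2, IsWaveSolution r ε γ ω Ωref m Ω Ω₁ f a b Φ → Φ = Ψ) ∧
        ∀ u : ℝ → ℂ, ContDiffOn ℝ (⊤ : ℕ∞) u (Ioo 0 Real.pi) →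
          u ε = a 0 → u (Real.pi - ε) = a 1 →
          deriv u ε = b 0 → deriv u (Real.pi - ε) = b 1 →
          ∃ U : sobolev ε 2,
            (∀ j : Fin 3, U.1 j =ᵐ[latMeasure ε] iteratedDeriv (j : ℕ) u) ∧
            Ψ = (B.symm (f - Bfull U)).1 + U) ∧
      -- lifted regularity
      (∀ Ω₂ : ℝ → ℝ, ZonalH2 Ω Ω₁ Ω₂ →
        ∃ B₄ B₄star : sobolev₀ ε 4 ≃L[ℂ] LatL2 ε,
          (∀ (Ψ : sobolev₀ ε 4) (ψ : sobolev₀ ε 2),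
            waveForm r ε γ ω Ωref m Ω Ω₁ (jet Ψ.1) (jet ψ.1)
              = pairing r ε (B₄ Ψ) (jet ψ.1 0)) ∧
          (∀ (Ψ : sobolev₀ ε 4) (ψ : sobolev₀ ε 2),
            conj (waveForm r ε γ ω Ωref m Ω Ω₁ (jet ψ.1) (jet Ψ.1))
              = pairing r ε (B₄star Ψ) (jet ψ.1 0))) := by
  have h : ε < Real.pi - ε := by linarith
  have hΩm := hΩ.memL2.memLp hε h
  have hΩ₁m := hΩ.deriv_memL2.memLp hε h
  have hadm := waveCoeff_admissible hε r γ ω Ωref m hΩm hΩ₁m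
  have hform : ∀ {k l : ℕ} (u : sobolev ε (k + 2)) (v : sobolev ε (l + 2)), _ := fun u v =>
    waveForm_eq_coeffForm hε h hr γ ω Ωref m hΩm hΩ₁m u v
  obtain ⟨Bfull, hfull⟩ := hadm.exists_operator h
  obtain ⟨Bad, had⟩ := hadm.adjoint.exists_operator h
  obtain ⟨c, hc, hcoer⟩ := waveForm_coercive hε h hr hγ m hΩ hcond
  obtain ⟨B, hB⟩ := exists_equiv_sobolev₀ h Bfull hc fun v => by
    refine (hcoer v).trans (le_of_eq ?_)
    rw [hform (k := 0) (l := 0), hfull]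
  -- The adjoint form has the conjugate diagonal, so it satisfies the same lower bound with the same
  -- constant.
  obtain ⟨Bstar, hBstar⟩ := exists_equiv_sobolev₀ h Bad hc fun v => by
    refine (hcoer v).trans (le_of_eq ?_)
    rw [hform (k := 0) (l := 0), ← RCLike.norm_conj, conj_coeffForm, had]
  have hB' : ∀ u ψ : sobolev₀ ε 2, B u ψ
      = coeffForm ε (waveCoeff r γ ω Ωref m Ω Ω₁) (jet u.1) (jet ψ.1) := fun u ψ => by
    rw [hB, hfull]
  have hBstar' : ∀ u ψ : sobolev₀ ε 2, Bstar u ψ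
      = coeffForm ε (adjointCoeff (waveCoeff r γ ω Ωref m Ω Ω₁)) (jet u.1) (jet ψ.1) := fun u ψ => by
    rw [hBstar, had]
  have hfull' : ∀ (u : sobolev ε 2) (ψ : sobolev₀ ε 2),
      Bfull u ψ = waveForm r ε γ ω Ωref m Ω Ω₁ (jet u) (jet ψ.1) := fun u ψ => by
    rw [hform (k := 0) (l := 0), hfull]
  have hBB : ∀ Ψ : sobolev₀ ε 2, B Ψ = Bfull Ψ.1 := hB
  refine ⟨Bfull, B, Bstar, hfull', hBB, fun Ψ ψ => ?_,
    fun f a b => exists_isWaveSolution hε h Bfull B hfull' hBB f a b, fun Ω₂ hΩ₂ => ?_⟩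
  · rw [hBstar', hB', conj_coeffForm]
  · obtain ⟨B₄, hB₄⟩ := (regularCoeff_waveCoeff hε h hr hγ hΩ₂).exists_equiv hε h hr B hB'
    obtain ⟨B₄star, hB₄star⟩ :=
      (regularCoeff_adjoint_waveCoeff hε h hr hγ hΩ₂).exists_equiv hε h hr Bstar hBstar'
    refine ⟨B₄, B₄star, fun Ψ ψ => ?_, fun Ψ ψ => ?_⟩
    · rw [hform (k := 2) (l := 0), hB₄]
    · rw [hform (k := 0) (l := 2), conj_coeffForm, hB₄star]
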